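/- Let $n_1,n_2,\varkappa\ge 1$ be integers, write $x=(x',x'')\in\mathbb R^{n_1}\times\mathbb R^{n_2}$, let $|\cdot|$ denote Lebesgue measure of sets, and put $Q=n_1+(1+\varkappa)n_2$. Let $V(x')=|x'|^{2\varkappa}$ or $V(x')=\sum_{j}(x_j')^{2\varkappa}$, and let $G_\varkappa=-\Delta_{x'}-V(x')\Delta_{x''}$ be the Grushin operator, i.e. the non-negative self-adjoint operator on $L^2(\mathbb R^{n_1+n_2})$ that is the closure of this differential operator on $C_c^\infty$. Let $X=(X_j,X_{\alpha,k})$, where $X_j=\partial_{x'_j}$ and $X_{\alpha,k}=x'^{\alpha}\partial_{x''_k}$ for $1\le j\le n_1$, $1\le k\le n_2$, $\alpha\in\mathbb N^{n_1}$, $|\alpha|=\varkappa$. Let $$d(x,y)=|x'-y'|+\begin{cases}\dfrac{|x''-y''|}{(|x'|+|y'|)^{\varkappa}} & \text{if } |x''-y''|^{1/(1+\varkappa)}\le |x'|+|y'|,\\[1ex] |x''-y''|^{1/(1+\varkappa)} & \text{otherwise,}\end{cases}$$ and $B(x,r)=\{y: d(x,y)<r\}$. Let $\chi_0(G_\varkappa)$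 be the spectral projection of $G_\varkappa$ for $[0,1)$, and $\chi_j(G_\varkappa)$, $j\ge1$, that for $[2^{j-1},2^j)$. A dyadic decomposition of $(\mathbb R^{n_1+n_2},d,|\cdot|)$ with parameters $0<h_1\le h_2$ and $0<\varepsilon_0,\delta_0<1$ is a family $\mathcal D=\bigcup_{k\in\mathbb Z}\mathcal D_k$ of measurable sets such that: the members of each $\mathcal D_k$ cover almost all of $\mathbb R^{n_1+n_2}$; for $k\ge l$, $P\in\mathcal D_k$, $R\in\mathcal D_l$, either $P\cap R=\emptyset$ or $P\subset R$; every $P\in\mathcal D_k$ contains at least one member of $\mathcal D_{k+1}$ and is contained in exactly one member of $\mathcal D_{k-1}$; if $P'\in\mathcal D_{k+1}$ is contained in $P\in\mathcal D_k$, then $|P'|\ge\varepsilon_0|P|$; and for every $P\in\mathcal D_k$ there is a point $c_P$ with $B(c_P,h_1\delta_0^k)\subset P\subset B(c_P,h_2\delta_0^k)$. A family $S$ of measurable sets is $\eta$-sparse if there are pairwise disjoint measurable sets $E_P\subset P$ ($P\in S$) with $|E_P|\ge\eta|P|$, and $\mathcal A_Sf(x)=\sum_{P\in S}\big(\frac1{|P|}\int_P|f|\big)\chi_P(x)$.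 **Theorem.** There are finitely many dyadic decompositions of $(\mathbb R^{n_1+n_2},d,|\cdot|)$ with common parameters, whose union we denote by $\mathcal S$, and a number $0<\eta<1$, all depending only on $n_1,n_2,\varkappa$, with the following property. Let $T$ be a bounded operator on $L^2(\mathbb R^{n_1+n_2})$, and let $T_j=T\circ\chi_j(G_\varkappa)$, $j\in\mathbb N$, have integral kernels $T_j(x,y)$ for which the derivatives below exist. Suppose that for some $R_0\ge Q+\frac12$ there is a constant $C$ such that for all $\mathfrak r\in[0,R_0]$, $j\in\mathbb N$ and $x,y\in\mathbb R^{n_1+n_2}$, $$|B(x,2^{-j/2})|^{1/2}|B(y,2^{-j/2})|^{1/2}d(x,y)^{\mathfrak r}|T_j(x,y)|\le C\,2^{-j\mathfrak r/2},$$ $$|B(x,2^{-j/2})|^{1/2}|B(y,2^{-j/2})|^{1/2}d(x,y)^{\mathfrak r}|X_yT_j(x,y)|\le C\,2^{-j\mathfrak r/2}2^{j/2},$$ and that for some $R_1>Q$ and every $\mathcal K_0>0$ there is a constant $C_{\mathcal K_0}$ such that for all $\mathfrak r\in[0,R_1]$, $j\in\mathbb N$ and all $x,y$ with $d(x,y)<\mathcal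 K_0$, $$|B(x,2^{-j/2})|^{1/2}|B(y,2^{-j/2})|^{1/2}d(x,y)^{\mathfrak r}|X_xT_j(x,y)|\le C_{\mathcal K_0}\,2^{-j\mathfrak r/2}2^{j/2}.$$ Then there is a constant $C_T$ such that for every compactly supported bounded measurable function $f$ there exists an $\eta$-sparse family $S\subset\mathcal S$ with $$|Tf(x)|\le C_T\,\mathcal A_Sf(x)\qquad\text{for almost every }x\in\mathbb R^{n_1+n_2}.$$ -/

import Mathlib

open MeasureTheory Set
open scoped ENNReal NNReal ContDiff

noncomputable section

namespace Grushin

/-- The underlying space `ℝ^{n₁+n₂} = ℝ^{n₁} × ℝ^{n₂}`; a point is `x = (x', x'') = (x.1, x.2)`,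
each factor carrying its Euclidean norm.  Its `volume` is Lebesgue measure. -/
abbrev Space (n₁ n₂ : ℕ) : Type :=
  EuclideanSpace ℝ (Fin n₁) × EuclideanSpace ℝ (Fin n₂)

/-- The complex Hilbert space `L²(ℝ^{n₁+n₂})`. -/
abbrev L2 (n₁ n₂ : ℕ) : Type :=
  Lp ℂ 2 (volume : Measure (Space n₁ n₂))

/-- The homogeneous dimension `Q = n₁ + (1 + ϰ) n₂`. -/
def homDim (n₁ n₂ κ : ℕ) : ℝ := n₁ + (1 + κ) * n₂

variable {n₁ n₂ : ℕ}

/-! ### The Grushin distance and its balls -/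

/-- The Grushin (quasi-)distance
`d(x,y) = |x'-y'| + |x''-y''| / (|x'|+|y'|)^ϰ` if `|x''-y''|^{1/(1+ϰ)} ≤ |x'|+|y'|`, and
`d(x,y) = |x'-y'| + |x''-y''|^{1/(1+ϰ)}` otherwise.
(If `|x'|+|y'| = 0` in the first case then `x'' = y''` and the quotient is `0 / 0 = 0`.) -/
def dist (κ : ℕ) (x y : Space n₁ n₂) : ℝ :=
  ‖x.1 - y.1‖ +
    if ‖x.2 - y.2‖ ^ (1 / (1 + κ : ℝ)) ≤ ‖x.1‖ + ‖y.1‖ then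
      ‖x.2 - y.2‖ / (‖x.1‖ + ‖y.1‖) ^ κ
    else ‖x.2 - y.2‖ ^ (1 / (1 + κ : ℝ))

/-- The ball `B(x,r) = {y : d(x,y) < r}`. -/
def ball (κ : ℕ) (x : Space n₁ n₂) (r : ℝ) : Set (Space n₁ n₂) :=
  {y | dist κ x y < r}

/-- The Lebesgue measure `|B(x,r)|`. -/
def ballVol (κ : ℕ) (x : Space n₁ n₂) (r : ℝ) : ℝ :=
  (volume : Measure (Space n₁ n₂)).real (ball κ x r)

/-! ### The gradient vector fields -/

/-- The vector field `X_j = ∂/∂x'_j`. -/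
def fieldX (j : Fin n₁) : Space n₁ n₂ → Space n₁ n₂ :=
  fun _ => (EuclideanSpace.single j 1, 0)

/-- The vector field `X_{α,k} = x'^α ∂/∂x''_k`. -/
def fieldXX (α : Fin n₁ → ℕ) (k : Fin n₂) : Space n₁ n₂ → Space n₁ n₂ :=
  fun x => (0, (∏ i, x.1 i ^ α i) • EuclideanSpace.single k 1)

/-- The multi-indices `α ∈ ℕ^{n₁}` with `|α| = ϰ`. -/
def multiIndices (n₁ κ : ℕ) : Finset (Fin n₁ → ℕ) :=
  Finset.piAntidiag Finset.univ κ

/-- `f` has, at every point, a derivative along each of the fields `X_j` and `X_{α,k}`, `|α| = ϰ`.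
Every (real) differentiable function has this property. -/
def XDifferentiable (κ : ℕ) (f : Space n₁ n₂ → ℂ) : Prop :=
  ∀ x, (∀ j, LineDifferentiableAt ℝ f x (fieldX j x)) ∧
    ∀ α ∈ multiIndices n₁ κ, ∀ k, LineDifferentiableAt ℝ f x (fieldXX α k x)

/-- The Euclidean length `|X f (x)|` of the gradient vector `X f = (X_j f, X_{α,k} f)`. -/
def normX (κ : ℕ) (f : Space n₁ n₂ → ℂ) (x : Space n₁ n₂) : ℝ :=
  Real.sqrt (∑ j, ‖lineDeriv ℝ f x (fieldX j x)‖ ^ 2 +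
    ∑ α ∈ multiIndices n₁ κ, ∑ k, ‖lineDeriv ℝ f x (fieldXX α k x)‖ ^ 2)

/-! ### The Grushin operator and its spectral projections -/

/-- The two admissible potentials: `V(x') = |x'|^{2ϰ}` or `V(x') = ∑_j (x'_j)^{2ϰ}`. -/
def IsPotential (κ : ℕ) (V : EuclideanSpace ℝ (Fin n₁) → ℝ) : Prop :=
  (V = fun u => ‖u‖ ^ (2 * κ)) ∨ (V = fun u => ∑ j, u j ^ (2 * κ))

/-- The differential operator `G φ = - Δ_{x'} φ - V(x') Δ_{x''} φ`. -/
def grushinOp (V : EuclideanSpace ℝ (Fin n₁) → ℝ) (φ : Space n₁ n₂ → ℂ) (x : Space n₁ n₂) : ℂ :=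
  - Laplacian.laplacian (fun u => φ (u, x.2)) x.1
    - (V x.1 : ℂ) * Laplacian.laplacian (fun v => φ (x.1, v)) x.2

/-- The graph, in the Hilbert space `L² ⊕ L²`, of the closure of `G` on `C_c^∞(ℝ^{n₁+n₂})`.
The operator `G` is essentially self-adjoint and non-negative on `C_c^∞`, so this is the graph of
the self-adjoint operator `G`. -/
def grushinGraph (V : EuclideanSpace ℝ (Fin n₁) → ℝ) :
    Submodule ℂ (WithLp 2 (L2 n₁ n₂ × L2 n₁ n₂)) :=
  (Submodule.span ℂ
    {p | ∃ φ : Space n₁ n₂ → ℂ, ContDiff ℝ ∞ φ ∧ HasCompactSupport φ ∧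
      p.fst =ᵐ[volume] φ ∧ p.snd =ᵐ[volume] grushinOp V φ}).topologicalClosure

section HilbertSpace

variable {H : Type*} [NormedAddCommGroup H] [InnerProductSpace ℂ H] [CompleteSpace H]

/-- The isometric embedding `f ↦ (f, 0)` of `H` into `H ⊕ H`. -/
def inlH : H →L[ℂ] WithLp 2 (H × H) :=
  ((WithLp.prodContinuousLinearEquiv 2 ℂ H H).symm : (H × H) →L[ℂ] WithLp 2 (H × H)) ∘L
    ContinuousLinearMap.inl ℂ H H

/-- For a closed subspace `Γ` of `H ⊕ H` that is the graph of a closed densely defined operator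
`A`, this is the bounded operator `(1 + A* A)⁻¹`: the orthogonal projection of `(f, 0)` to `Γ` is
`(u, A u)` where `u + A* A u = f`. -/
def invOneAddSq (Γ : Submodule ℂ (WithLp 2 (H × H))) [Γ.HasOrthogonalProjection] : H →L[ℂ] H :=
  ContinuousLinearMap.adjoint inlH ∘L Γ.starProjection ∘L inlH

theorem isSelfAdjoint_invOneAddSq (Γ : Submodule ℂ (WithLp 2 (H × H)))
    [Γ.HasOrthogonalProjection] : IsSelfAdjoint (invOneAddSq Γ) :=
  (isSelfAdjoint_starProjection Γ).adjoint_conj inlH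

/-- For `Γ` the graph of a non-negative self-adjoint operator `A` and `b > 0`, this is the spectral
projection `1_{[0,b)}(A)`.  Indeed `A < b` if and only if `(1 + A²)⁻¹ > (1 + b²)⁻¹`, and the
spectral projection of a bounded self-adjoint operator `R` for `(t, ∞)` is the orthogonal
projection onto the closure of the range of the positive part `(R - t)⁺`. -/
def spectralCutoff (Γ : Submodule ℂ (WithLp 2 (H × H))) [Γ.HasOrthogonalProjection] (b : ℝ) :
    H →L[ℂ] H :=
  (LinearMap.range
    (cfc (fun s : ℝ => max (s - (1 + b ^ 2)⁻¹) 0) (invOneAddSq Γ) : H →L[ℂ] H).toLinearMap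
    ).topologicalClosure.starProjection

end HilbertSpace

instance hasOrthogonalProjection_grushinGraph (V : EuclideanSpace ℝ (Fin n₁) → ℝ) :
    (grushinGraph (n₂ := n₂) V).HasOrthogonalProjection := by
  unfold grushinGraph; infer_instance

/-- The dyadic spectral projections `χ_j(G)`: `χ_0(G) = 1_{[0,1)}(G)` and
`χ_j(G) = 1_{[2^{j-1},2^j)}(G)` for `j ≥ 1`. -/
def dyadicProj (n₂ : ℕ) (V : EuclideanSpace ℝ (Fin n₁) → ℝ) : ℕ → (L2 n₁ n₂ →L[ℂ] L2 n₁ n₂)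
  | 0 => spectralCutoff (grushinGraph V) 1
  | j + 1 => spectralCutoff (grushinGraph V) (2 ^ (j + 1)) - spectralCutoff (grushinGraph V) (2 ^ j)

/-! ### Integral kernels and the kernel conditions -/

/-- Bounded (Lebesgue) measurable functions with compact support. -/
structure IsBddCompactSupp (f : Space n₁ n₂ → ℂ) : Prop where
  meas : AEStronglyMeasurable f volume
  bdd : ∃ M : ℝ, ∀ x, ‖f x‖ ≤ M
  supp : HasCompactSupport f

theorem IsBddCompactSupp.memLp {f : Space n₁ n₂ → ℂ} (hf : IsBddCompactSupp f) :
    MemLp f 2 volume := by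
  obtain ⟨M, hM⟩ := hf.bdd
  have hfin : IsFiniteMeasure ((volume : Measure (Space n₁ n₂)).restrict (tsupport f)) :=
    ⟨by simpa using hf.supp.isCompact.measure_lt_top⟩
  have h : MemLp f 2 ((volume : Measure (Space n₁ n₂)).restrict (tsupport f)) :=
    MemLp.of_bound hf.meas.restrict M (Filter.Eventually.of_forall hM)
  have h2 := (memLp_indicator_iff_restrict (isClosed_tsupport f).measurableSet).2 h
  rwa [Set.indicator_eq_self.2 (subset_tsupport f)] at h2

/-- The class in `L²` of a bounded measurable function with compact support. -/
def IsBddCompactSupp.toL2 {f : Space n₁ n₂ → ℂ} (hf : IsBddCompactSupp f) : L2 n₁ n₂ :=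
  hf.memLp.toLp f

/-- `K` is an integral kernel of the bounded operator `A` on `L²`:
`A f(x) = ∫ K(x,y) f(y) dy` for almost every `x`, for all `f` bounded with compact support. -/
def IsIntegralKernel (A : L2 n₁ n₂ →L[ℂ] L2 n₁ n₂) (K : Space n₁ n₂ → Space n₁ n₂ → ℂ) : Prop :=
  ∀ f : Space n₁ n₂ → ℂ, ∀ hf : IsBddCompactSupp f, ∀ᵐ x,
    Integrable (fun y => K x y * f y) volume ∧ A hf.toL2 x = ∫ y, K x y * f y

/-- The weight `|B(x, 2^{-j/2})|^{1/2} |B(y, 2^{-j/2})|^{1/2} d(x,y)^r`. -/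
def weight (κ j : ℕ) (r : ℝ) (x y : Space n₁ n₂) : ℝ :=
  ballVol κ x (2 ^ (-(j : ℝ) / 2)) ^ (1 / 2 : ℝ) * ballVol κ y (2 ^ (-(j : ℝ) / 2)) ^ (1 / 2 : ℝ) *
    dist κ x y ^ r

/-- For all `r ∈ [0, R₀]` and all `j`:
`sup_{x,y} |B(x,2^{-j/2})|^{1/2} |B(y,2^{-j/2})|^{1/2} d(x,y)^r |K_j(x,y)| ≲ 2^{-jr/2}`. -/
def KernelSup (κ : ℕ) (K : ℕ → Space n₁ n₂ → Space n₁ n₂ → ℂ) (R₀ : ℝ) : Prop :=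
  ∃ C : ℝ, ∀ r ∈ Icc 0 R₀, ∀ j : ℕ, ∀ x y,
    weight κ j r x y * ‖K j x y‖ ≤ C * 2 ^ (-(j * r) / 2)

/-- For all `r ∈ [0, R₀]` and all `j`:
`sup_{x,y} |B(x,2^{-j/2})|^{1/2} |B(y,2^{-j/2})|^{1/2} d(x,y)^r |X_y K_j(x,y)| ≲ 2^{-jr/2} 2^{j/2}`,
the derivatives along the fields being assumed to exist. -/
def KernelGradYSup (κ : ℕ) (K : ℕ → Space n₁ n₂ → Space n₁ n₂ → ℂ) (R₀ : ℝ) : Prop :=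
  (∀ j x, XDifferentiable κ (fun y => K j x y)) ∧
  ∃ C : ℝ, ∀ r ∈ Icc 0 R₀, ∀ j : ℕ, ∀ x y,
    weight κ j r x y * normX κ (fun y' => K j x y') y ≤ C * 2 ^ (-(j * r) / 2) * 2 ^ ((j : ℝ) / 2)

/-- For all `r ∈ [0, R₀]`, all `K₀ > 0` and all `j`:
`sup_x sup_{d(x,y) < K₀} |B(x,2^{-j/2})|^{1/2} |B(y,2^{-j/2})|^{1/2} d(x,y)^r |X_x K_j(x,y)|
  ≲_{K₀} 2^{-jr/2} 2^{j/2}`, the derivatives along the fields being assumed to exist. -/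
def KernelGradXSup (κ : ℕ) (K : ℕ → Space n₁ n₂ → Space n₁ n₂ → ℂ) (R₀ : ℝ) : Prop :=
  (∀ j y, XDifferentiable κ (fun x => K j x y)) ∧
  ∀ K₀ : ℝ, 0 < K₀ → ∃ C : ℝ, ∀ r ∈ Icc 0 R₀, ∀ j : ℕ, ∀ x y, dist κ x y < K₀ →
    weight κ j r x y * normX κ (fun x' => K j x' y) x ≤ C * 2 ^ (-(j * r) / 2) * 2 ^ ((j : ℝ) / 2)

/-! ### Dyadic cubes, sparse families and sparse operators -/

/-- `𝒟 = ⋃_k 𝒟_k` is a dyadic decomposition of `(ℝ^{n₁+n₂}, d, |·|)` (a system of Christ cubes) with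
parameters `h₁, h₂, ε₀, δ₀`. -/
structure IsDyadicDecomposition (κ : ℕ) (h₁ h₂ ε₀ δ₀ : ℝ) (𝒟 : ℤ → Set (Set (Space n₁ n₂))) :
    Prop where
  h₁_pos : 0 < h₁
  h₁_le : h₁ ≤ h₂
  ε₀_mem : ε₀ ∈ Ioo (0 : ℝ) 1
  δ₀_mem : δ₀ ∈ Ioo (0 : ℝ) 1
  meas : ∀ k, ∀ P ∈ 𝒟 k, MeasurableSet P
  cover : ∀ k, volume (⋃₀ 𝒟 k)ᶜ = 0
  nested : ∀ k l, l ≤ k → ∀ P ∈ 𝒟 k, ∀ R ∈ 𝒟 l, Disjoint P R ∨ P ⊆ R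
  child : ∀ k, ∀ P ∈ 𝒟 k, ∃ P' ∈ 𝒟 (k + 1), P' ⊆ P
  parent : ∀ k, ∀ P ∈ 𝒟 k, ∃! P', P' ∈ 𝒟 (k - 1) ∧ P ⊆ P'
  child_vol : ∀ k, ∀ P ∈ 𝒟 k, ∀ P' ∈ 𝒟 (k + 1), P' ⊆ P →
    ENNReal.ofReal ε₀ * volume P ≤ volume P'
  center : ∀ k, ∀ P ∈ 𝒟 k, ∃ c, ball κ c (h₁ * δ₀ ^ k) ⊆ P ∧ P ⊆ ball κ c (h₂ * δ₀ ^ k)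

/-- `S` is an `η`-sparse family: there are pairwise disjoint measurable `E_P ⊆ P`, `P ∈ S`, with
`|E_P| ≥ η |P|`. -/
def IsSparse (η : ℝ) (S : Set (Set (Space n₁ n₂))) : Prop :=
  ∃ E : Set (Space n₁ n₂) → Set (Space n₁ n₂),
    (∀ P ∈ S, E P ⊆ P ∧ MeasurableSet (E P) ∧ ENNReal.ofReal η * volume P ≤ volume (E P)) ∧
    S.PairwiseDisjoint E

/-- The sparse operator `A_{r,S} f(x) = ∑_{P ∈ S} (|P|⁻¹ ∫_P |f|^r)^{1/r} χ_P(x)`, with values in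
`[0, ∞]`. -/
def sparseOperator (r : ℝ) (S : Set (Set (Space n₁ n₂))) (f : Space n₁ n₂ → ℂ)
    (x : Space n₁ n₂) : ℝ≥0∞ :=
  ∑' P : S, (P : Set (Space n₁ n₂)).indicator
    (fun _ => ((volume (P : Set (Space n₁ n₂)))⁻¹ *
      ∫⁻ y in (P : Set (Space n₁ n₂)), ‖f y‖ₑ ^ r) ^ (1 / r)) x

end Grushin

end

/-! ### Stopping-time arguments on abstract dyadic grids. -/

noncomputable section
namespace Grushin

/-! ### Dyadic grids -/

/-! The proof combines a local sparse domination argument, run on an abstract dyadic grid, with the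
verification that the partial sums of the `T_j` are Calderón–Zygmund operators for a grid adapted to
the Grushin distance.

Abstract argument. Let `T` be a strong limit on `L²` of operators whose kernels are regular,
uniformly, on the annuli around each cell (`CZOperator`). A Calderón–Zygmund decomposition gives the
weak type (1,1) bound (`CZOperator.exists_weakType`). Fix a cell `q` with dilate `q*`, and let `a`
be a large multiple of the integral of `|f|` over `q*` divided by `|q|`. The set where `T(f
1_{q*})`, the averages of `|f 1_{q*}|`, or the density of the first exceptional set are too large
fills a small part of `q`. It is covered, up to a null set, by disjoint cells `p` of total measure
at most `|q|/2`, none of which lies inside it. A point of `p` outside the exceptional set, together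
with the regularity of the kernel, bounds `T(f 1_{q* \ p*})` by a multiple of `a` on all of `p`
(`exists_ae_map_compl_le`, `exists_stopping_step`). Iterating from root cells whose dilates contain
the support of `f` gives `|Tf| ≤ C ∑ a_q` over the cells containing the point. The part of each cell
not covered by its children has at least half its measure, and these parts are disjoint: this is
sparseness. Replacing each dilate by a comparable cell of one of finitely many adjacent grids gives
the sparse operator (`exists_sparse_domination`).

Geometry. The ball `B(x,r)` is comparable to a box with sides `r` in `x'` and `r (|x'| + r)^κ` in
`x''`. The cells are products of dyadic cubes of side `2^{-k}` in `x'` and of side `2^{-k} M^κ` in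
`x''`, where `M` is a power of two comparable to `|x'| + 2^{-k}` that depends only on the first
cube. Shifts by one third in each coordinate provide the adjacent grids (`exists_adjacent_cube`).

Kernels. For each `j` the mean value theorem along a path tangent to the fields `X` gives smoothness
(`norm_sub_le_of_normX_le`), and the size bound of order `Q + 1/2` gives decay. Interpolating the
two produces a factor that decays geometrically both in the annulus index and in the distance of `j`
from the scale of the annulus (`exists_sub_le`), so the sum over `j` is bounded uniformly. The
gradient in `x` is controlled only at bounded distance; on annuli of radius at least `1` all
frequencies `j ≥ 0` are high relative to the radius, and the size bounds alone are summable
(`exists_sum_size_le`).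

Finally `∑_{j ≤ J} χ_j(G)` tends strongly to the identity (`tendsto_spectralCutoff`). Of the
operator this needs only that its domain contains the test functions. -/

/-- A nested sequence of countable measurable partitions of `X`: the cells of level `k` are the
fibres of `idx k`. -/
structure Grid {X : Type*} [MeasurableSpace X] [TopologicalSpace X] (μ : Measure X)
    (ι : Type) where
  /-- the label of the cell of level `k` that contains `x` -/
  idx : ℤ → X → ι
  /-- the doubling constant -/
  dbl : ℝ≥0
  idx_pred : ∀ {k x y}, idx (k + 1) x = idx (k + 1) y → idx k x = idx k y
  measurableSet_fiber : ∀ k i, MeasurableSet (idx k ⁻¹' {i})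
  measure_ne_zero : ∀ k x, μ (idx k ⁻¹' {idx k x}) ≠ 0
  measure_ne_top : ∀ k x, μ (idx k ⁻¹' {idx k x}) ≠ ⊤
  two_mul_measure_le : ∀ k x, 2 * μ (idx (k + 1) ⁻¹' {idx (k + 1) x}) ≤ μ (idx k ⁻¹' {idx k x})
  measure_le_dbl : ∀ k x, μ (idx k ⁻¹' {idx k x}) ≤ dbl * μ (idx (k + 1) ⁻¹' {idx (k + 1) x})
  exists_subset : ∀ U : Set X, IsOpen U → ∀ x ∈ U, ∃ k, idx k ⁻¹' {idx k x} ⊆ U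

namespace Grid

variable {X : Type*} [MeasurableSpace X] [TopologicalSpace X] {μ : Measure X} {ι : Type}
  (G : Grid μ ι)

/-- The cell with a given level and label. -/
def cell (p : ℤ × ι) : Set X := G.idx p.1 ⁻¹' {p.2}

/-- The cell of level `k` that contains `x`. -/
def cube (k : ℤ) (x : X) : Set X := G.cell (k, G.idx k x)

theorem mem_cell {p : ℤ × ι} {x : X} : x ∈ G.cell p ↔ G.idx p.1 x = p.2 := Iff.rfl

theorem mem_cube {k : ℤ} {x y : X} : y ∈ G.cube k x ↔ G.idx k y = G.idx k x := Iff.rfl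

theorem mem_cube_self (k : ℤ) (x : X) : x ∈ G.cube k x := G.mem_cube.2 rfl

theorem cube_eq_cell {p : ℤ × ι} {x : X} (h : x ∈ G.cell p) : G.cube p.1 x = G.cell p := by
  rw [cube, G.mem_cell.1 h]

theorem idx_eq_of_le {k l : ℤ} (hkl : k ≤ l) {x y : X} (h : G.idx l x = G.idx l y) :
    G.idx k x = G.idx k y := by
  obtain ⟨n, rfl⟩ := Int.le.dest hkl
  induction n with
  | zero => simpa using h
  | succ n ih =>
    refine ih (by omega) (G.idx_pred ?_)
    push_cast at h
    rwa [← add_assoc] at h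

theorem cube_subset_cube {k l : ℤ} (hkl : k ≤ l) (x : X) : G.cube l x ⊆ G.cube k x :=
  fun _ hy => G.idx_eq_of_le hkl hy

theorem cube_eq_of_mem {k : ℤ} {x y : X} (h : y ∈ G.cube k x) : G.cube k y = G.cube k x := by
  rw [cube, G.mem_cube.1 h, cube]

theorem measurableSet_cell (p : ℤ × ι) : MeasurableSet (G.cell p) := G.measurableSet_fiber _ _

theorem measurableSet_cube (k : ℤ) (x : X) : MeasurableSet (G.cube k x) := G.measurableSet_fiber _ _

theorem cube_ne_zero (k : ℤ) (x : X) : μ (G.cube k x) ≠ 0 := G.measure_ne_zero k x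

theorem cube_ne_top (k : ℤ) (x : X) : μ (G.cube k x) ≠ ⊤ := G.measure_ne_top k x

theorem cell_ne_top (p : ℤ × ι) : μ (G.cell p) ≠ ⊤ := by
  rcases (G.cell p).eq_empty_or_nonempty with h | ⟨x, hx⟩
  · simp [h]
  · rw [← G.cube_eq_cell hx]; exact G.cube_ne_top _ _

theorem two_pow_mul_cube_le (k : ℤ) (x : X) (n : ℕ) :
    2 ^ n * μ (G.cube k x) ≤ μ (G.cube (k - n) x) := by
  induction n with
  | zero => simp
  | succ n ih =>
    have h := G.two_mul_measure_le (k - (n + 1 : ℕ)) x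
    have h1 : k - ((n + 1 : ℕ) : ℤ) + 1 = k - n := by push_cast; ring
    rw [h1] at h
    calc 2 ^ (n + 1) * μ (G.cube k x) = 2 * (2 ^ n * μ (G.cube k x)) := by ring
      _ ≤ 2 * μ (G.cube (k - n) x) := by gcongr
      _ ≤ _ := h

theorem cube_le_dbl (k : ℤ) (x : X) : μ (G.cube (k - 1) x) ≤ G.dbl * μ (G.cube k x) := by
  have h := G.measure_le_dbl (k - 1) x
  rwa [sub_add_cancel] at h

/-- The maximal cells of a family of cells. -/
def maximal (H : Set (ℤ × ι)) : Set (ℤ × ι) :=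
  {p | p ∈ H ∧ ∃ x ∈ G.cell p, ∀ l < p.1, (l, G.idx l x) ∉ H}

/-- Points of one cell share all coarser cells, so the point that witnesses maximality may be
exchanged for any other point of the cell. -/
theorem notMem_of_mem_maximal {H : Set (ℤ × ι)} {p : ℤ × ι} (hp : p ∈ G.maximal H) {x : X}
    (hx : x ∈ G.cell p) {l : ℤ} (hl : l < p.1) : (l, G.idx l x) ∉ H := by
  obtain ⟨-, y, hy, h⟩ := hp
  rw [G.idx_eq_of_le hl.le (hx.trans hy.symm)]
  exact h l hl

theorem pairwiseDisjoint_maximal (H : Set (ℤ × ι)) : (G.maximal H).PairwiseDisjoint G.cell := by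
  intro p hp q hq hpq
  refine Set.disjoint_left.2 fun x hxp hxq => hpq ?_
  rcases lt_trichotomy p.1 q.1 with h | h | h
  · exact absurd (by rw [G.mem_cell.1 hxp]; exact hp.1) (G.notMem_of_mem_maximal hq hxq h)
  · refine Prod.ext h ?_
    rw [← G.mem_cell.1 hxp, ← G.mem_cell.1 hxq, h]
  · exact absurd (by rw [G.mem_cell.1 hxq]; exact hq.1) (G.notMem_of_mem_maximal hp hxp h)

theorem exists_mem_maximal {H : Set (ℤ × ι)} {k : ℤ} {x : X} (hk : (k, G.idx k x) ∈ H)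
    {b : ℤ} (hb : ∀ l, (l, G.idx l x) ∈ H → b ≤ l) :
    ∃ p ∈ G.maximal H, x ∈ G.cell p ∧ p.1 ≤ k := by
  obtain ⟨l, hl, hmin⟩ := Int.exists_least_of_bdd (P := fun l => (l, G.idx l x) ∈ H)
    ⟨b, hb⟩ ⟨k, hk⟩
  refine ⟨(l, G.idx l x), ⟨hl, x, rfl, fun m hm hmem => ?_⟩, rfl, hmin k hk⟩
  exact absurd (hmin m hmem) (not_le.2 hm)

/-- The cells on which the average of `ν` exceeds `lam`. -/
def heavy (ν : Measure X) (lam : ℝ≥0∞) : Set (ℤ × ι) :=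
  {p | lam * μ (G.cell p) < ν (G.cell p)}

/-- The stopping cells: the maximal cells on which the average of `ν` exceeds `lam`. -/
def stopping (ν : Measure X) (lam : ℝ≥0∞) : Set (ℤ × ι) := G.maximal (G.heavy ν lam)

variable {ν : Measure X} {lam : ℝ≥0∞}

/-- Each step to a coarser level at least doubles `μ`, while `ν` is finite. Hence the averages of
`ν` eventually stay below `lam`, and every heavy cell lies in a maximal one. -/
theorem exists_le_of_heavy (hν : ν univ ≠ ⊤) (h0 : lam ≠ 0) (x : X) :
    ∃ b : ℤ, ∀ l, (l, G.idx l x) ∈ G.heavy ν lam → b ≤ l := by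
  have hc0 := G.cube_ne_zero 0 x
  obtain ⟨n, hn⟩ := ENNReal.exists_nat_mul_gt (mul_ne_zero h0 hc0) hν
  refine ⟨-n, fun l hl => ?_⟩
  by_contra hlt
  push Not at hlt
  have h1 : ν (G.cube l x) ≤ ν univ := measure_mono (subset_univ _)
  have h2 : (2 : ℝ≥0∞) ^ n * μ (G.cube 0 x) ≤ μ (G.cube l x) :=
    (G.two_pow_mul_cube_le 0 x n).trans (measure_mono (G.cube_subset_cube (by omega) x))
  have h3 : (n : ℝ≥0∞) ≤ 2 ^ n := by exact_mod_cast (Nat.lt_two_pow_self (n := n)).le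
  have h4 : n * (lam * μ (G.cube 0 x)) ≤ lam * μ (G.cube l x) :=
    calc n * (lam * μ (G.cube 0 x)) = lam * (n * μ (G.cube 0 x)) := by ring
      _ ≤ lam * (2 ^ n * μ (G.cube 0 x)) := by gcongr
      _ ≤ _ := by gcongr
  exact absurd (hn.trans_le (h4.trans (le_of_lt (show _ < ν (G.cube l x) from hl)))) (not_lt.2 h1)

theorem exists_mem_stopping (hν : ν univ ≠ ⊤) (h0 : lam ≠ 0) {k : ℤ} {x : X}
    (h : lam * μ (G.cube k x) < ν (G.cube k x)) :
    ∃ p ∈ G.stopping ν lam, x ∈ G.cell p ∧ p.1 ≤ k := by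
  obtain ⟨b, hb⟩ := G.exists_le_of_heavy hν h0 x
  exact G.exists_mem_maximal (H := G.heavy ν lam) (k := k) h hb

theorem measure_cube_pred_le_of_mem_stopping {p : ℤ × ι} (hp : p ∈ G.stopping ν lam) {x : X}
    (hx : x ∈ G.cell p) : ν (G.cube (p.1 - 1) x) ≤ lam * μ (G.cube (p.1 - 1) x) :=
  not_lt.1 (G.notMem_of_mem_maximal hp hx (by omega : p.1 - 1 < p.1))

/-- The parent of a stopping cell is not heavy; doubling carries its bound down to the cell. -/
theorem measure_cell_le_of_mem_stopping {p : ℤ × ι} (hp : p ∈ G.stopping ν lam) :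
    ν (G.cell p) ≤ lam * G.dbl * μ (G.cell p) := by
  obtain ⟨x, hx, -⟩ := hp.2
  rw [← G.cube_eq_cell hx]
  calc ν (G.cube p.1 x) ≤ ν (G.cube (p.1 - 1) x) :=
        measure_mono (G.cube_subset_cube (by omega) x)
    _ ≤ lam * μ (G.cube (p.1 - 1) x) := G.measure_cube_pred_le_of_mem_stopping hp hx
    _ ≤ lam * (G.dbl * μ (G.cube p.1 x)) := by gcongr; exact G.cube_le_dbl _ _
    _ = _ := by ring

variable [Countable ι]

theorem measure_biUnion_cell {F : Set (ℤ × ι)} (hF : F.PairwiseDisjoint G.cell) (ν : Measure X) :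
    ν (⋃ p ∈ F, G.cell p) = ∑' p : F, ν (G.cell p) :=
  measure_biUnion F.to_countable hF fun p _ => G.measurableSet_cell p

theorem tsum_measure_cell_le {F : Set (ℤ × ι)} (hF : F.PairwiseDisjoint G.cell) {ν : Measure X}
    {lam : ℝ≥0∞} (h : ∀ p ∈ F, lam * μ (G.cell p) ≤ ν (G.cell p)) :
    lam * ∑' p : F, μ (G.cell p) ≤ ν (⋃ p ∈ F, G.cell p) := by
  rw [G.measure_biUnion_cell hF ν, ← ENNReal.tsum_mul_left]
  exact ENNReal.tsum_le_tsum fun p => h p p.2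

theorem measure_cell_le_tsum {F : Set (ℤ × ι)} (hF : F.PairwiseDisjoint G.cell) {ν : Measure X}
    {lam : ℝ≥0∞} (h : ∀ p ∈ F, ν (G.cell p) ≤ lam * μ (G.cell p)) :
    ν (⋃ p ∈ F, G.cell p) ≤ lam * μ (⋃ p ∈ F, G.cell p) := by
  rw [G.measure_biUnion_cell hF ν, G.measure_biUnion_cell hF μ, ← ENNReal.tsum_mul_left]
  exact ENNReal.tsum_le_tsum fun p => h p p.2

/-- A measure all of whose averages over the cells that meet `A` are at most `lam` is at most
`lam * μ` on `A`. -/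
theorem measure_le_mul_measure [OpensMeasurableSpace X] [μ.OuterRegular] {ν : Measure X}
    {lam : ℝ≥0∞} {A : Set X} (hlam : lam ≠ ⊤)
    (hA : ∀ x ∈ A, ∀ k, ν (G.cube k x) ≤ lam * μ (G.cube k x)) :
    ν A ≤ lam * μ A := by
  have key : ∀ U, A ⊆ U → IsOpen U → ν A ≤ lam * μ U := by
    intro U hAU hU
    -- Only levels `≥ 0` are admitted, which guarantees maximal cells. Small cells around points of
    -- `A` lie in `U` by `exists_subset`.
    let H : Set (ℤ × ι) := {p | 0 ≤ p.1 ∧ G.cell p ⊆ U ∧ (G.cell p ∩ A).Nonempty}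
    have hdis := G.pairwiseDisjoint_maximal H
    have hsub : A ⊆ ⋃ p ∈ G.maximal H, G.cell p := by
      intro x hx
      obtain ⟨k, hk⟩ := G.exists_subset U hU x (hAU hx)
      have hmem : (max k 0, G.idx (max k 0) x) ∈ H :=
        ⟨le_max_right _ _, (G.cube_subset_cube (le_max_left k 0) x).trans hk, x,
          G.mem_cube_self _ _, hx⟩
      obtain ⟨p, hp, hxp, -⟩ := G.exists_mem_maximal hmem (b := 0) fun l hl => hl.1
      exact mem_iUnion₂.2 ⟨p, hp, hxp⟩
    calc ν A ≤ ν (⋃ p ∈ G.maximal H, G.cell p) := measure_mono hsub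
      _ ≤ lam * μ (⋃ p ∈ G.maximal H, G.cell p) := by
          refine G.measure_cell_le_tsum hdis fun p hp => ?_
          obtain ⟨x, hxp, hxA⟩ := hp.1.2.2
          rw [← G.cube_eq_cell hxp]
          exact hA x hxA _
      _ ≤ lam * μ U := by
          gcongr
          exact iUnion₂_subset fun p hp => hp.1.2.1
  -- Pulling `lam` out of the infimum over open sets requires `lam ≠ 0`; for `lam = 0` the open set
  -- `univ` is enough.
  rcases eq_or_ne lam 0 with rfl | h0
  · simpa using key univ (subset_univ _) isOpen_univ
  rw [A.measure_eq_iInf_isOpen μ]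
  simp only [ENNReal.mul_iInf_of_ne h0 hlam]
  exact le_iInf fun U => le_iInf fun hU => le_iInf fun hUo => key U hU hUo

/-- This takes the place of the Lebesgue differentiation theorem. On the set `A` where all averages
are at most `lam` but `h > lam`, the previous lemma gives `∫_A h ≤ lam μ(A)`, which is impossible
unless `A` is null. -/
theorem ae_le_of_lintegral_cube_le [OpensMeasurableSpace X] [μ.OuterRegular] {h : X → ℝ≥0∞}
    (hm : AEMeasurable h μ) (hfin : ∫⁻ x, h x ∂μ ≠ ⊤) {lam : ℝ≥0∞} (h0 : lam ≠ 0)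
    (hlam : lam ≠ ⊤) :
    ∀ᵐ x ∂μ, (∀ k, ∫⁻ y in G.cube k x, h y ∂μ ≤ lam * μ (G.cube k x)) → h x ≤ lam := by
  set g := hm.mk h
  have hgm : Measurable g := hm.measurable_mk
  have hgh : h =ᵐ[μ] g := hm.ae_eq_mk
  set L : Set X := {x | ∀ k, ∫⁻ y in G.cube k x, g y ∂μ ≤ lam * μ (G.cube k x)}
  have hLm : MeasurableSet L := by
    have : L = ⋂ k : ℤ, ⋃ i : ι, {x | x ∈ G.cell (k, i) ∧
        ∫⁻ y in G.cell (k, i), g y ∂μ ≤ lam * μ (G.cell (k, i))} := by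
      ext x
      simp only [L, mem_ofPred_eq, mem_iInter, mem_iUnion]
      refine forall_congr' fun k => ⟨fun hx => ⟨G.idx k x, rfl, hx⟩, ?_⟩
      rintro ⟨i, hi, hx⟩
      have : G.cube k x = G.cell (k, i) := G.cube_eq_cell (p := (k, i)) hi
      rwa [this]
    rw [this]
    exact .iInter fun k => .iUnion fun i => (G.measurableSet_cell (k, i)).inter (.const _)
  set A := L ∩ {x | lam < g x}
  have hAm : MeasurableSet A := hLm.inter (measurableSet_lt measurable_const hgm)
  have hgfin : ∫⁻ x, g x ∂μ ≠ ⊤ := by rwa [← lintegral_congr_ae hgh]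
  have hle : ∫⁻ x in A, g x ∂μ ≤ lam * μ A := by
    rw [← withDensity_apply _ hAm]
    refine G.measure_le_mul_measure hlam fun x hx k => ?_
    rw [withDensity_apply _ (G.measurableSet_cube k x)]
    exact hx.1 k
  have hA0 : μ A = 0 := by
    by_contra hne
    have hlt : ∫⁻ x in A, lam ∂μ < ∫⁻ x in A, g x ∂μ := by
      have hAtop : μ A ≠ ⊤ := by
        intro htop
        have : lam * μ A ≤ ∫⁻ x, g x ∂μ := by
          calc lam * μ A = ∫⁻ x in A, lam ∂μ := by simp
            _ ≤ ∫⁻ x in A, g x ∂μ := setLIntegral_mono hgm fun x hx => hx.2.le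
            _ ≤ _ := setLIntegral_le_lintegral _ _
        rw [htop, ENNReal.mul_top h0] at this
        exact hgfin (top_le_iff.1 this)
      refine setLIntegral_strict_mono hAm hne hgm ?_ (ae_of_all _ fun x hx => hx.2)
      simpa using ENNReal.mul_ne_top hlam hAtop
    rw [setLIntegral_const] at hlt
    exact absurd hle (not_le.2 hlt)
  have hAae : ∀ᵐ x ∂μ, x ∉ A := measure_eq_zero_iff_ae_notMem.1 hA0
  filter_upwards [hAae, hgh] with x hx hxg hk
  rw [hxg]
  by_contra hcon
  refine hx ⟨fun k => ?_, not_le.1 hcon⟩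
  rw [← lintegral_congr_ae (ae_restrict_of_ae hgh)]
  exact hk k

theorem mul_tsum_stopping_le :
    lam * ∑' p : G.stopping ν lam, μ (G.cell p) ≤ ν univ :=
  (G.tsum_measure_cell_le (G.pairwiseDisjoint_maximal _) fun _ hp => le_of_lt hp.1).trans
    (measure_mono (subset_univ _))

/-- The weak type estimate for the dyadic maximal function. -/
theorem mul_measure_iUnion_heavy_le (hν : ν univ ≠ ⊤) (h0 : lam ≠ 0) :
    lam * μ (⋃ p ∈ G.heavy ν lam, G.cell p) ≤ ν univ := by
  have hsub : ⋃ p ∈ G.heavy ν lam, G.cell p ⊆ ⋃ p ∈ G.stopping ν lam, G.cell p := by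
    refine iUnion₂_subset fun p hp x hx => ?_
    obtain ⟨q, hq, hxq, -⟩ := G.exists_mem_stopping (x := x) (k := p.1) hν h0
      (by rw [G.cube_eq_cell hx]; exact hp)
    exact mem_iUnion₂.2 ⟨q, hq, hxq⟩
  calc lam * μ (⋃ p ∈ G.heavy ν lam, G.cell p)
      ≤ lam * μ (⋃ p ∈ G.stopping ν lam, G.cell p) := by gcongr
    _ = lam * ∑' p : G.stopping ν lam, μ (G.cell p) := by
        rw [G.measure_biUnion_cell (F := G.stopping ν lam) (G.pairwiseDisjoint_maximal _)]
    _ ≤ _ := G.mul_tsum_stopping_le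

end Grid
end Grushin
end

/-! ### Weak type bound and sparse domination for operators that are regular with respect to a grid.
-/

noncomputable section
namespace Grushin

open Filter Topology

/-! ### Square integrable functions -/

section LpTwo

variable {X : Type*} [MeasurableSpace X] {μ : Measure X}

theorem eLpNorm_two_sq (f : X → ℂ) : eLpNorm f 2 μ ^ 2 = ∫⁻ x, ‖f x‖ₑ ^ 2 ∂μ := by
  rw [eLpNorm_eq_lintegral_rpow_enorm_toReal (by norm_num) (by norm_num), ← ENNReal.rpow_natCast,
    ← ENNReal.rpow_mul]
  norm_num

theorem lintegral_enorm_sq_eq (f : Lp ℂ 2 μ) : ∫⁻ x, ‖f x‖ₑ ^ 2 ∂μ = ‖f‖ₑ ^ 2 := by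
  rw [← eLpNorm_two_sq, Lp.enorm_def]

theorem enorm_toLp_sq {f : X → ℂ} (hf : MemLp f 2 μ) :
    ‖hf.toLp f‖ₑ ^ 2 = ∫⁻ x, ‖f x‖ₑ ^ 2 ∂μ := by
  rw [Lp.enorm_toLp, eLpNorm_two_sq]

/-- Dominated convergence in `L²`. The general filter allows unordered sums over a countable family,
as needed for the bad parts of a function. -/
theorem tendsto_toLp_of_dominated {ι : Type*} {l : Filter ι} [l.IsCountablyGenerated]
    {F : ι → X → ℂ} {f : X → ℂ} (hF : ∀ i, MemLp (F i) 2 μ) (hf : MemLp f 2 μ) {g : X → ℝ≥0∞}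
    (hg : ∫⁻ x, g x ^ 2 ∂μ ≠ ⊤) (hFg : ∀ i, ∀ᵐ x ∂μ, ‖F i x - f x‖ₑ ≤ g x)
    (hlim : ∀ᵐ x ∂μ, Tendsto (fun i => F i x) l (𝓝 (f x))) :
    Tendsto (fun i => (hF i).toLp (F i)) l (𝓝 (hf.toLp f)) := by
  rw [Lp.tendsto_Lp_iff_tendsto_eLpNorm'']
  have h : Tendsto (fun i => ∫⁻ x, ‖F i x - f x‖ₑ ^ 2 ∂μ) l (𝓝 (∫⁻ _, 0 ∂μ)) := by
    refine tendsto_lintegral_filter_of_dominated_convergence' (fun x => g x ^ 2)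
      (.of_forall fun i => ?_) (.of_forall fun i => ?_) hg ?_
    · exact (((hF i).sub hf).1.enorm).pow_const 2
    · filter_upwards [hFg i] with x hx
      gcongr
    · filter_upwards [hlim] with x hx
      have h1 : Tendsto (fun i => F i x - f x) l (𝓝 0) := by
        simpa using hx.sub_const (f x)
      have h2 := ((ENNReal.continuous_pow 2).comp continuous_enorm).continuousAt.tendsto.comp h1
      simpa [Function.comp_def] using h2
  have h3 : Tendsto (fun i => (eLpNorm (F i - f) 2 μ ^ 2) ^ (1 / 2 : ℝ)) l (𝓝 (0 ^ (1 / 2 : ℝ))) := by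
    refine (ENNReal.continuous_rpow_const.tendsto _).comp ?_
    simp_rw [eLpNorm_two_sq]
    simpa using h
  refine (by simpa using h3 : Tendsto _ l (𝓝 (0 : ℝ≥0∞))).congr fun i => ?_
  rw [← ENNReal.rpow_natCast, ← ENNReal.rpow_mul]
  norm_num

theorem enorm_sq_map_le (T : Lp ℂ 2 μ →L[ℂ] Lp ℂ 2 μ) (f : Lp ℂ 2 μ) :
    ‖T f‖ₑ ^ 2 ≤ ‖T‖ₑ ^ 2 * ‖f‖ₑ ^ 2 := by
  rw [← mul_pow]
  gcongr
  exact T.le_opENorm f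

theorem mul_measure_lt_map_le (T : Lp ℂ 2 μ →L[ℂ] Lp ℂ 2 μ) (f : Lp ℂ 2 μ) (lam : ℝ≥0∞) :
    lam ^ 2 * μ {x | lam < ‖T f x‖ₑ} ≤ ‖T‖ₑ ^ 2 * ‖f‖ₑ ^ 2 := by
  calc lam ^ 2 * μ {x | lam < ‖T f x‖ₑ} ≤ lam ^ 2 * μ {x | lam ^ 2 ≤ ‖T f x‖ₑ ^ 2} := by
        gcongr with x
        exact fun h => by gcongr
    _ ≤ ∫⁻ x, ‖T f x‖ₑ ^ 2 ∂μ := mul_meas_ge_le_lintegral₀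
        ((Lp.aestronglyMeasurable (T f)).enorm.pow_const 2) _
    _ = ‖T f‖ₑ ^ 2 := lintegral_enorm_sq_eq _
    _ ≤ _ := enorm_sq_map_le T f

end LpTwo

/-! ### Bounded functions with compact support -/

variable {n₁ n₂ : ℕ}

namespace IsBddCompactSupp

variable {f g : Space n₁ n₂ → ℂ}

theorem of_isBounded (hf : AEStronglyMeasurable f volume) {M : ℝ} (hM : ∀ x, ‖f x‖ ≤ M)
    {s : Set (Space n₁ n₂)} (hs : Bornology.IsBounded s) (hfs : ∀ x ∉ s, f x = 0) :
    IsBddCompactSupp f where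
  meas := hf
  bdd := ⟨M, hM⟩
  supp := by
    refine HasCompactSupport.intro hs.isCompact_closure fun x hx => hfs x fun h => hx ?_
    exact subset_closure h

theorem isBounded_support (hf : IsBddCompactSupp f) :
    Bornology.IsBounded (Function.support f) :=
  hf.supp.isCompact.isBounded.subset (subset_tsupport f)

theorem memLp_one (hf : IsBddCompactSupp f) : MemLp f 1 volume := by
  obtain ⟨M, hM⟩ := hf.bdd
  have hfin : IsFiniteMeasure ((volume : Measure (Space n₁ n₂)).restrict (tsupport f)) :=
    ⟨by simpa using hf.supp.isCompact.measure_lt_top⟩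
  have h : MemLp f 1 ((volume : Measure (Space n₁ n₂)).restrict (tsupport f)) :=
    MemLp.of_bound hf.meas.restrict M (Filter.Eventually.of_forall hM)
  have h2 := (memLp_indicator_iff_restrict (isClosed_tsupport f).measurableSet).2 h
  rwa [Set.indicator_eq_self.2 (subset_tsupport f)] at h2

theorem integrable (hf : IsBddCompactSupp f) : Integrable f volume :=
  memLp_one_iff_integrable.1 hf.memLp_one

theorem lintegral_ne_top (hf : IsBddCompactSupp f) : ∫⁻ x, ‖f x‖ₑ ≠ ⊤ :=
  hf.integrable.2.ne

theorem add (hf : IsBddCompactSupp f) (hg : IsBddCompactSupp g) : IsBddCompactSupp (f + g) where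
  meas := hf.meas.add hg.meas
  bdd := by
    obtain ⟨M, hM⟩ := hf.bdd
    obtain ⟨N, hN⟩ := hg.bdd
    exact ⟨M + N, fun x => (norm_add_le _ _).trans (add_le_add (hM x) (hN x))⟩
  supp := hf.supp.add hg.supp

theorem indicator (hf : IsBddCompactSupp f) {s : Set (Space n₁ n₂)} (hs : MeasurableSet s) :
    IsBddCompactSupp (s.indicator f) := by
  obtain ⟨M, hM⟩ := hf.bdd
  refine of_isBounded (hf.meas.indicator hs) (M := M) (fun x => ?_) hf.isBounded_support
    fun x hx => ?_
  · exact (norm_indicator_le_norm_self _ _).trans (hM x)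
  · rw [Function.notMem_support] at hx
    simp [Set.indicator, hx]

theorem zero : IsBddCompactSupp (0 : Space n₁ n₂ → ℂ) where
  meas := aestronglyMeasurable_zero
  bdd := ⟨0, by simp⟩
  supp := HasCompactSupport.zero

theorem sum {α : Type*} (F : Finset α) {u : α → Space n₁ n₂ → ℂ}
    (hu : ∀ a, IsBddCompactSupp (u a)) : IsBddCompactSupp (∑ a ∈ F, u a) := by
  classical
  induction F using Finset.induction_on with
  | empty => simpa using zero
  | insert a F ha ih => rw [Finset.sum_insert ha]; exact (hu a).add ih

theorem toL2_add (hf : IsBddCompactSupp f) (hg : IsBddCompactSupp g) :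
    (hf.add hg).toL2 = hf.toL2 + hg.toL2 := MemLp.toLp_add _ _

theorem toL2_sum {α : Type*} (F : Finset α) {u : α → Space n₁ n₂ → ℂ}
    (hu : ∀ a, IsBddCompactSupp (u a)) : (sum F hu).toL2 = ∑ a ∈ F, (hu a).toL2 := by
  classical
  induction F using Finset.induction_on with
  | empty => simp [toL2]
  | insert a F ha ih =>
    rw [Finset.sum_insert ha (f := fun a => (hu a).toL2), ← ih, ← toL2_add]
    simp [toL2, Finset.sum_insert ha]

theorem toL2_congr (hf : IsBddCompactSupp f) (hg : IsBddCompactSupp g) (h : f =ᵐ[volume] g) :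
    hf.toL2 = hg.toL2 := MemLp.toLp_congr _ _ h

end IsBddCompactSupp

/-! ### Calderón–Zygmund operators adapted to a grid -/

/-- A grid of `ℝ^{n₁+n₂}` together with, for each cell, a dilate of it. -/
structure StarGrid (n₁ n₂ : ℕ) (ι : Type) extends
    Grid (volume : Measure (Space n₁ n₂)) ι where
  /-- the dilate of the cell of level `k` that contains `x` -/
  star : ℤ → Space n₁ n₂ → Set (Space n₁ n₂)
  /-- the ratio of the measures of a dilate and its cell -/
  starDbl : ℝ≥0
  star_congr : ∀ {k x y}, idx k x = idx k y → star k x = star k y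
  measurableSet_star : ∀ k x, MeasurableSet (star k x)
  star_succ_subset : ∀ k x, star (k + 1) x ⊆ star k x
  -- A dilate contains the parent of its cell. This makes the dilates of the root cells reach the
  -- support of `f`.
  fiber_subset_star : ∀ k x, idx k ⁻¹' {idx k x} ⊆ star (k + 1) x
  exists_mem_star : ∀ x y, ∃ k, y ∈ star k x
  isBounded_star : ∀ k x, Bornology.IsBounded (star k x)
  measure_star_le : ∀ k x, volume (star k x) ≤ starDbl * volume (idx k ⁻¹' {idx k x})

namespace StarGrid

variable {ι : Type} (G : StarGrid n₁ n₂ ι)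

theorem star_subset_star {k l : ℤ} (hkl : k ≤ l) (x : Space n₁ n₂) : G.star l x ⊆ G.star k x := by
  obtain ⟨n, rfl⟩ := Int.le.dest hkl
  induction n with
  | zero => simp
  | succ n ih =>
    refine subset_trans ?_ (ih (by omega))
    push_cast
    rw [← add_assoc]
    exact G.star_succ_subset _ _

theorem cube_pred_subset_star (k : ℤ) (x : Space n₁ n₂) : G.cube (k - 1) x ⊆ G.star k x := by
  have := G.fiber_subset_star (k - 1) x
  rwa [sub_add_cancel] at this

theorem cube_subset_star (k : ℤ) (x : Space n₁ n₂) : G.cube k x ⊆ G.star k x :=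
  (G.cube_subset_cube (by omega) x).trans (G.cube_pred_subset_star k x)

theorem star_ne_zero (k : ℤ) (x : Space n₁ n₂) : volume (G.star k x) ≠ 0 := fun h =>
  G.cube_ne_zero k x (measure_mono_null (G.cube_subset_star k x) h)

theorem star_ne_top (k : ℤ) (x : Space n₁ n₂) : volume (G.star k x) ≠ ⊤ :=
  (G.isBounded_star k x).measure_lt_top.ne

theorem star_le (k : ℤ) (x : Space n₁ n₂) :
    volume (G.star k x) ≤ G.starDbl * volume (G.cube k x) := G.measure_star_le k x

theorem star_eq_of_mem {k : ℤ} {x y : Space n₁ n₂} (h : y ∈ G.cube k x) :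
    G.star k y = G.star k x := G.star_congr h

theorem isBounded_cube (k : ℤ) (x : Space n₁ n₂) : Bornology.IsBounded (G.cube k x) :=
  (G.isBounded_star k x).subset (G.cube_subset_star k x)

/-- The `i`-th annulus around a cell. -/
def annulus (k : ℤ) (x : Space n₁ n₂) (i : ℕ) : Set (Space n₁ n₂) :=
  G.star (k - i - 1) x \ G.star (k - i) x

theorem measurableSet_annulus (k : ℤ) (x : Space n₁ n₂) (i : ℕ) :
    MeasurableSet (G.annulus k x i) :=
  (G.measurableSet_star _ _).diff (G.measurableSet_star _ _)

theorem exists_mem_annulus {k : ℤ} {x y : Space n₁ n₂} (h : y ∉ G.star k x) :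
    ∃ i, y ∈ G.annulus k x i := by
  classical
  have hex : ∃ i : ℕ, y ∈ G.star (k - i - 1) x := by
    obtain ⟨l, hl⟩ := G.exists_mem_star x y
    exact ⟨(k - l).toNat, G.star_subset_star (by omega) x hl⟩
  refine ⟨Nat.find hex, Nat.find_spec hex, ?_⟩
  rcases hn : Nat.find hex with _ | m
  · simpa using h
  · have := Nat.find_min hex (m := m) (by omega)
    have e : k - ((m + 1 : ℕ) : ℤ) = k - m - 1 := by push_cast; ring
    rwa [e]

end StarGrid

/-- An operator on `L²` that is the strong limit of operators `S J` with integral kernels `k J`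
that are uniformly regular with respect to the cells of a grid. -/
structure CZOperator {ι : Type} (G : StarGrid n₁ n₂ ι) where
  /-- the operator -/
  T : L2 n₁ n₂ →L[ℂ] L2 n₁ n₂
  /-- the approximations -/
  S : ℕ → L2 n₁ n₂ →L[ℂ] L2 n₁ n₂
  /-- the kernels of the approximations -/
  k : ℕ → Space n₁ n₂ → Space n₁ n₂ → ℂ
  /-- the decay of the modulus of continuity of the kernels -/
  w : ℤ → ℕ → ℝ≥0∞
  /-- the kernel constant -/
  W : ℝ≥0
  tendsto : ∀ f, Tendsto (fun J => S J f) atTop (𝓝 (T f))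
  isIntegralKernel : ∀ J, IsIntegralKernel (S J) (k J)
  -- The decay `w l i` may depend on the level `l`; only its sum over the annuli has to be bounded
  -- uniformly. The scale-dependent gradient bound in `x` requires this.
  tsum_le : ∀ l, ∑' i, w l i ≤ W
  regular_right : ∀ J l i x ξ z y, ξ ∈ G.cube l x → z ∈ G.cube l x → y ∈ G.annulus l x i →
    volume (G.star (l - i - 1) x) * ‖k J y ξ - k J y z‖ₑ ≤ w l i
  regular_left : ∀ J l i x ξ z y, ξ ∈ G.cube l x → z ∈ G.cube l x → y ∈ G.annulus l x i →
    volume (G.star (l - i - 1) x) * ‖k J ξ y - k J z y‖ₑ ≤ w l i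

namespace CZOperator

variable {ι : Type} {G : StarGrid n₁ n₂ ι} (A : CZOperator G)

theorem exists_seq_tendsto_ae (f : L2 n₁ n₂) :
    ∃ φ : ℕ → ℕ, ∀ᵐ x, Tendsto (fun n => A.S (φ n) f x) atTop (𝓝 (A.T f x)) := by
  obtain ⟨φ, -, h⟩ := (tendstoInMeasure_of_tendsto_Lp (A.tendsto f)).exists_seq_tendsto_ae
  exact ⟨φ, h⟩

variable {f : Space n₁ n₂ → ℂ}

theorem ae_eq_integral (hf : IsBddCompactSupp f) :
    ∀ᵐ x, ∀ J, Integrable (fun y => A.k J x y * f y) volume ∧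
      A.S J hf.toL2 x = ∫ y, A.k J x y * f y :=
  ae_all_iff.2 fun J => A.isIntegralKernel J f hf

theorem weight_div_le {l : ℤ} {i : ℕ} {x : Space n₁ n₂} {a : ℝ≥0∞}
    (h : volume (G.star (l - i - 1) x) * a ≤ A.w l i) :
    a ≤ A.w l i / volume (G.star (l - i - 1) x) := by
  rw [ENNReal.le_div_iff_mul_le (.inl (G.star_ne_zero _ _)) (.inl (G.star_ne_top _ _))]
  rwa [mul_comm]

/-- Off the dilate of its cell, `T b` is integrable if `b` lives on a cell and has mean zero. -/
theorem lintegral_compl_star_le (hf : IsBddCompactSupp f) {l : ℤ} {x : Space n₁ n₂}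
    (hsupp : ∀ y ∉ G.cube l x, f y = 0) (hmean : ∫ y, f y = 0) :
    ∫⁻ y in (G.star l x)ᶜ, ‖A.T hf.toL2 y‖ₑ ≤ A.W * ∫⁻ y, ‖f y‖ₑ := by
  set H : Space n₁ n₂ → ℝ≥0∞ := fun y => ∑' i : ℕ,
    (G.annulus l x i).indicator (fun _ => A.w l i / volume (G.star (l - i - 1) x)) y
  have hpt : ∀ᵐ y, y ∈ (G.star l x)ᶜ → ‖A.T hf.toL2 y‖ₑ ≤ H y * ∫⁻ z, ‖f z‖ₑ := by
    obtain ⟨φ, hφ⟩ := A.exists_seq_tendsto_ae hf.toL2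
    filter_upwards [hφ, A.ae_eq_integral hf] with y hy hint hmem
    -- At almost every `y` the approximations converge along a subsequence, so a bound uniform in
    -- `n` suffices.
    refine le_of_tendsto (continuous_enorm.continuousAt.tendsto.comp hy) (.of_forall fun n => ?_)
    obtain ⟨i, hi⟩ := G.exists_mem_annulus hmem
    obtain ⟨hI, hS⟩ := hint (φ n)
    -- As `f` has mean zero, the value of the kernel at the reference point `x` of the cell may be
    -- subtracted.
    have h1 : ∫ z, A.k (φ n) y z * f z = ∫ z, (A.k (φ n) y z - A.k (φ n) y x) * f z := by
      have : ∫ z, A.k (φ n) y x * f z = 0 := by rw [integral_const_mul, hmean, mul_zero]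
      simp_rw [sub_mul]
      rw [integral_sub hI (hf.integrable.const_mul _), this, sub_zero]
    simp only [Function.comp_apply]
    rw [hS, h1]
    calc ‖∫ z, (A.k (φ n) y z - A.k (φ n) y x) * f z‖ₑ
        ≤ ∫⁻ z, ‖(A.k (φ n) y z - A.k (φ n) y x) * f z‖ₑ := enorm_integral_le_lintegral_enorm _
      _ ≤ ∫⁻ z, A.w l i / volume (G.star (l - i - 1) x) * ‖f z‖ₑ := by
          refine lintegral_mono fun z => ?_
          by_cases hz : z ∈ G.cube l x
          · simp only [enorm_mul]
            gcongr
            exact A.weight_div_le (A.regular_right _ l i x z x y hz (G.mem_cube_self _ _) hi)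
          · simp [hsupp z hz]
      _ = A.w l i / volume (G.star (l - i - 1) x) * ∫⁻ z, ‖f z‖ₑ :=
          lintegral_const_mul'' _ hf.meas.enorm
      _ ≤ H y * ∫⁻ z, ‖f z‖ₑ := by
          gcongr
          refine le_trans ?_ (ENNReal.le_tsum i)
          rw [Set.indicator_of_mem hi]
  have hH : Measurable H := Measurable.tsum fun i =>
    measurable_const.indicator (G.measurableSet_annulus l x i)
  calc ∫⁻ y in (G.star l x)ᶜ, ‖A.T hf.toL2 y‖ₑ
      ≤ ∫⁻ y in (G.star l x)ᶜ, H y * ∫⁻ z, ‖f z‖ₑ := by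
        refine lintegral_mono_ae ?_
        exact (ae_restrict_iff' (G.measurableSet_star l x).compl).2 hpt
    _ ≤ ∫⁻ y, H y * ∫⁻ z, ‖f z‖ₑ := setLIntegral_le_lintegral _ _
    _ = (∫⁻ y, H y) * ∫⁻ z, ‖f z‖ₑ := lintegral_mul_const _ hH
    _ ≤ A.W * ∫⁻ y, ‖f y‖ₑ := by
        gcongr
        rw [lintegral_tsum fun i => (measurable_const.indicator
          (G.measurableSet_annulus l x i)).aemeasurable]
        refine le_trans (ENNReal.tsum_le_tsum fun i => ?_) (A.tsum_le l)
        rw [lintegral_indicator (G.measurableSet_annulus l x i), setLIntegral_const]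
        calc A.w l i / volume (G.star (l - i - 1) x) * volume (G.annulus l x i)
            ≤ A.w l i / volume (G.star (l - i - 1) x) * volume (G.star (l - i - 1) x) := by
              gcongr; exact sdiff_subset
          _ ≤ A.w l i := (ENNReal.div_mul_cancel (G.star_ne_zero _ _) (G.star_ne_top _ _)).le

/-- On a cell, `T f` oscillates little if `f` vanishes on the dilate of the cell. -/
theorem exists_ae_enorm_sub_le (hf : IsBddCompactSupp f) {l : ℤ} {x : Space n₁ n₂} {a : ℝ≥0∞}
    (hsupp : ∀ y ∈ G.star l x, f y = 0)
    (ha : ∀ i : ℕ, ∫⁻ y in G.star (l - i - 1) x, ‖f y‖ₑ ≤ a * volume (G.star (l - i - 1) x)) :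
    ∃ p : Space n₁ n₂ → Prop, (∀ᵐ y, p y) ∧ ∀ ξ ∈ G.cube l x, ∀ z ∈ G.cube l x, p ξ → p z →
      ‖A.T hf.toL2 ξ - A.T hf.toL2 z‖ₑ ≤ A.W * a := by
  obtain ⟨φ, hφ⟩ := A.exists_seq_tendsto_ae hf.toL2
  -- The null set is fixed before the two points are chosen, so the oscillation bound holds for all
  -- pairs of good points.
  refine ⟨_, hφ.and (A.ae_eq_integral hf), fun ξ hξ z hz ⟨hξ1, hξ2⟩ ⟨hz1, hz2⟩ => ?_⟩
  refine le_of_tendsto (continuous_enorm.continuousAt.tendsto.comp (hξ1.sub hz1))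
    (.of_forall fun n => ?_)
  simp only [Function.comp_apply]
  rw [(hξ2 _).2, (hz2 _).2, ← integral_sub (hξ2 _).1 (hz2 _).1]
  calc ‖∫ y, (A.k (φ n) ξ y * f y - A.k (φ n) z y * f y)‖ₑ
      ≤ ∫⁻ y, ‖A.k (φ n) ξ y * f y - A.k (φ n) z y * f y‖ₑ := enorm_integral_le_lintegral_enorm _
    _ ≤ ∫⁻ y, ∑' i : ℕ, (G.annulus l x i).indicator
          (fun y => A.w l i / volume (G.star (l - i - 1) x) * ‖f y‖ₑ) y := by
        refine lintegral_mono fun y => ?_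
        by_cases hy : y ∈ G.star l x
        · simp [hsupp y hy]
        · obtain ⟨i, hi⟩ := G.exists_mem_annulus hy
          refine le_trans ?_ (ENNReal.le_tsum i)
          rw [Set.indicator_of_mem hi, ← sub_mul, enorm_mul]
          gcongr
          exact A.weight_div_le (A.regular_left _ l i x ξ z y hξ hz hi)
    _ = ∑' i : ℕ, A.w l i / volume (G.star (l - i - 1) x) * ∫⁻ y in G.annulus l x i, ‖f y‖ₑ := by
        rw [lintegral_tsum fun i => (hf.meas.enorm.const_mul _).indicator
          (G.measurableSet_annulus l x i)]
        refine tsum_congr fun i => ?_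
        rw [lintegral_indicator (G.measurableSet_annulus l x i),
          lintegral_const_mul'' _ hf.meas.enorm.restrict]
    _ ≤ ∑' i : ℕ, A.w l i * a := by
        refine ENNReal.tsum_le_tsum fun i => ?_
        calc A.w l i / volume (G.star (l - i - 1) x) * ∫⁻ y in G.annulus l x i, ‖f y‖ₑ
            ≤ A.w l i / volume (G.star (l - i - 1) x) * (a * volume (G.star (l - i - 1) x)) := by
              gcongr
              exact (lintegral_mono_set sdiff_subset).trans (ha i)
          _ = (A.w l i / volume (G.star (l - i - 1) x) * volume (G.star (l - i - 1) x)) * a := by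
              ring
          _ ≤ A.w l i * a := by gcongr; exact (ENNReal.div_mul_cancel (G.star_ne_zero _ _) (G.star_ne_top _ _)).le
    _ ≤ A.W * a := by
        rw [ENNReal.tsum_mul_right]
        gcongr
        exact A.tsum_le l

end CZOperator

end Grushin
end

noncomputable section
namespace Grushin
open Filter Topology
variable {n₁ n₂ : ℕ}

namespace StarGrid

variable {ι : Type} (G : StarGrid n₁ n₂ ι)

/-- The dilate of a cell. -/
def starCell (p : ℤ × ι) : Set (Space n₁ n₂) := ⋃ x ∈ G.cell p, G.star p.1 x

theorem starCell_eq {p : ℤ × ι} {x : Space n₁ n₂} (hx : x ∈ G.cell p) :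
    G.starCell p = G.star p.1 x := by
  refine subset_antisymm (iUnion₂_subset fun y hy => ?_) fun y hy => mem_iUnion₂.2 ⟨x, hx, hy⟩
  rw [G.star_congr (hy.trans hx.symm : G.idx p.1 y = G.idx p.1 x)]

theorem measurableSet_starCell (p : ℤ × ι) : MeasurableSet (G.starCell p) := by
  rcases (G.cell p).eq_empty_or_nonempty with h | ⟨x, hx⟩
  · simp [starCell, h]
  · rw [G.starCell_eq hx]
    exact G.measurableSet_star _ _

theorem measure_starCell_le (p : ℤ × ι) :
    volume (G.starCell p) ≤ G.starDbl * volume (G.cell p) := by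
  rcases (G.cell p).eq_empty_or_nonempty with h | ⟨x, hx⟩
  · simp [starCell, h]
  · rw [G.starCell_eq hx, ← G.cube_eq_cell hx]
    exact G.star_le _ _

theorem isBounded_cell (p : ℤ × ι) : Bornology.IsBounded (G.cell p) := by
  rcases (G.cell p).eq_empty_or_nonempty with h | ⟨x, hx⟩
  · simp [h]
  · rw [← G.cube_eq_cell hx]
    exact G.isBounded_cube _ _

end StarGrid

/-! ### The Calderón–Zygmund decomposition -/

theorem enorm_setAverage_mul_le (f : Space n₁ n₂ → ℂ) {s : Set (Space n₁ n₂)}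
    (hs : volume s ≠ ⊤) :
    ‖⨍ y in s, f y‖ₑ * volume s ≤ ∫⁻ y in s, ‖f y‖ₑ := by
  rcases eq_or_ne (volume s) 0 with h0 | h0
  · simp [h0]
  rw [setAverage_eq, enorm_smul, measureReal_def, mul_right_comm]
  have : ‖(volume s).toReal⁻¹‖ₑ * volume s = 1 := by
    rw [Real.enorm_eq_ofReal (by positivity),
      ENNReal.ofReal_inv_of_pos (ENNReal.toReal_pos h0 hs), ENNReal.ofReal_toReal hs,
      ENNReal.inv_mul_cancel h0 hs]
  rw [this, one_mul]
  exact enorm_integral_le_lintegral_enorm _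

namespace CZOperator

variable {ι : Type} {G : StarGrid n₁ n₂ ι} (A : CZOperator G)
  {f : Space n₁ n₂ → ℂ}

theorem withDensity_enorm_univ : (volume.withDensity fun y => ‖f y‖ₑ) univ = ∫⁻ y, ‖f y‖ₑ := by
  rw [withDensity_apply _ MeasurableSet.univ, setLIntegral_univ]

variable (G f) in
/-- The part of `f - ⨍ f` that lives on the cell `p`. -/
def badPart (p : ℤ × ι) : Space n₁ n₂ → ℂ :=
  (G.cell p).indicator fun x => f x - ⨍ y in G.cell p, f y

theorem isBddCompactSupp_badPart (hf : IsBddCompactSupp f) (p : ℤ × ι) :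
    IsBddCompactSupp (badPart G f p) := by
  obtain ⟨M, hM⟩ := hf.bdd
  refine .of_isBounded ((hf.meas.sub aestronglyMeasurable_const).indicator (G.measurableSet_cell p))
    (M := M + ‖⨍ y in G.cell p, f y‖) (fun x => ?_) (G.isBounded_cell p) fun x hx => ?_
  · refine (norm_indicator_le_norm_self _ _).trans ((norm_sub_le _ _).trans ?_)
    gcongr
    exact hM x
  · exact indicator_of_notMem hx _

theorem integral_badPart (p : ℤ × ι) : ∫ x, badPart G f p x = 0 := by
  have : IsFiniteMeasure ((volume : Measure (Space n₁ n₂)).restrict (G.cell p)) :=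
    ⟨by simpa using (G.cell_ne_top p).lt_top⟩
  rw [badPart, integral_indicator (G.measurableSet_cell p)]
  exact integral_sub_average _ f

theorem lintegral_badPart_le (hf : IsBddCompactSupp f) (p : ℤ × ι) :
    ∫⁻ x, ‖badPart G f p x‖ₑ ≤ 2 * ∫⁻ x in G.cell p, ‖f x‖ₑ := by
  have h : ∀ x, ‖badPart G f p x‖ₑ =
      (G.cell p).indicator (fun x => ‖f x - ⨍ y in G.cell p, f y‖ₑ) x := fun x => by
    rw [badPart, enorm_indicator_eq_indicator_enorm]
  simp_rw [h]
  rw [lintegral_indicator (G.measurableSet_cell p)]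
  calc ∫⁻ x in G.cell p, ‖f x - ⨍ y in G.cell p, f y‖ₑ
      ≤ ∫⁻ x in G.cell p, (‖f x‖ₑ + ‖⨍ y in G.cell p, f y‖ₑ) :=
        lintegral_mono fun x => enorm_sub_le
    _ = (∫⁻ x in G.cell p, ‖f x‖ₑ) + ‖⨍ y in G.cell p, f y‖ₑ * volume (G.cell p) := by
        rw [lintegral_add_left' hf.meas.enorm.restrict, setLIntegral_const]
    _ ≤ (∫⁻ x in G.cell p, ‖f x‖ₑ) + ∫⁻ x in G.cell p, ‖f x‖ₑ := by
        gcongr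
        exact enorm_setAverage_mul_le f (G.cell_ne_top p)
    _ = _ := (two_mul _).symm

variable [Countable ι]

/-- The Calderón–Zygmund decomposition at height `lam`: `f` is the sum of `g` and the bad parts of
`f` on the stopping cells, the sum being convergent in `L²`. -/
theorem exists_decomposition (hf : IsBddCompactSupp f) {lam : ℝ≥0∞} (h0 : lam ≠ 0)
    (hlam : lam ≠ ⊤) :
    ∃ g : L2 n₁ n₂,
      HasSum (fun p : G.stopping (volume.withDensity fun y => ‖f y‖ₑ) lam =>
        (isBddCompactSupp_badPart (G := G) hf p).toL2) (hf.toL2 - g) ∧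
      ‖g‖ₑ ^ 2 ≤ 3 * (1 + G.dbl) * lam * ∫⁻ x, ‖f x‖ₑ := by
  set ν : Measure (Space n₁ n₂) := volume.withDensity fun y => ‖f y‖ₑ
  set P := G.stopping ν lam
  have hdis : P.PairwiseDisjoint G.cell := G.pairwiseDisjoint_maximal _
  have hνuniv : ν univ = ∫⁻ y, ‖f y‖ₑ := withDensity_enorm_univ
  have hνtop : ν univ ≠ ⊤ := by rw [hνuniv]; exact hf.lintegral_ne_top
  have hνcell : ∀ p, ν (G.cell p) = ∫⁻ y in G.cell p, ‖f y‖ₑ := fun p =>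
    withDensity_apply _ (G.measurableSet_cell p)
  -- Maximality and doubling bound the averages on stopping cells from above.
  have havg : ∀ p ∈ P, ‖⨍ y in G.cell p, f y‖ₑ ≤ lam * G.dbl := by
    intro p hp
    have hpos : volume (G.cell p) ≠ 0 := by
      obtain ⟨x, hx, -⟩ := hp.2
      rw [← G.cube_eq_cell hx]
      exact G.cube_ne_zero _ _
    have h1 := (enorm_setAverage_mul_le f (G.cell_ne_top p)).trans
      ((hνcell p).symm.trans_le (G.measure_cell_le_of_mem_stopping hp))
    exact (ENNReal.mul_le_mul_iff_left hpos (G.cell_ne_top p)).1 h1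
  set Ω := ⋃ p ∈ P, G.cell p
  have hΩm : MeasurableSet Ω := .biUnion P.to_countable fun p _ => G.measurableSet_cell p
  set u : P → Space n₁ n₂ → ℂ := fun p => badPart G f p
  have hu : ∀ p, IsBddCompactSupp (u p) := fun p => isBddCompactSupp_badPart (G := G) hf p.1
  have hu_of_mem : ∀ (p q : P) x, x ∈ G.cell p → q ≠ p → u q x = 0 := by
    intro p q x hx hqp
    refine indicator_of_notMem (fun hxq => ?_) _
    exact Set.disjoint_left.1 (hdis q.2 p.2 fun h => hqp (Subtype.ext h)) hxq hx
  have hu_of_notMem : ∀ (q : P) x, x ∉ Ω → u q x = 0 := fun q x hx =>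
    indicator_of_notMem (fun hxq => hx (mem_iUnion₂.2 ⟨q, q.2, hxq⟩)) _
  set b : Space n₁ n₂ → ℂ := fun x => ∑' q : P, u q x
  have hb_of_mem : ∀ (p : P) x, x ∈ G.cell p → b x = u p x := fun p x hx =>
    tsum_eq_single p fun q hq => hu_of_mem p q x hx hq
  have hb_of_notMem : ∀ x, x ∉ Ω → b x = 0 := fun x hx => by
    simp [b, fun q => hu_of_notMem q x hx]
  have hsum : ∀ x, HasSum (fun q : P => u q x) (b x) := by
    intro x
    by_cases hx : x ∈ Ω
    · obtain ⟨p, hp, hxp⟩ := mem_iUnion₂.1 hx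
      rw [hb_of_mem ⟨p, hp⟩ x hxp]
      exact hasSum_single _ fun q hq => hu_of_mem ⟨p, hp⟩ q x hxp hq
    · rw [hb_of_notMem x hx]
      simp only [fun q => hu_of_notMem q x hx]
      exact hasSum_zero
  obtain ⟨M, hM⟩ := hf.bdd
  -- `D` depends on the supremum of `f`. It only provides a dominating function in `L²` and does not
  -- enter the final bound.
  set D : ℝ≥0∞ := ENNReal.ofReal M + lam * G.dbl
  have hDtop : D ≠ ⊤ := ENNReal.add_ne_top.2
    ⟨ENNReal.ofReal_ne_top, ENNReal.mul_ne_top hlam ENNReal.coe_ne_top⟩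
  have hbD : ∀ x, ‖b x‖ₑ ≤ Ω.indicator (fun _ => D) x := by
    intro x
    by_cases hx : x ∈ Ω
    · obtain ⟨p, hp, hxp⟩ := mem_iUnion₂.1 hx
      rw [hb_of_mem ⟨p, hp⟩ x hxp, indicator_of_mem hx]
      simp only [u, badPart, indicator_of_mem hxp]
      refine enorm_sub_le.trans (add_le_add ?_ (havg p hp))
      rw [← ofReal_norm]
      exact ENNReal.ofReal_le_ofReal (hM x)
    · simp [hb_of_notMem x hx]
  -- By disjointness a finite partial sum equals, at each point, either `b` or zero.
  have hF : ∀ (F : Finset P) x, ‖(∑ q ∈ F, u q) x - b x‖ₑ ≤ ‖b x‖ₑ := by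
    classical
    intro F x
    rw [Finset.sum_apply]
    by_cases hx : x ∈ Ω
    · obtain ⟨p, hp, hxp⟩ := mem_iUnion₂.1 hx
      have : ∑ q ∈ F, u q x = if ⟨p, hp⟩ ∈ F then u ⟨p, hp⟩ x else 0 := by
        split_ifs with h
        · exact Finset.sum_eq_single_of_mem _ h fun q _ hq => hu_of_mem ⟨p, hp⟩ q x hxp hq
        · exact Finset.sum_eq_zero fun q hq => hu_of_mem ⟨p, hp⟩ q x hxp fun e => h (e ▸ hq)
      rw [this, hb_of_mem ⟨p, hp⟩ x hxp]
      split_ifs <;> simp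
    · simp [hb_of_notMem x hx, fun q => hu_of_notMem q x hx]
  have hPvol : volume Ω ≠ ⊤ := by
    have h1 : lam * volume Ω ≤ ν univ := by
      rw [G.measure_biUnion_cell hdis]
      exact G.mul_tsum_stopping_le
    intro htop
    rw [htop, ENNReal.mul_top h0] at h1
    exact hνtop (top_le_iff.1 h1)
  have hD2 : ∫⁻ x, (Ω.indicator (fun _ => D) x) ^ 2 ≠ ⊤ := by
    have : ∀ x, (Ω.indicator (fun _ => D) x) ^ 2 = Ω.indicator (fun _ => D ^ 2) x := fun x => by
      by_cases hx : x ∈ Ω <;> simp [hx]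
    simp_rw [this]
    rw [lintegral_indicator hΩm, setLIntegral_const]
    exact ENNReal.mul_ne_top (ENNReal.pow_ne_top hDtop) hPvol
  have hbmeas : AEStronglyMeasurable b volume := by
    refine aestronglyMeasurable_of_tendsto_ae (u := (atTop : Filter (Finset P)))
      (f := fun F => ∑ q ∈ F, u q) (fun F => (IsBddCompactSupp.sum F hu).meas)
      (ae_of_all _ fun x => ?_)
    simpa [HasSum, Finset.sum_apply] using hsum x
  have hb2 : MemLp b 2 volume := by
    refine ⟨hbmeas, ?_⟩
    have h1 : eLpNorm b 2 volume ^ 2 < ⊤ := by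
      rw [eLpNorm_two_sq]
      refine lt_of_le_of_lt (lintegral_mono fun x => ?_) hD2.lt_top
      dsimp only
      gcongr
      exact hbD x
    exact (ENNReal.pow_lt_top_iff.1 h1).resolve_right (by norm_num)
  have hb1 : ∫⁻ x, ‖b x‖ₑ ≤ 2 * ∫⁻ x, ‖f x‖ₑ := by
    calc ∫⁻ x, ‖b x‖ₑ ≤ ∫⁻ x, ∑' q : P, ‖u q x‖ₑ := by
          refine lintegral_mono fun x => ?_
          by_cases hx : x ∈ Ω
          · obtain ⟨p, hp, hxp⟩ := mem_iUnion₂.1 hx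
            rw [hb_of_mem ⟨p, hp⟩ x hxp]
            exact ENNReal.le_tsum (f := fun q : P => ‖u q x‖ₑ) _
          · simp [hb_of_notMem x hx]
      _ = ∑' q : P, ∫⁻ x, ‖u q x‖ₑ := lintegral_tsum fun q => (hu q).meas.enorm
      _ ≤ ∑' q : P, 2 * ν (G.cell q) := ENNReal.tsum_le_tsum fun q =>
          (lintegral_badPart_le hf q.1).trans_eq (by rw [hνcell])
      _ = 2 * ν Ω := by rw [ENNReal.tsum_mul_left, ← G.measure_biUnion_cell hdis]
      _ ≤ 2 * ∫⁻ x, ‖f x‖ₑ := by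
          rw [← hνuniv]
          gcongr
          exact subset_univ _
  have hg2 : MemLp (f - b) 2 volume := hf.memLp.sub hb2
  refine ⟨hg2.toLp, ?_, ?_⟩
  · have h1 : hf.toL2 - hg2.toLp = hb2.toLp := by
      rw [IsBddCompactSupp.toL2, ← MemLp.toLp_sub]
      exact MemLp.toLp_congr _ _ (ae_of_all _ fun x => by simp)
    rw [h1]
    have h2 := tendsto_toLp_of_dominated (l := (atTop : Filter (Finset P)))
      (fun F => (IsBddCompactSupp.sum F hu).memLp) hb2 hD2
      (fun F => ae_of_all _ fun x => (hF F x).trans (hbD x))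
      (ae_of_all _ fun x => by simpa [HasSum, Finset.sum_apply] using hsum x)
    refine h2.congr fun F => ?_
    exact IsBddCompactSupp.toL2_sum F hu
  · rw [enorm_toLp_sq]
    have hle : ∀ᵐ x, ‖(f - b) x‖ₑ ≤ (1 + G.dbl) * lam := by
      -- On `Ω` the good part is the average over a stopping cell. Off `Ω` no cube around the point
      -- is heavy, and differentiation bounds `f` itself.
      filter_upwards [G.ae_le_of_lintegral_cube_le hf.meas.enorm hf.lintegral_ne_top h0 hlam]
        with x hx
      by_cases hxΩ : x ∈ Ω
      · obtain ⟨p, hp, hxp⟩ := mem_iUnion₂.1 hxΩ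
        have : (f - b) x = ⨍ y in G.cell p, f y := by
          rw [Pi.sub_apply, hb_of_mem ⟨p, hp⟩ x hxp]
          simp only [u, badPart, indicator_of_mem hxp]
          ring
        rw [this]
        calc _ ≤ lam * G.dbl := havg p hp
          _ = G.dbl * lam := mul_comm _ _
          _ ≤ _ := by gcongr; exact le_add_self
      · rw [Pi.sub_apply, hb_of_notMem x hxΩ, sub_zero]
        have h1 : ‖f x‖ₑ ≤ lam := by
          refine hx fun k => ?_
          rw [← withDensity_apply _ (G.measurableSet_cube k x)]
          by_contra hcon
          obtain ⟨p, hp, hxp, -⟩ := G.exists_mem_stopping (x := x) (k := k) hνtop h0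
            (not_le.1 hcon)
          exact hxΩ (mem_iUnion₂.2 ⟨p, hp, hxp⟩)
        calc _ ≤ 1 * lam := by simpa using h1
          _ ≤ _ := by gcongr; exact le_self_add
    -- The `L²` norm is estimated by the `L^∞` norm times the `L¹` norm; the factor 3 comes from
    -- `‖f‖₁ + ‖b‖₁` with `‖b‖₁ ≤ 2 ‖f‖₁`.
    calc ∫⁻ x, ‖(f - b) x‖ₑ ^ 2 ≤ ∫⁻ x, (1 + G.dbl) * lam * ‖(f - b) x‖ₑ := by
          refine lintegral_mono_ae ?_
          filter_upwards [hle] with x hx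
          rw [sq]
          gcongr
      _ = (1 + G.dbl) * lam * ∫⁻ x, ‖(f - b) x‖ₑ :=
          lintegral_const_mul'' _ (hf.meas.sub hbmeas).enorm
      _ ≤ (1 + G.dbl) * lam * ((∫⁻ x, ‖f x‖ₑ) + 2 * ∫⁻ x, ‖f x‖ₑ) := by
          gcongr
          calc ∫⁻ x, ‖(f - b) x‖ₑ ≤ ∫⁻ x, (‖f x‖ₑ + ‖b x‖ₑ) :=
                lintegral_mono fun x => enorm_sub_le
            _ = (∫⁻ x, ‖f x‖ₑ) + ∫⁻ x, ‖b x‖ₑ := lintegral_add_left' hf.meas.enorm _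
            _ ≤ _ := by gcongr
      _ = _ := by ring

/-- The weak type `(1,1)` estimate. -/
theorem exists_weakType : ∃ C : ℝ≥0, ∀ f : Space n₁ n₂ → ℂ, ∀ hf : IsBddCompactSupp f,
    ∀ lam : ℝ≥0∞, lam ≠ 0 → lam ≠ ⊤ →
      lam * volume {x | lam < ‖A.T hf.toL2 x‖ₑ} ≤ C * ∫⁻ x, ‖f x‖ₑ := by
  -- The three summands come from the good part, from the dilates of the stopping cells, and from
  -- the bad part off these dilates.
  set C₀ : ℝ≥0 := ‖A.T‖₊ ^ 2 * (3 * (1 + G.dbl)) + G.starDbl + 2 * A.W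
  suffices h : ∀ f : Space n₁ n₂ → ℂ, ∀ hf : IsBddCompactSupp f, ∀ lam : ℝ≥0∞, lam ≠ 0 → lam ≠ ⊤ →
      lam * volume {x | 2 * lam < ‖A.T hf.toL2 x‖ₑ} ≤ C₀ * ∫⁻ x, ‖f x‖ₑ by
    refine ⟨2 * C₀, fun f hf lam h0 hlam => ?_⟩
    have h1 := h f hf (lam / 2) (by simpa using h0) (ENNReal.div_ne_top hlam (by norm_num))
    rw [ENNReal.mul_div_cancel (by norm_num) (by norm_num)] at h1
    calc lam * volume {x | lam < ‖A.T hf.toL2 x‖ₑ}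
        = 2 * (lam / 2 * volume {x | lam < ‖A.T hf.toL2 x‖ₑ}) := by
          rw [← mul_assoc, ENNReal.mul_div_cancel (by norm_num) (by norm_num)]
      _ ≤ 2 * (C₀ * ∫⁻ x, ‖f x‖ₑ) := by gcongr
      _ = _ := by push_cast; ring
  intro f hf lam h0 hlam
  set N := ∫⁻ x, ‖f x‖ₑ
  obtain ⟨g, hsum, hg⟩ := exists_decomposition (G := G) hf h0 hlam
  set ν : Measure (Space n₁ n₂) := volume.withDensity fun y => ‖f y‖ₑ
  set P := G.stopping ν lam
  have hdis : P.PairwiseDisjoint G.cell := G.pairwiseDisjoint_maximal _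
  have hνuniv : ν univ = N := withDensity_enorm_univ
  set v : P → L2 n₁ n₂ := fun p => A.T (isBddCompactSupp_badPart (G := G) hf p).toL2
  set Ω := ⋃ p ∈ P, G.starCell p
  have hΩm : MeasurableSet Ω := .biUnion P.to_countable fun p _ => G.measurableSet_starCell p
  have hsumT : HasSum v (A.T (hf.toL2 - g)) := hsum.mapL A.T
  -- The series of the `T b_p` converges in `L²`, hence almost everywhere along a sequence of finite
  -- sets; each finite sum is dominated by the full sum of absolute values.
  have hbad : ∀ᵐ x, ‖A.T (hf.toL2 - g) x‖ₑ ≤ ∑' p : P, ‖v p x‖ₑ := by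
    obtain ⟨φ, -, hφ⟩ := (tendstoInMeasure_of_tendsto_Lp hsumT).exists_seq_tendsto_ae'
    have hcoe : ∀ᵐ x, ∀ n, (∑ p ∈ φ n, v p : L2 n₁ n₂) x = ∑ p ∈ φ n, v p x := by
      refine ae_all_iff.2 fun n => ?_
      filter_upwards [Lp.coeFn_finsetSum (φ n) v] with x hx
      rw [hx, Finset.sum_apply]
    filter_upwards [hφ, hcoe] with x hx hc
    refine le_of_tendsto (continuous_enorm.continuousAt.tendsto.comp hx) (.of_forall fun n => ?_)
    simp only [Function.comp_apply, hc]
    exact (enorm_sum_le _ _).trans (ENNReal.sum_le_tsum _)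
  have hE1 : lam * volume {x | lam < ‖A.T g x‖ₑ} ≤ ‖A.T‖₊ ^ 2 * (3 * (1 + G.dbl)) * N := by
    have h1 := (mul_measure_lt_map_le A.T g lam).trans (mul_le_mul_right hg _)
    rw [sq, mul_assoc] at h1
    refine (ENNReal.mul_le_mul_iff_right h0 hlam).1 (h1.trans_eq ?_)
    rw [enorm_eq_nnnorm]
    ring
  have hE2 : lam * volume Ω ≤ G.starDbl * N := by
    calc lam * volume Ω ≤ lam * ∑' p : P, volume (G.starCell p) := by
          gcongr
          exact measure_biUnion_le _ P.to_countable _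
      _ ≤ lam * ∑' p : P, G.starDbl * volume (G.cell p) := by
          gcongr
          exact G.measure_starCell_le _
      _ = G.starDbl * (lam * ∑' p : P, volume (G.cell p)) := by
          rw [ENNReal.tsum_mul_left]
          ring
      _ ≤ G.starDbl * N := by
          gcongr
          exact G.mul_tsum_stopping_le.trans_eq hνuniv
  have hE3 : lam * volume ({x | lam < ‖A.T (hf.toL2 - g) x‖ₑ} \ Ω) ≤ 2 * A.W * N := by
    calc lam * volume ({x | lam < ‖A.T (hf.toL2 - g) x‖ₑ} \ Ω)
        ≤ lam * (volume.restrict Ωᶜ) {x | lam ≤ ‖A.T (hf.toL2 - g) x‖ₑ} := by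
          rw [Measure.restrict_apply' hΩm.compl]
          gcongr
          exact fun x hx => ⟨le_of_lt (show lam < ‖A.T (hf.toL2 - g) x‖ₑ from hx.1), hx.2⟩
      _ ≤ ∫⁻ x in Ωᶜ, ‖A.T (hf.toL2 - g) x‖ₑ :=
          mul_meas_ge_le_lintegral₀ (Lp.aestronglyMeasurable _).enorm.restrict _
      _ ≤ ∫⁻ x in Ωᶜ, ∑' p : P, ‖v p x‖ₑ := lintegral_mono_ae (ae_restrict_of_ae hbad)
      _ = ∑' p : P, ∫⁻ x in Ωᶜ, ‖v p x‖ₑ := lintegral_tsum fun p =>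
          (Lp.aestronglyMeasurable _).enorm.restrict
      _ ≤ ∑' p : P, A.W * (2 * ν (G.cell p)) := by
          refine ENNReal.tsum_le_tsum fun p => ?_
          obtain ⟨x, hx, -⟩ := p.2.2
          have h1 := A.lintegral_compl_star_le (isBddCompactSupp_badPart (G := G) hf p)
            (l := p.1.1) (x := x)
            (fun y hy => indicator_of_notMem (by rwa [← G.cube_eq_cell hx]) _)
            (integral_badPart _)
          calc ∫⁻ x in Ωᶜ, ‖v p x‖ₑ ≤ ∫⁻ y in (G.star p.1.1 x)ᶜ, ‖v p y‖ₑ := by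
                refine lintegral_mono_set (compl_subset_compl.2 ?_)
                rw [← G.starCell_eq hx]
                exact subset_biUnion_of_mem (u := fun q => G.starCell q) p.2
            _ ≤ A.W * ∫⁻ y, ‖badPart G f p y‖ₑ := h1
            _ ≤ A.W * (2 * ν (G.cell p)) := by
                gcongr
                rw [withDensity_apply _ (G.measurableSet_cell p)]
                exact lintegral_badPart_le hf p.1
      _ = 2 * A.W * ∑' p : P, ν (G.cell p) := by
          rw [ENNReal.tsum_mul_left, ENNReal.tsum_mul_left]
          ring
      _ ≤ 2 * A.W * N := by
          gcongr
          rw [← G.measure_biUnion_cell hdis, ← hνuniv]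
          exact measure_mono (subset_univ _)
  have hsub : {x | 2 * lam < ‖A.T hf.toL2 x‖ₑ} ≤ᵐ[volume] ({x | lam < ‖A.T g x‖ₑ} ∪ (Ω ∪
      ({x | lam < ‖A.T (hf.toL2 - g) x‖ₑ} \ Ω)) : Set (Space n₁ n₂)) := by
    have h1 : A.T hf.toL2 = A.T g + A.T (hf.toL2 - g) := by rw [← map_add]; simp
    filter_upwards [Lp.coeFn_add (A.T g) (A.T (hf.toL2 - g))] with x hx hlt
    by_contra hcon
    rw [← h1] at hx
    have hlt : 2 * lam < ‖A.T hf.toL2 x‖ₑ := hlt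
    change x ∉ ({x | lam < ‖A.T g x‖ₑ} ∪ (Ω ∪
      ({x | lam < ‖A.T (hf.toL2 - g) x‖ₑ} \ Ω)) : Set (Space n₁ n₂)) at hcon
    simp only [mem_union, Set.mem_sdiff, mem_ofPred_eq, not_or, not_and, not_not, not_lt] at hcon
    obtain ⟨h2, h3, h4⟩ := hcon
    have h5 : ‖A.T (hf.toL2 - g) x‖ₑ ≤ lam := by
      by_contra h
      exact h3 (h4 (not_le.1 h))
    rw [hx, Pi.add_apply, two_mul] at hlt
    exact absurd hlt (not_lt.2 ((enorm_add_le _ _).trans (add_le_add h2 h5)))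
  calc lam * volume {x | 2 * lam < ‖A.T hf.toL2 x‖ₑ}
      ≤ lam * (volume {x | lam < ‖A.T g x‖ₑ} + (volume Ω +
        volume ({x | lam < ‖A.T (hf.toL2 - g) x‖ₑ} \ Ω))) := by
        gcongr
        refine (measure_mono_ae hsub).trans ((measure_union_le _ _).trans ?_)
        gcongr
        exact measure_union_le _ _
    _ ≤ ‖A.T‖₊ ^ 2 * (3 * (1 + G.dbl)) * N + (G.starDbl * N + 2 * A.W * N) := by
        rw [mul_add, mul_add]
        gcongr
    _ = C₀ * N := by
        simp only [C₀]
        push_cast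
        ring

end CZOperator
end Grushin
end

noncomputable section
namespace Grushin
open Filter Topology
variable {n₁ n₂ : ℕ}

/-! ### The stopping construction -/

/-- Every dilated cell of `G` is contained in a cell of comparable size of one of the grids `𝒢 t`,
whose level is smaller by `c`. -/
def IsAdjacent {ι : Type} (G : StarGrid n₁ n₂ ι) {m : ℕ}
    (𝒢 : Fin m → Grid (volume : Measure (Space n₁ n₂)) ι) (c : ℤ) (D : ℝ≥0) : Prop :=
  ∀ k x, ∃ t, G.star k x ⊆ (𝒢 t).cube (k - c) x ∧
    volume ((𝒢 t).cube (k - c) x) ≤ D * volume (G.cube k x)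

namespace CZOperator

variable {ι : Type} {G : StarGrid n₁ n₂ ι} (A : CZOperator G)

theorem ae_map_indicator_add {f : Space n₁ n₂ → ℂ} (hf : IsBddCompactSupp f)
    {s : Set (Space n₁ n₂)} (hs : MeasurableSet s) :
    ∀ᵐ x, A.T hf.toL2 x = A.T (hf.indicator hs).toL2 x + A.T (hf.indicator hs.compl).toL2 x := by
  have h : hf.toL2 = (hf.indicator hs).toL2 + (hf.indicator hs.compl).toL2 := by
    rw [← IsBddCompactSupp.toL2_add]
    simp [IsBddCompactSupp.toL2]
  rw [h, map_add]
  exact Lp.coeFn_add _ _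

variable [Countable ι]

/-- If `|T f| ≤ a` on a large part of a cell, and the averages of `|f|` over the dilates of its
ancestors are at most `a`, then the part of `f` off the dilate contributes `O(a)` on the cell. -/
theorem exists_ae_map_compl_le : ∃ C : ℝ≥0, ∀ f : Space n₁ n₂ → ℂ, ∀ hf : IsBddCompactSupp f,
    ∀ (k : ℤ) (x : Space n₁ n₂) (a : ℝ≥0∞), a ≠ 0 → a ≠ ⊤ →
      volume ({y | a < ‖A.T hf.toL2 y‖ₑ} ∩ G.cube k x) ≤ 4⁻¹ * volume (G.cube k x) →
      (∀ l, ∫⁻ y in G.star l x, ‖f y‖ₑ ≤ a * volume (G.star l x)) →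
      ∀ᵐ y, y ∈ G.cube k x →
        ‖A.T (hf.indicator (G.measurableSet_star k x).compl).toL2 y‖ₑ ≤ C * a := by
  obtain ⟨Cw, hCw⟩ := A.exists_weakType
  -- With this `K` the weak type bound leaves at most a quarter of the cell where `T f₁` exceeds `K
  -- a`; the `+ 1` keeps `K` nonzero.
  set K : ℝ≥0 := 4 * (Cw * G.starDbl) + 1
  refine ⟨1 + K + A.W, fun f hf k x a h0 htop hlevel havg => ?_⟩
  have hs := G.measurableSet_star k x
  set f₁ := (G.star k x).indicator f
  have hf₁ : IsBddCompactSupp f₁ := hf.indicator hs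
  have hf₂ : IsBddCompactSupp ((G.star k x)ᶜ.indicator f) := hf.indicator hs.compl
  have hK0 : (K : ℝ≥0∞) ≠ 0 := by
    simp [K]
  have hKa0 : (K : ℝ≥0∞) * a ≠ 0 := mul_ne_zero hK0 h0
  have hKatop : (K : ℝ≥0∞) * a ≠ ⊤ := ENNReal.mul_ne_top ENNReal.coe_ne_top htop
  have hweak : volume {y | K * a < ‖A.T hf₁.toL2 y‖ₑ} ≤ 4⁻¹ * volume (G.cube k x) := by
    have h1 := hCw f₁ hf₁ (K * a) hKa0 hKatop
    have h2 : ∫⁻ y, ‖f₁ y‖ₑ ≤ a * (G.starDbl * volume (G.cube k x)) := by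
      calc ∫⁻ y, ‖f₁ y‖ₑ = ∫⁻ y in G.star k x, ‖f y‖ₑ := by
            simp only [f₁, enorm_indicator_eq_indicator_enorm]
            exact lintegral_indicator hs _
        _ ≤ a * volume (G.star k x) := havg k
        _ ≤ _ := by gcongr; exact G.star_le k x
    have h3 : (K * a) * volume {y | K * a < ‖A.T hf₁.toL2 y‖ₑ} ≤
        (K * a) * (4⁻¹ * volume (G.cube k x)) := by
      calc _ ≤ Cw * ∫⁻ y, ‖f₁ y‖ₑ := h1
        _ ≤ Cw * (a * (G.starDbl * volume (G.cube k x))) := by gcongr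
        _ = (4 * (Cw * G.starDbl) * a) * (4⁻¹ * volume (G.cube k x)) := by
            have : (4 : ℝ≥0∞) * 4⁻¹ = 1 := ENNReal.mul_inv_cancel (by norm_num) (by norm_num)
            calc _ = (4 * 4⁻¹ : ℝ≥0∞) * (Cw * (a * (G.starDbl * volume (G.cube k x)))) := by
                  rw [this, one_mul]
              _ = _ := by ring
        _ ≤ _ := by
            gcongr
            simp only [K]
            push_cast
            exact le_self_add
    exact (ENNReal.mul_le_mul_iff_right hKa0 hKatop).1 h3
  obtain ⟨p, hp, hosc⟩ := A.exists_ae_enorm_sub_le hf₂ (l := k) (x := x) (a := a)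
    (fun y hy => indicator_of_notMem (by simpa using hy) _) (fun i => by
      refine le_trans (lintegral_mono fun y => ?_) (havg (k - i - 1))
      exact enorm_indicator_le_enorm_self _ _)
  have hsplit := A.ae_map_indicator_add hf hs
  -- The two exceptional sets fill at most half of the cell, so a point `z` with both values under
  -- control remains. The oscillation bound then transfers the estimate at `z` to the whole cell.
  have hgood : ∃ z ∈ G.cube k x, ‖A.T hf.toL2 z‖ₑ ≤ a ∧ ‖A.T hf₁.toL2 z‖ₑ ≤ K * a ∧ p z ∧
      A.T hf.toL2 z = A.T hf₁.toL2 z + A.T hf₂.toL2 z := by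
    by_contra hcon
    push Not at hcon
    have hsub : G.cube k x ≤ᵐ[volume] (({y | a < ‖A.T hf.toL2 y‖ₑ} ∩ G.cube k x) ∪
        {y | K * a < ‖A.T hf₁.toL2 y‖ₑ} : Set (Space n₁ n₂)) := by
      filter_upwards [hp, hsplit] with z hpz hz hzQ
      by_contra h
      change z ∉ (({y | a < ‖A.T hf.toL2 y‖ₑ} ∩ G.cube k x) ∪
        {y | K * a < ‖A.T hf₁.toL2 y‖ₑ} : Set (Space n₁ n₂)) at h
      simp only [mem_union, mem_inter_iff, mem_ofPred_eq, not_or, not_and, not_lt] at h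
      refine hcon z hzQ ?_ h.2 hpz hz
      by_contra h'
      exact h.1 (not_le.1 h') hzQ
    have h1 : volume (G.cube k x) ≤ 2⁻¹ * volume (G.cube k x) := by
      calc volume (G.cube k x) ≤ 4⁻¹ * volume (G.cube k x) + 4⁻¹ * volume (G.cube k x) :=
            (measure_mono_ae hsub).trans ((measure_union_le _ _).trans (add_le_add hlevel hweak))
        _ = (4⁻¹ * 2) * volume (G.cube k x) := by ring
        _ = _ := by
            congr 1
            rw [show (4 : ℝ≥0∞) = 2 * 2 by norm_num,
              ENNReal.mul_inv (by norm_num) (by norm_num), mul_assoc,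
              ENNReal.inv_mul_cancel (by norm_num) (by norm_num), mul_one]
    have h2 : 2⁻¹ * volume (G.cube k x) < volume (G.cube k x) := by
      rw [mul_comm, ← div_eq_mul_inv]
      exact ENNReal.half_lt_self (G.cube_ne_zero k x) (G.cube_ne_top k x)
    exact absurd h1 (not_le.2 h2)
  obtain ⟨z, hzQ, hz1, hz2, hpz, hz⟩ := hgood
  filter_upwards [hp] with ξ hξ hξQ
  have h1 : ‖A.T hf₂.toL2 z‖ₑ ≤ a + K * a := by
    have : A.T hf₂.toL2 z = A.T hf.toL2 z - A.T hf₁.toL2 z := by rw [hz]; ring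
    rw [this]
    exact enorm_sub_le.trans (add_le_add hz1 hz2)
  calc ‖A.T hf₂.toL2 ξ‖ₑ = ‖(A.T hf₂.toL2 ξ - A.T hf₂.toL2 z) + A.T hf₂.toL2 z‖ₑ := by
        rw [sub_add_cancel]
    _ ≤ A.W * a + (a + K * a) :=
        (enorm_add_le _ _).trans (add_le_add (hosc ξ hξQ z hzQ hξ hpz) h1)
    _ = _ := by push_cast; ring

/-- One step of the stopping construction. -/
theorem exists_stopping_step {m : ℕ} {𝒢 : Fin m → Grid (volume : Measure (Space n₁ n₂)) ι} {c : ℤ}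
    {D : ℝ≥0} (hadj : IsAdjacent G 𝒢 c D) :
    ∃ C : ℝ≥0, ∀ f : Space n₁ n₂ → ℂ, ∀ hf : IsBddCompactSupp f, ∀ q : ℤ × ι,
      ∃ P : Set (ℤ × ι), P.PairwiseDisjoint G.cell ∧
        (∀ p ∈ P, q.1 < p.1 ∧ (G.cell p).Nonempty ∧ G.cell p ⊆ G.cell q) ∧
        2 * ∑' p : P, volume (G.cell p) ≤ volume (G.cell q) ∧
        (∀ᵐ x, x ∈ G.cell q → x ∉ ⋃ p ∈ P, G.cell p →
          ‖A.T (hf.indicator (G.measurableSet_starCell q)).toL2 x‖ₑ ≤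
            C * ((∫⁻ y in G.starCell q, ‖f y‖ₑ) / volume (G.cell q))) ∧
        ∀ p ∈ P, ∀ᵐ x, x ∈ G.cell p →
          ‖A.T (hf.indicator (G.measurableSet_starCell q)).toL2 x‖ₑ ≤
            C * ((∫⁻ y in G.starCell q, ‖f y‖ₑ) / volume (G.cell q)) +
              ‖A.T (hf.indicator (G.measurableSet_starCell p)).toL2 x‖ₑ := by
  obtain ⟨Cw, hCw⟩ := A.exists_weakType
  obtain ⟨Ck, hCk⟩ := A.exists_ae_map_compl_le
  -- `B` collects the weak type constants of the three exceptional sets below. `α` is so large that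
  -- they fill at most the fraction `1 / (2 E')` of the cell, and `1 / E'` is the density at which
  -- the construction stops.
  set B : ℝ≥0 := Cw + (m * (D + 1) + 4 * Cw)
  set E' : ℝ≥0 := 2 * (G.dbl + 1)
  set α : ℝ≥0 := 2 * (E' * B) + 1
  refine ⟨(Ck + 1) * α, fun f hf q => ?_⟩
  rcases (G.cell q).eq_empty_or_nonempty with hq | ⟨x₀, hx₀⟩
  · exact ⟨∅, by simp, by simp, by simp, by simp [hq], by simp⟩
  set s := G.starCell q with hsdef
  have hs : MeasurableSet s := G.measurableSet_starCell q
  set g := s.indicator f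
  have hg : IsBddCompactSupp g := hf.indicator hs
  set N := ∫⁻ y in s, ‖f y‖ₑ
  have hgN : ∫⁻ y, ‖g y‖ₑ = N := by
    simp only [g, enorm_indicator_eq_indicator_enorm]
    exact lintegral_indicator hs _
  have hNtop : N ≠ ⊤ := by rw [← hgN]; exact hg.lintegral_ne_top
  set V := volume (G.cell q)
  have hVcube : V = volume (G.cube q.1 x₀) := by rw [G.cube_eq_cell hx₀]
  have hV0 : V ≠ 0 := by rw [hVcube]; exact G.cube_ne_zero _ _
  have hVtop : V ≠ ⊤ := G.cell_ne_top q
  -- For `N = 0` the height `a` would vanish, but then `T g = 0` and no children are needed.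
  rcases eq_or_ne N 0 with hN0 | hN0
  · have hT : A.T hg.toL2 = 0 := by
      have h1 : g =ᵐ[volume] 0 := by
        rw [hN0, lintegral_eq_zero_iff' hg.meas.enorm] at hgN
        filter_upwards [hgN] with x hx
        simpa using hx
      rw [hg.toL2_congr .zero h1]
      simp [IsBddCompactSupp.toL2]
    refine ⟨∅, by simp, by simp, by simp, ?_, by simp⟩
    filter_upwards [Lp.coeFn_zero ℂ 2 (volume : Measure (Space n₁ n₂))] with x hx _ _
    change ‖A.T hg.toL2 x‖ₑ ≤ _
    rw [hT, hx]
    simp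
  set a : ℝ≥0∞ := α * (N / V)
  have hα0 : (α : ℝ≥0∞) ≠ 0 := by simp [α]
  have ha0 : a ≠ 0 := mul_ne_zero hα0 (ENNReal.div_ne_zero.2 ⟨hN0, hVtop⟩)
  have hatop : a ≠ ⊤ := ENNReal.mul_ne_top ENNReal.coe_ne_top (ENNReal.div_ne_top hNtop hV0)
  set ν : Measure (Space n₁ n₂) := volume.withDensity fun y => ‖g y‖ₑ
  have hνuniv : ν univ = N := by rw [← hgN]; exact withDensity_enorm_univ
  have hνtop : ν univ ≠ ⊤ := by rwa [hνuniv]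
  set E₁ : Set (Space n₁ n₂) := {x | a < ‖A.T hg.toL2 x‖ₑ}
  have hE₁m : MeasurableSet E₁ :=
    measurableSet_lt measurable_const (Lp.stronglyMeasurable _).measurable.enorm
  have hE₁ : a * volume E₁ ≤ Cw * N := by rw [← hgN]; exact hCw g hg a ha0 hatop
  -- The threshold is lowered by the factor `D + 1` because averages over dilates are tested on
  -- adjacent cells, which may be larger by the factor `D`.
  set b : ℝ≥0∞ := a / (D + 1 : ℝ≥0)
  have hD1 : ((D + 1 : ℝ≥0) : ℝ≥0∞) ≠ 0 := by simp
  have hb0 : b ≠ 0 := ENNReal.div_ne_zero.2 ⟨ha0, ENNReal.coe_ne_top⟩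
  have hab : (D + 1 : ℝ≥0) * b = a := ENNReal.mul_div_cancel hD1 ENNReal.coe_ne_top
  set E₂ : Set (Space n₁ n₂) := ⋃ t, ⋃ p ∈ (𝒢 t).heavy ν b, (𝒢 t).cell p
  have hE₂m : MeasurableSet E₂ :=
    .iUnion fun t => .biUnion (to_countable _) fun p _ => (𝒢 t).measurableSet_cell p
  have hE₂ : a * volume E₂ ≤ (m * (D + 1 : ℝ≥0)) * N := by
    calc a * volume E₂ ≤ a * ∑' t, volume (⋃ p ∈ (𝒢 t).heavy ν b, (𝒢 t).cell p) := by
          gcongr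
          exact measure_iUnion_le _
      _ = ∑ t, (D + 1 : ℝ≥0) * (b * volume (⋃ p ∈ (𝒢 t).heavy ν b, (𝒢 t).cell p)) := by
          rw [tsum_fintype, Finset.mul_sum]
          refine Finset.sum_congr rfl fun t _ => ?_
          rw [← mul_assoc, hab]
      _ ≤ ∑ t : Fin m, (D + 1 : ℝ≥0) * N := by
          gcongr with t
          rw [← hνuniv]
          exact (𝒢 t).mul_measure_iUnion_heavy_le hνtop hb0
      _ = _ := by simp [mul_assoc]
  set ν₁ : Measure (Space n₁ n₂) := volume.restrict E₁
  have hν₁univ : ν₁ univ = volume E₁ := Measure.restrict_apply_univ _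
  have hE₁top : volume E₁ ≠ ⊤ := by
    intro h
    rw [h, ENNReal.mul_top ha0] at hE₁
    exact (ENNReal.mul_ne_top ENNReal.coe_ne_top hNtop) (top_le_iff.1 hE₁)
  -- Cells in which `E₁` has density above `1/4` are removed, so that at the remaining points the
  -- level set hypothesis of `exists_ae_map_compl_le` holds at every level.
  set E₃ : Set (Space n₁ n₂) := ⋃ p ∈ G.heavy ν₁ 4⁻¹, G.cell p
  have hE₃m : MeasurableSet E₃ := .biUnion (to_countable _) fun p _ => G.measurableSet_cell p
  have hE₃ : a * volume E₃ ≤ 4 * Cw * N := by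
    have h1 : 4⁻¹ * volume E₃ ≤ volume E₁ := by
      rw [← hν₁univ]
      exact G.mul_measure_iUnion_heavy_le (by rwa [hν₁univ]) (by norm_num)
    calc a * volume E₃ = 4 * (a * (4⁻¹ * volume E₃)) := by
          have : (4 : ℝ≥0∞) * 4⁻¹ = 1 := ENNReal.mul_inv_cancel (by norm_num) (by norm_num)
          calc _ = (4 * 4⁻¹ : ℝ≥0∞) * (a * volume E₃) := by rw [this, one_mul]
            _ = _ := by ring
      _ ≤ 4 * (a * volume E₁) := by gcongr
      _ ≤ 4 * (Cw * N) := by gcongr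
      _ = _ := by ring
  set E : Set (Space n₁ n₂) := (E₁ ∪ (E₂ ∪ E₃)) ∩ G.cell q
  have hEm : MeasurableSet E := (hE₁m.union (hE₂m.union hE₃m)).inter (G.measurableSet_cell q)
  have hE : a * volume E ≤ B * N := by
    calc a * volume E ≤ a * (volume E₁ + (volume E₂ + volume E₃)) := by
          gcongr
          refine (measure_mono inter_subset_left).trans ((measure_union_le _ _).trans ?_)
          gcongr
          exact measure_union_le _ _
      _ ≤ Cw * N + ((m * (D + 1 : ℝ≥0)) * N + 4 * Cw * N) := by
          rw [mul_add, mul_add]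
          gcongr
      _ = B * N := by simp only [B]; push_cast; ring
  have hE' : (2 * E' : ℝ≥0) * volume E ≤ V := by
    have h1 : (N / V) * ((2 * E' : ℝ≥0) * volume E * α) ≤ (N / V) * (V * α) := by
      calc (N / V) * ((2 * E' : ℝ≥0) * volume E * α) = (2 * E' : ℝ≥0) * (a * volume E) := by
            simp only [a]; ring
        _ ≤ (2 * E' : ℝ≥0) * (B * N) := by gcongr
        _ = (2 * (E' * B) : ℝ≥0) * N := by push_cast; ring
        _ ≤ α * N := by
            gcongr
            exact le_self_add
        _ = (N / V) * (V * α) := by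
            rw [← mul_assoc, ENNReal.div_mul_cancel hV0 hVtop, mul_comm]
    have h2 := (ENNReal.mul_le_mul_iff_right (ENNReal.div_ne_zero.2 ⟨hN0, hVtop⟩)
      (ENNReal.div_ne_top hNtop hV0)).1 h1
    exact (ENNReal.mul_le_mul_iff_left hα0 ENNReal.coe_ne_top).1 h2
  have hE'0 : (E' : ℝ≥0∞) ≠ 0 := by simp [E']
  -- The density `θ` satisfies `θ * dbl < 1`, so a stopping cell is never contained in `E`. On the
  -- other hand `2 |E| ≤ θ V` makes the stopping cells fill at most half of the cell.
  set θ : ℝ≥0∞ := (E' : ℝ≥0∞)⁻¹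
  have hθE' : E' * θ = 1 := ENNReal.mul_inv_cancel hE'0 ENNReal.coe_ne_top
  have hθ0 : θ ≠ 0 := ENNReal.inv_ne_zero.2 ENNReal.coe_ne_top
  have hθtop : θ ≠ ⊤ := ENNReal.inv_ne_top.2 hE'0
  have hEV : 2 * volume E ≤ θ * V := by
    calc 2 * volume E = θ * ((2 * E' : ℝ≥0) * volume E) := by
          push_cast
          calc 2 * volume E = (E' * θ) * (2 * volume E) := by rw [hθE', one_mul]
            _ = _ := by ring
      _ ≤ θ * V := by gcongr
  have hEtop : volume E ≠ ⊤ := ((measure_mono inter_subset_right).trans_lt hVtop.lt_top).ne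
  set ν₂ : Measure (Space n₁ n₂) := volume.restrict E
  have hν₂univ : ν₂ univ = volume E := Measure.restrict_apply_univ _
  have hν₂ : ∀ p, ν₂ (G.cell p) = volume (G.cell p ∩ E) := fun p =>
    Measure.restrict_apply (G.measurableSet_cell p)
  set P := G.stopping ν₂ θ
  have hθ1 : θ < 1 := by
    rw [ENNReal.inv_lt_one]
    have : (1 : ℝ≥0) < E' := by
      simp only [E']
      have : (0 : ℝ≥0) ≤ G.dbl := zero_le
      calc (1 : ℝ≥0) < 2 * (0 + 1) := by norm_num
        _ ≤ 2 * (G.dbl + 1) := by gcongr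
    exact_mod_cast this
  have hPsub : ∀ p ∈ P, q.1 < p.1 ∧ G.cell p ⊆ G.cell q := by
    intro p hp
    have hheavy : θ * volume (G.cell p) < volume (G.cell p ∩ E) := by
      have : θ * volume (G.cell p) < ν₂ (G.cell p) := hp.1
      rwa [hν₂] at this
    obtain ⟨y, hyp, hyE⟩ : (G.cell p ∩ E).Nonempty :=
      nonempty_of_measure_ne_zero (ne_bot_of_gt hheavy)
    -- A cell containing `q` is too large to have density above `θ`, since `E` is a small part of
    -- `q`.
    have hlt : q.1 < p.1 := by
      by_contra hle
      have h1 : G.cell q ⊆ G.cell p := by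
        rw [← G.cube_eq_cell hyE.2, ← G.cube_eq_cell hyp]
        exact G.cube_subset_cube (not_lt.1 hle) y
      have h2 : θ * V < θ * V := by
        calc θ * V ≤ θ * volume (G.cell p) := by gcongr; exact measure_mono h1
          _ < volume (G.cell p ∩ E) := hheavy
          _ ≤ volume E := measure_mono inter_subset_right
          _ ≤ 2 * volume E := le_mul_of_one_le_left' (by norm_num)
          _ ≤ θ * V := hEV
      exact lt_irrefl _ h2
    refine ⟨hlt, ?_⟩
    rw [← G.cube_eq_cell hyE.2, ← G.cube_eq_cell hyp]
    exact G.cube_subset_cube hlt.le y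
  refine ⟨P, G.pairwiseDisjoint_maximal _, fun p hp => ⟨(hPsub p hp).1, ?_, (hPsub p hp).2⟩,
    ?_, ?_, ?_⟩
  · obtain ⟨x, hx, -⟩ := hp.2
    exact ⟨x, hx⟩
  · have h1 : θ * (2 * ∑' p : P, volume (G.cell p)) ≤ θ * V := by
      calc θ * (2 * ∑' p : P, volume (G.cell p)) = 2 * (θ * ∑' p : P, volume (G.cell p)) := by ring
        _ ≤ 2 * volume E := by
            gcongr
            rw [← hν₂univ]
            exact G.mul_tsum_stopping_le
        _ ≤ θ * V := hEV
    exact (ENNReal.mul_le_mul_iff_right hθ0 hθtop).1 h1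
  -- Outside the stopping cells all densities of `E` are at most `θ < 1`, so by differentiation of
  -- the indicator almost every such point lies outside `E`.
  · have hae := G.ae_le_of_lintegral_cube_le (h := E.indicator fun _ => 1)
      ((measurable_const.indicator hEm).aemeasurable)
      (by rw [lintegral_indicator hEm]; simpa using hEtop) hθ0 hθtop
    filter_upwards [hae] with x hx hxq hxP
    have hxE : x ∉ E := by
      intro hxE
      have h1 : (1 : ℝ≥0∞) ≤ θ := by
        have := hx fun k => ?_
        · rwa [indicator_of_mem hxE] at this
        rw [lintegral_indicator hEm, setLIntegral_one, Measure.restrict_apply hEm, inter_comm]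
        by_contra hcon
        have h2 : θ * volume (G.cube k x) < ν₂ (G.cube k x) := by
          change _ < ν₂ (G.cell (k, G.idx k x))
          rw [hν₂]
          exact not_le.1 hcon
        obtain ⟨p, hp, hxp, -⟩ := G.exists_mem_stopping (by rwa [hν₂univ]) hθ0 h2
        exact hxP (mem_iUnion₂.2 ⟨p, hp, hxp⟩)
      exact absurd h1 (not_le.2 hθ1)
    have h1 : ‖A.T hg.toL2 x‖ₑ ≤ a := by
      by_contra hcon
      exact hxE ⟨.inl (not_le.1 hcon), hxq⟩
    refine h1.trans ?_
    simp only [a]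
    rw [ENNReal.coe_mul, mul_assoc]
    refine le_mul_of_one_le_left' ?_
    push_cast
    exact le_add_self
  · intro p hp
    -- A stopping cell has density at most `θ * dbl < 1`, so it has a point outside `E`. That one
    -- point controls the level set in the cell and the averages over all dilates around it.
    obtain ⟨x, hxp, hxE⟩ : ∃ x ∈ G.cell p, x ∉ E := by
      by_contra hcon
      push Not at hcon
      have h1 : volume (G.cell p) ≤ θ * G.dbl * volume (G.cell p) := by
        calc volume (G.cell p) ≤ ν₂ (G.cell p) := by
              rw [hν₂, inter_eq_left.2 hcon]
          _ ≤ _ := G.measure_cell_le_of_mem_stopping hp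
      have h2 : θ * G.dbl < 1 := by
        calc θ * G.dbl < θ * E' := by
              refine (ENNReal.mul_lt_mul_iff_right hθ0 hθtop).2 ?_
              have : G.dbl < E' := by
                simp only [E']
                calc G.dbl < G.dbl + 1 := lt_add_one _
                  _ ≤ 2 * (G.dbl + 1) := le_mul_of_one_le_left' (by norm_num)
              exact_mod_cast this
          _ = 1 := by rw [mul_comm, hθE']
      obtain ⟨y, hy, -⟩ := hp.2
      have h3 : volume (G.cell p) ≠ 0 := by
        rw [← G.cube_eq_cell hy]
        exact G.cube_ne_zero _ _
      have h4 : θ * G.dbl * volume (G.cell p) < 1 * volume (G.cell p) :=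
        (ENNReal.mul_lt_mul_iff_left h3 (G.cell_ne_top p)).2 h2
      rw [one_mul] at h4
      exact absurd h1 (not_le.2 h4)
    have hxq : x ∈ G.cell q := (hPsub p hp).2 hxp
    have hx₁₂₃ : x ∉ E₁ ∪ (E₂ ∪ E₃) := fun h => hxE ⟨h, hxq⟩
    simp only [mem_union, not_or] at hx₁₂₃
    have hlevel : volume (E₁ ∩ G.cube p.1 x) ≤ 4⁻¹ * volume (G.cube p.1 x) := by
      by_contra hcon
      refine hx₁₂₃.2.2 (mem_iUnion₂.2 ⟨p, ?_, hxp⟩)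
      change 4⁻¹ * volume (G.cell p) < ν₁ (G.cell p)
      rw [Measure.restrict_apply (G.measurableSet_cell p), inter_comm, ← G.cube_eq_cell hxp]
      exact not_le.1 hcon
    have havg : ∀ l, ∫⁻ y in G.star l x, ‖g y‖ₑ ≤ a * volume (G.star l x) := by
      intro l
      by_contra hcon
      obtain ⟨t, ht, hvol⟩ := hadj l x
      refine hx₁₂₃.2.1 (mem_iUnion.2 ⟨t, mem_iUnion₂.2
        ⟨(l - c, (𝒢 t).idx (l - c) x), ?_, (𝒢 t).mem_cube_self _ _⟩⟩)
      change b * volume ((𝒢 t).cube (l - c) x) < ν ((𝒢 t).cube (l - c) x)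
      calc b * volume ((𝒢 t).cube (l - c) x) ≤ b * ((D + 1 : ℝ≥0) * volume (G.cube l x)) := by
            gcongr
            refine hvol.trans ?_
            gcongr
            exact le_self_add
        _ = a * volume (G.cube l x) := by rw [← mul_assoc, mul_comm b, hab]
        _ ≤ a * volume (G.star l x) := by gcongr; exact G.cube_subset_star l x
        _ < ∫⁻ y in G.star l x, ‖g y‖ₑ := not_le.1 hcon
        _ ≤ ∫⁻ y in (𝒢 t).cube (l - c) x, ‖g y‖ₑ := lintegral_mono_set ht
        _ = ν ((𝒢 t).cube (l - c) x) :=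
            (withDensity_apply _ ((𝒢 t).measurableSet_cube _ _)).symm
    have hkey := hCk g hg p.1 x a ha0 hatop hlevel havg
    have hstarx : G.starCell p = G.star p.1 x := G.starCell_eq hxp
    have hsub : G.star p.1 x ⊆ s := by
      rw [hsdef, G.starCell_eq hxq]
      exact G.star_subset_star (hPsub p hp).1.le x
    -- The dilate of `p` lies in the dilate of `q`, so cutting `g` down to it gives the function
    -- from which the next step starts.
    have hcomp : (hg.indicator (G.measurableSet_star p.1 x)).toL2 =
        (hf.indicator (G.measurableSet_starCell p)).toL2 := by
      refine IsBddCompactSupp.toL2_congr _ _ (ae_of_all _ fun y => ?_)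
      simp only [g]
      rw [indicator_indicator, inter_eq_left.2 hsub, hstarx]
    filter_upwards [hkey, A.ae_map_indicator_add hg (G.measurableSet_star p.1 x)] with y hy1 hy2 hyp
    change ‖A.T hg.toL2 y‖ₑ ≤ _
    rw [hy2, hcomp, add_comm]
    refine (enorm_add_le _ _).trans ?_
    gcongr
    refine (hy1 (by rwa [G.cube_eq_cell hxp])).trans ?_
    simp only [a]
    rw [← mul_assoc]
    gcongr
    push_cast
    gcongr
    exact le_self_add

end CZOperator
end Grushin
end

noncomputable section
namespace Grushin
open Filter Topology
variable {n₁ n₂ : ℕ}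

/-! ### Sparse domination -/

namespace StarGrid

variable {ι : Type} (G : StarGrid n₁ n₂ ι)

/-- The cells of level at most `k₀` in the Whitney-type partition of the space around the cells
that contain `x₀`. -/
def rootCells (x₀ : Space n₁ n₂) (k₀ : ℤ) : Set (ℤ × ι) :=
  {p | p.1 ≤ k₀ ∧ (G.cell p).Nonempty ∧ G.cell p ⊆ G.cube (p.1 - 1) x₀ ∧
    (p.1 = k₀ ∨ Disjoint (G.cell p) (G.cube p.1 x₀))}

/-- For roots of different levels, the coarser one avoids the cell around `x₀` of its own level,
while the finer one lies inside that cell. -/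
theorem pairwiseDisjoint_rootCells (x₀ : Space n₁ n₂) (k₀ : ℤ) :
    (G.rootCells x₀ k₀).PairwiseDisjoint G.cell := by
  have key : ∀ p ∈ G.rootCells x₀ k₀, ∀ q ∈ G.rootCells x₀ k₀, ∀ x ∈ G.cell p, x ∈ G.cell q →
      ¬ p.1 < q.1 := by
    intro p hp q hq x hxp hxq hlt
    rcases hp.2.2.2 with h | h
    · exact absurd hq.1 (by omega)
    · exact Set.disjoint_left.1 h hxp (G.cube_subset_cube (by omega) x₀ (hq.2.2.1 hxq))
  intro p hp q hq hpq
  refine Set.disjoint_left.2 fun x hxp hxq => hpq ?_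
  have h : p.1 = q.1 :=
    le_antisymm (not_lt.1 (key q hq p hp x hxq hxp)) (not_lt.1 (key p hp q hq x hxp hxq))
  exact Prod.ext h (by rw [← G.mem_cell.1 hxp, ← G.mem_cell.1 hxq, h])

/-- The root is found at the first level, counted upwards from `k₀`, at which the cell around `x₀`
contains `x`: it is the cell of `x` one level below, or the cell of level `k₀` itself. -/
theorem exists_mem_rootCells {x₀ : Space n₁ n₂} (k₀ : ℤ) {x : Space n₁ n₂}
    (h : ∃ k, x ∈ G.cube k x₀) : ∃ p ∈ G.rootCells x₀ k₀, x ∈ G.cell p := by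
  classical
  have hex : ∃ i : ℕ, x ∈ G.cube (k₀ - i) x₀ := by
    obtain ⟨k, hk⟩ := h
    exact ⟨(k₀ - k).toNat, G.cube_subset_cube (by omega) x₀ hk⟩
  rcases hn : Nat.find hex with _ | j
  · have h0 : x ∈ G.cube k₀ x₀ := by
      have := Nat.find_spec hex
      rw [hn] at this
      simpa using this
    refine ⟨(k₀, G.idx k₀ x), ⟨le_rfl, ⟨x, rfl⟩, ?_, .inl rfl⟩, rfl⟩
    change G.cube k₀ x ⊆ _
    rw [G.cube_eq_of_mem h0]
    exact G.cube_subset_cube (by omega) x₀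
  · have h1 : x ∈ G.cube (k₀ - (j + 1 : ℕ)) x₀ := hn ▸ Nat.find_spec hex
    have h2 : x ∉ G.cube (k₀ - j) x₀ := Nat.find_min hex (by omega)
    have e : k₀ - ((j + 1 : ℕ) : ℤ) = k₀ - j - 1 := by push_cast; ring
    rw [e] at h1
    refine ⟨(k₀ - j, G.idx (k₀ - j) x), ⟨by simp, ⟨x, rfl⟩, ?_, .inr ?_⟩, rfl⟩
    · change G.cube (k₀ - j) x ⊆ G.cube (k₀ - j - 1) x₀
      rw [← G.cube_eq_of_mem h1]
      exact G.cube_subset_cube (by omega) x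
    · refine Set.disjoint_left.2 fun y hy hy' => h2 ?_
      exact (show G.idx _ x = _ from (show G.idx _ y = G.idx _ x from hy).symm.trans hy')

/-- The parent of a root is a cell around `x₀`, and the dilate contains the parent. If the cell of
level `k₀` around `x₀` contains the support of `f`, restricting `f` to the dilate of a root
therefore changes nothing. -/
theorem cube_subset_starCell {x₀ : Space n₁ n₂} {k₀ : ℤ} {p : ℤ × ι}
    (hp : p ∈ G.rootCells x₀ k₀) : G.cube k₀ x₀ ⊆ G.starCell p := by
  obtain ⟨hle, ⟨y, hy⟩, hsub, -⟩ := hp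
  rw [G.starCell_eq hy]
  refine subset_trans ?_ (G.cube_pred_subset_star p.1 y)
  rw [G.cube_eq_of_mem (hsub hy)]
  exact G.cube_subset_cube (by omega) x₀

/-- The generations of a tree of cells in which `P q` is the set of children of `q`. -/
def generation (R : Set (ℤ × ι)) (P : ℤ × ι → Set (ℤ × ι)) : ℕ → Set (ℤ × ι)
  | 0 => R
  | n + 1 => ⋃ q ∈ generation R P n, P q

section Tree

variable {R : Set (ℤ × ι)} {P : ℤ × ι → Set (ℤ × ι)}

theorem mem_generation_succ {n : ℕ} {p : ℤ × ι} :
    p ∈ generation R P (n + 1) ↔ ∃ q ∈ generation R P n, p ∈ P q := by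
  simp [generation]

variable (hR : R.PairwiseDisjoint G.cell) (hP : ∀ q, (P q).PairwiseDisjoint G.cell)
  (hsub : ∀ q, ∀ p ∈ P q, G.cell p ⊆ G.cell q)

include hR hP hsub in
theorem pairwiseDisjoint_generation (n : ℕ) : (generation R P n).PairwiseDisjoint G.cell := by
  induction n with
  | zero => exact hR
  | succ n ih =>
    intro p hp p' hp' hne
    obtain ⟨q, hq, hpq⟩ := mem_generation_succ.1 hp
    obtain ⟨q', hq', hpq'⟩ := mem_generation_succ.1 hp'
    rcases eq_or_ne q q' with rfl | h
    · exact hP q hpq hpq' hne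
    · exact (ih hq hq' h).mono (hsub q p hpq) (hsub q' p' hpq')

include hsub in
theorem exists_ancestor (n j : ℕ) {p : ℤ × ι} (hp : p ∈ generation R P (n + j)) :
    ∃ q ∈ generation R P n, G.cell p ⊆ G.cell q := by
  induction j generalizing p with
  | zero => exact ⟨p, hp, subset_rfl⟩
  | succ j ih =>
    obtain ⟨q, hq, hpq⟩ := (mem_generation_succ (n := n + j)).1 hp
    obtain ⟨a, ha, hqa⟩ := ih hq
    exact ⟨a, ha, (hsub q p hpq).trans hqa⟩

variable (P) in
/-- The part of a cell that is not covered by its children. -/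
def residue (q : ℤ × ι) : Set (Space n₁ n₂) := G.cell q \ ⋃ p ∈ P q, G.cell p

include hR hP hsub in
-- The residues become the disjoint sets in the definition of sparseness. A cell of a later
-- generation lies in a child of some cell of the earlier generation: it either misses the residue
-- because that child was removed, or lies in a disjoint cell.
theorem pairwiseDisjoint_residue :
    (⋃ n, generation R P n).PairwiseDisjoint (G.residue P) := by
  have key : ∀ n m p q, p ∈ generation R P n → q ∈ generation R P m → p ≠ q → n ≤ m →
      Disjoint (G.residue P p) (G.residue P q) := by
    intro n m p q hp hq hne hnm
    rcases hnm.eq_or_lt with rfl | hlt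
    · exact (G.pairwiseDisjoint_generation hR hP hsub n hp hq hne).mono sdiff_subset sdiff_subset
    · obtain ⟨j, rfl⟩ := Nat.exists_eq_add_of_lt hlt
      obtain ⟨a', ha', hqa⟩ := G.exists_ancestor hsub (n + 1) j (p := q)
        (by rwa [show n + 1 + j = n + j + 1 by ring])
      obtain ⟨a, ha, haa⟩ := mem_generation_succ.1 ha'
      rcases eq_or_ne p a with rfl | h
      · refine Set.disjoint_left.2 fun x hxp hxq => hxp.2 ?_
        exact mem_iUnion₂.2 ⟨a', haa, hqa hxq.1⟩
      · exact (G.pairwiseDisjoint_generation hR hP hsub n hp ha h).mono sdiff_subset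
          (sdiff_subset.trans (hqa.trans (hsub a a' haa)))
  intro p hp q hq hne
  obtain ⟨n, hn⟩ := mem_iUnion.1 hp
  obtain ⟨m, hm⟩ := mem_iUnion.1 hq
  rcases le_total n m with h | h
  · exact key n m p q hn hm hne h
  · exact (key m n q p hm hn hne.symm h).symm

variable [Countable ι]

theorem measurableSet_residue (q : ℤ × ι) : MeasurableSet (G.residue P q) :=
  (G.measurableSet_cell q).diff (.biUnion (to_countable _) fun p _ => G.measurableSet_cell p)

variable (hhalf : ∀ q, 2 * ∑' p : P q, volume (G.cell p) ≤ volume (G.cell q))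

include hhalf in
theorem two_mul_measure_children_le (q : ℤ × ι) :
    2 * volume (⋃ p ∈ P q, G.cell p) ≤ volume (G.cell q) := by
  refine le_trans ?_ (hhalf q)
  gcongr
  exact measure_biUnion_le _ (to_countable _) _

include hhalf in
theorem measure_le_two_mul_residue (q : ℤ × ι) :
    volume (G.cell q) ≤ 2 * volume (G.residue P q) := by
  have h1 := G.two_mul_measure_children_le hhalf q
  have h2 : volume (G.cell q) ≤ volume (G.residue P q) + volume (⋃ p ∈ P q, G.cell p) := by
    refine (measure_mono fun x hx => ?_).trans (measure_union_le _ _)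
    by_cases h : x ∈ ⋃ p ∈ P q, G.cell p
    · exact .inr h
    · exact .inl ⟨hx, h⟩
  have htop := G.cell_ne_top q
  have h3 : volume (G.cell q) + volume (G.cell q) ≤
      2 * volume (G.residue P q) + volume (G.cell q) := by
    calc volume (G.cell q) + volume (G.cell q) = 2 * volume (G.cell q) := (two_mul _).symm
      _ ≤ 2 * (volume (G.residue P q) + volume (⋃ p ∈ P q, G.cell p)) := by gcongr
      _ = 2 * volume (G.residue P q) + 2 * volume (⋃ p ∈ P q, G.cell p) := mul_add _ _ _
      _ ≤ _ := by gcongr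
  exact (ENNReal.add_le_add_iff_right htop).1 h3

include hR hP hsub hhalf in
-- The measure of the generations halves at each step, so almost no point belongs to infinitely many
-- of them and the recursion terminates at almost every point.
theorem ae_notMem_generation :
    ∀ᵐ x, ∃ n, x ∉ ⋃ p ∈ generation R P n, G.cell p := by
  set U : ℕ → Set (Space n₁ n₂) := fun n => ⋃ p ∈ generation R P n, G.cell p
  -- The decay is tracked inside each root separately, as the union of all roots may have infinite
  -- measure.
  have hstep : ∀ q ∈ R, ∀ n, 2 * volume (U (n + 1) ∩ G.cell q) ≤ volume (U n ∩ G.cell q) := by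
    intro q hq n
    set F : Set (ℤ × ι) := {p ∈ generation R P n | G.cell p ⊆ G.cell q}
    have h1 : U (n + 1) ∩ G.cell q ⊆ ⋃ a ∈ F, ⋃ p ∈ P a, G.cell p := by
      rintro x ⟨hx, hxq⟩
      obtain ⟨p, hp, hxp⟩ := mem_iUnion₂.1 hx
      obtain ⟨a, ha, hpa⟩ := mem_generation_succ.1 hp
      refine mem_iUnion₂.2 ⟨a, ⟨ha, ?_⟩, mem_iUnion₂.2 ⟨p, hpa, hxp⟩⟩
      obtain ⟨q', hq', haq'⟩ := G.exists_ancestor hsub 0 n (p := a) (by rwa [zero_add])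
      rcases eq_or_ne q' q with rfl | hne
      · exact haq'
      · exact absurd hxq (Set.disjoint_left.1 (hR hq' hq hne) (haq' (hsub a p hpa hxp)))
    have hF : F.PairwiseDisjoint G.cell :=
      (G.pairwiseDisjoint_generation hR hP hsub n).subset (sep_subset _ _)
    calc 2 * volume (U (n + 1) ∩ G.cell q)
        ≤ 2 * ∑' a : F, volume (⋃ p ∈ P a, G.cell p) := by
          gcongr
          exact (measure_mono h1).trans (measure_biUnion_le _ (to_countable F) _)
      _ = ∑' a : F, 2 * volume (⋃ p ∈ P a, G.cell p) := ENNReal.tsum_mul_left.symm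
      _ ≤ ∑' a : F, volume (G.cell a) :=
          ENNReal.tsum_le_tsum fun a => G.two_mul_measure_children_le hhalf a
      _ = volume (⋃ a ∈ F, G.cell a) := (G.measure_biUnion_cell hF _).symm
      _ ≤ _ := by
          refine measure_mono (iUnion₂_subset fun a ha x hx => ?_)
          exact ⟨mem_iUnion₂.2 ⟨a, ha.1, hx⟩, ha.2 hx⟩
  have hpow : ∀ q ∈ R, ∀ n, 2 ^ n * volume (U n ∩ G.cell q) ≤ volume (G.cell q) := by
    intro q hq n
    induction n with
    | zero => simpa using measure_mono inter_subset_right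
    | succ n ih =>
      calc 2 ^ (n + 1) * volume (U (n + 1) ∩ G.cell q)
          = 2 ^ n * (2 * volume (U (n + 1) ∩ G.cell q)) := by ring
        _ ≤ 2 ^ n * volume (U n ∩ G.cell q) := by gcongr; exact hstep q hq n
        _ ≤ _ := ih
  have hnull : ∀ q ∈ R, volume ((⋂ n, U n) ∩ G.cell q) = 0 := by
    intro q hq
    by_contra h0
    obtain ⟨n, hn⟩ := ENNReal.exists_nat_mul_gt h0 (G.cell_ne_top q)
    have h1 : (n : ℝ≥0∞) ≤ 2 ^ n := by exact_mod_cast (Nat.lt_two_pow_self (n := n)).le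
    refine absurd (hpow q hq n) (not_le.2 (hn.trans_le ?_))
    gcongr
    exact iInter_subset _ _
  have h0 : volume (⋃ q ∈ R, (⋂ n, U n) ∩ G.cell q) = 0 :=
    (measure_biUnion_null_iff (to_countable R)).2 hnull
  filter_upwards [measure_eq_zero_iff_ae_notMem.1 h0] with x hx
  by_contra hcon
  push Not at hcon
  refine hx ?_
  obtain ⟨q, hq, hxq⟩ := mem_iUnion₂.1 (hcon 0)
  exact mem_iUnion₂.2 ⟨q, hq, mem_iInter.2 hcon, hxq⟩

end Tree

end StarGrid

namespace CZOperator

variable {ι : Type} [Countable ι] {G : StarGrid n₁ n₂ ι} (A : CZOperator G)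

/-- Pointwise domination by a sparse family of cells of adjacent grids. -/
theorem exists_sparse_domination {m : ℕ} {𝒢 : Fin m → Grid (volume : Measure (Space n₁ n₂)) ι}
    {c : ℤ} {D : ℝ≥0} (hadj : IsAdjacent G 𝒢 c D)
    (hlev : ∀ t t' k k' x x', (𝒢 t).cube k x = (𝒢 t').cube k' x' → k = k')
    {x₀ : Space n₁ n₂} (hexh : ∀ s : Set (Space n₁ n₂), Bornology.IsBounded s →
      ∃ k, s ⊆ G.cube k x₀) :
    ∃ C : ℝ≥0, ∀ f : Space n₁ n₂ → ℂ, ∀ hf : IsBddCompactSupp f,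
      ∃ S : Set (Set (Space n₁ n₂)), (∀ R ∈ S, ∃ t k x, R = (𝒢 t).cube k x) ∧
        IsSparse (1 / (2 * (D + 1))) S ∧
        ∀ᵐ x, ‖A.T hf.toL2 x‖ₑ ≤ C * sparseOperator 1 S f x := by
  classical
  obtain ⟨C, hC⟩ := A.exists_stopping_step hadj
  refine ⟨C * D, fun f hf => ?_⟩
  choose P hP hPsub hhalf hmain hrec using hC f hf
  have hsub : ∀ q, ∀ p ∈ P q, G.cell p ⊆ G.cell q := fun q p hp => (hPsub q p hp).2.2
  obtain ⟨k₀, hk₀⟩ := hexh _ hf.isBounded_support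
  set R := G.rootCells x₀ k₀
  have hR : R.PairwiseDisjoint G.cell := G.pairwiseDisjoint_rootCells x₀ k₀
  set all := ⋃ n, StarGrid.generation R P n
  have hne : ∀ n, ∀ p ∈ StarGrid.generation R P n, (G.cell p).Nonempty := by
    intro n
    cases n with
    | zero => exact fun p hp => hp.2.1
    | succ n =>
      intro p hp
      obtain ⟨q, -, hpq⟩ := StarGrid.mem_generation_succ.1 hp
      exact (hPsub q p hpq).2.1
  -- the adjacent cell of a cell
  have hadj' : ∀ p : ℤ × ι, ∃ Q : Set (Space n₁ n₂), (G.cell p).Nonempty →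
      (∃ t x, Q = (𝒢 t).cube (p.1 - c) x) ∧ G.starCell p ⊆ Q ∧ volume Q ≤ D * volume (G.cell p) := by
    intro p
    rcases (G.cell p).eq_empty_or_nonempty with h | ⟨x, hx⟩
    · exact ⟨∅, fun h' => absurd h' (by simp [h])⟩
    · obtain ⟨t, h1, h2⟩ := hadj p.1 x
      refine ⟨(𝒢 t).cube (p.1 - c) x, fun _ => ⟨⟨t, x, rfl⟩, ?_, ?_⟩⟩
      · rwa [G.starCell_eq hx]
      · rwa [← G.cube_eq_cell hx]
  choose Q hQ using hadj'
  have hall : ∀ p ∈ all, (G.cell p).Nonempty := fun p hp => by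
    obtain ⟨n, hn⟩ := mem_iUnion.1 hp
    exact hne n p hn
  refine ⟨Q '' all, ?_, ?_, ?_⟩
  · rintro _ ⟨p, hp, rfl⟩
    obtain ⟨⟨t, x, h⟩, -⟩ := hQ p (hall p hp)
    exact ⟨t, _, x, h⟩
  -- Several cells may have the same adjacent cell `B`; one of them is selected, and its residue
  -- serves as the set attached to `B`.
  · have hinv : ∀ B : Set (Space n₁ n₂), ∃ p, B ∈ Q '' all → p ∈ all ∧ Q p = B := by
      intro B
      by_cases hB : B ∈ Q '' all
      · obtain ⟨p, hp⟩ := hB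
        exact ⟨p, fun _ => hp⟩
      · exact ⟨(0, G.idx 0 x₀), fun h => absurd h hB⟩
    choose p hp using hinv
    refine ⟨fun B => G.residue P (p B), fun B hB => ?_, fun B hB B' hB' hne' => ?_⟩
    · obtain ⟨hpB, hQB⟩ := hp B hB
      obtain ⟨-, h1, h2⟩ := hQ (p B) (hall _ hpB)
      rw [hQB] at h1 h2
      obtain ⟨y, hy⟩ := hall _ hpB
      refine ⟨?_, G.measurableSet_residue _, ?_⟩
      · refine sdiff_subset.trans (subset_trans ?_ h1)
        rw [G.starCell_eq hy, ← G.cube_eq_cell hy]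
        exact G.cube_subset_star _ _
      · have h3 : ENNReal.ofReal (1 / (2 * (D + 1))) * (2 * (D + 1)) = 1 := by
          have : (2 * (D + 1) : ℝ≥0∞) = ENNReal.ofReal (2 * (D + 1)) := by
            rw [ENNReal.ofReal_mul (by norm_num), ENNReal.ofReal_add (by positivity) (by norm_num)]
            simp
          rw [this, ← ENNReal.ofReal_mul (by positivity), one_div,
            inv_mul_cancel₀ (by positivity), ENNReal.ofReal_one]
        calc ENNReal.ofReal (1 / (2 * (D + 1))) * volume B
            ≤ ENNReal.ofReal (1 / (2 * (D + 1))) *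
              ((D + 1) * (2 * volume (G.residue P (p B)))) := by
              gcongr
              calc volume B ≤ D * volume (G.cell (p B)) := h2
                _ ≤ (D + 1) * (2 * volume (G.residue P (p B))) := by
                    gcongr
                    · exact le_self_add
                    · exact G.measure_le_two_mul_residue hhalf _
          _ = (ENNReal.ofReal (1 / (2 * (D + 1))) * (2 * (D + 1))) *
              volume (G.residue P (p B)) := by ring
          _ = volume (G.residue P (p B)) := by rw [h3, one_mul]
    · refine G.pairwiseDisjoint_residue hR hP hsub (hp B hB).1 (hp B' hB').1 fun h => hne' ?_
      rw [← (hp B hB).2, ← (hp B' hB').2, h]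
  · set v : ℤ × ι → Space n₁ n₂ → ℝ≥0∞ := fun q x =>
      ‖A.T (hf.indicator (G.measurableSet_starCell q)).toL2 x‖ₑ
    set avg : ℤ × ι → ℝ≥0∞ := fun q => (∫⁻ y in G.starCell q, ‖f y‖ₑ) / volume (G.cell q)
    have h1 : ∀ᵐ x, ∀ q, x ∈ G.cell q → x ∉ ⋃ p ∈ P q, G.cell p → v q x ≤ C * avg q :=
      ae_all_iff.2 hmain
    have h2 : ∀ᵐ x, ∀ q, ∀ p : P q, x ∈ G.cell p → v q x ≤ C * avg q + v p x :=
      ae_all_iff.2 fun q => ae_all_iff.2 fun p => hrec q p p.2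
    filter_upwards [h1, h2, G.ae_notMem_generation hR hP hsub hhalf] with x hx1 hx2 hx3
    -- Induction on the number of generations before `x` leaves the tree. The lower bound on the
    -- levels in `F` shows that the parent `q` is a new element of the sum.
    have claim : ∀ j n, ∀ q ∈ StarGrid.generation R P n, x ∈ G.cell q →
        x ∉ ⋃ p ∈ StarGrid.generation R P (n + j), G.cell p →
        ∃ F : Finset (ℤ × ι), (∀ p ∈ F, p ∈ all ∧ x ∈ G.cell p ∧ q.1 ≤ p.1) ∧
          v q x ≤ ∑ p ∈ F, C * avg p := by
      intro j
      induction j with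
      | zero => exact fun n q hq hxq hx => absurd (mem_iUnion₂.2 ⟨q, hq, hxq⟩) hx
      | succ j ih =>
        intro n q hq hxq hx
        by_cases hxP : x ∈ ⋃ p ∈ P q, G.cell p
        · obtain ⟨p, hp, hxp⟩ := mem_iUnion₂.1 hxP
          obtain ⟨F, hF, hle⟩ := ih (n + 1) p (StarGrid.mem_generation_succ.2 ⟨q, hq, hp⟩) hxp
            (by rwa [show n + 1 + j = n + (j + 1) by ring])
          have hlt := (hPsub q p hp).1
          have hqF : q ∉ F := fun h => absurd (hF q h).2.2 (not_le.2 hlt)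
          refine ⟨insert q F, fun p' hp' => ?_, ?_⟩
          · rcases Finset.mem_insert.1 hp' with rfl | h
            · exact ⟨mem_iUnion.2 ⟨n, hq⟩, hxq, le_rfl⟩
            · exact ⟨(hF p' h).1, (hF p' h).2.1, hlt.le.trans (hF p' h).2.2⟩
          · rw [Finset.sum_insert hqF]
            exact (hx2 q ⟨p, hp⟩ hxp).trans (by gcongr)
        · refine ⟨{q}, fun p hp => ?_, ?_⟩
          · rw [Finset.mem_singleton.1 hp]
            exact ⟨mem_iUnion.2 ⟨n, hq⟩, hxq, le_rfl⟩
          · rw [Finset.sum_singleton]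
            exact hx1 q hxq hxP
    obtain ⟨q, hq, hxq⟩ := G.exists_mem_rootCells (x₀ := x₀) (x := x) k₀ (by
      obtain ⟨k, hk⟩ := hexh {x} Bornology.isBounded_singleton
      exact ⟨k, hk rfl⟩)
    obtain ⟨j, hj⟩ := hx3
    obtain ⟨F, hF, hle⟩ := claim j 0 q hq hxq (by rwa [zero_add])
    have hTf : hf.toL2 = (hf.indicator (G.measurableSet_starCell q)).toL2 := by
      refine IsBddCompactSupp.toL2_congr _ _ (ae_of_all _ fun y => ?_)
      by_cases hy : y ∈ G.starCell q
      · rw [indicator_of_mem hy]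
      · rw [indicator_of_notMem hy]
        by_contra h
        exact hy (G.cube_subset_starCell hq (hk₀ h))
    -- The sparse sum counts each set once. Among the cells containing `x` nothing is lost: an
    -- adjacent cell determines its level, hence that of the original cell, and `x` determines the
    -- label.
    have hinj : Set.InjOn Q F := by
      intro p hp p' hp' h
      obtain ⟨t, y, hy⟩ := (hQ p (hall p (hF p hp).1)).1
      obtain ⟨t', y', hy'⟩ := (hQ p' (hall p' (hF p' hp').1)).1
      have hl : p.1 = p'.1 := by
        have := hlev t t' _ _ y y' (by rw [← hy, ← hy', h])
        omega
      refine Prod.ext hl ?_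
      rw [← G.mem_cell.1 (hF p hp).2.1, ← G.mem_cell.1 (hF p' hp').2.1, hl]
    set h : Set (Space n₁ n₂) → ℝ≥0∞ := fun B =>
      B.indicator (fun _ => ((volume B)⁻¹ * ∫⁻ y in B, ‖f y‖ₑ ^ (1 : ℝ)) ^ (1 / 1 : ℝ)) x
    calc ‖A.T hf.toL2 x‖ₑ = v q x := by rw [hTf]
      _ ≤ ∑ p ∈ F, C * avg p := hle
      _ ≤ ∑ p ∈ F, (C * D : ℝ≥0) * h (Q p) := by
          refine Finset.sum_le_sum fun p hp => ?_
          obtain ⟨hpall, hxp, -⟩ := hF p hp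
          obtain ⟨-, hs, hv⟩ := hQ p (hall p hpall)
          have hxQ : x ∈ Q p := hs (by
            rw [G.starCell_eq hxp]
            exact G.cube_subset_star _ _ (G.mem_cube_self _ _))
          simp only [h, indicator_of_mem hxQ, ENNReal.rpow_one, div_one]
          rw [ENNReal.coe_mul, mul_assoc]
          gcongr
          have hV0 : volume (G.cell p) ≠ 0 := by
            rw [← G.cube_eq_cell hxp]
            exact G.cube_ne_zero _ _
          simp only [avg]
          rw [ENNReal.div_le_iff hV0 (G.cell_ne_top p)]
          have hQ0 : volume (Q p) ≠ 0 := fun h0 => hV0 (measure_mono_null (by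
            rw [← G.cube_eq_cell hxp]
            refine subset_trans (G.cube_subset_star _ _) ?_
            rwa [← G.starCell_eq hxp]) h0)
          have hQtop : volume (Q p) ≠ ⊤ := ne_top_of_le_ne_top
            (ENNReal.mul_ne_top ENNReal.coe_ne_top (G.cell_ne_top p)) hv
          calc ∫⁻ y in G.starCell p, ‖f y‖ₑ ≤ ∫⁻ y in Q p, ‖f y‖ₑ := lintegral_mono_set hs
            _ = volume (Q p) * ((volume (Q p))⁻¹ * ∫⁻ y in Q p, ‖f y‖ₑ) := by
                rw [← mul_assoc, ENNReal.mul_inv_cancel hQ0 hQtop, one_mul]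
            _ ≤ (D * volume (G.cell p)) * ((volume (Q p))⁻¹ * ∫⁻ y in Q p, ‖f y‖ₑ) := by gcongr
            _ = _ := by ring
      _ = (C * D : ℝ≥0) * ∑ B ∈ F.image Q, h B := by
          rw [Finset.sum_image hinj, Finset.mul_sum]
      _ ≤ (C * D : ℝ≥0) * sparseOperator 1 (Q '' all) f x := by
          gcongr
          have hmem : ∀ B ∈ F.image Q, B ∈ Q '' all := fun B hB => by
            obtain ⟨p, hp, rfl⟩ := Finset.mem_image.1 hB
            exact ⟨p, (hF p hp).1, rfl⟩
          rw [← Finset.sum_subtype_of_mem (p := fun B => B ∈ Q '' all) h hmem]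
          exact ENNReal.sum_le_tsum (f := fun B : Q '' all => h B) _

end CZOperator
end Grushin
end

/-! ### Dyadic grids adapted to the Grushin distance. -/

noncomputable section
namespace Grushin
open Filter Topology

/-! ### Shifted dyadic intervals -/

/-- The offset of the shifted dyadic partition of level `k` of the line. -/
def dyadicOffset (t k : ℤ) : ℝ := t * (-1) ^ k / 3

/-- The label of the interval of the shifted dyadic partition of level `k` that contains `u`. -/
def dyadicIndex (t k : ℤ) (u : ℝ) : ℤ := ⌊2 ^ k * u + dyadicOffset t k⌋

/-- The centre of the interval of the shifted dyadic partition of level `k` that contains `u`. -/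
def dyadicMid (t k : ℤ) (u : ℝ) : ℝ := (2 ^ k)⁻¹ * (dyadicIndex t k u + 1 / 2 - dyadicOffset t k)

/-- Doubling an offset `± t/3` and changing its sign differ by an integer. This is why the shifted
partitions of consecutive levels are nested. -/
theorem exists_two_mul_dyadicOffset (t k : ℤ) :
    ∃ e : ℤ, 2 * dyadicOffset t k = dyadicOffset t (k + 1) + e := by
  refine ⟨if Even k then t else -t, ?_⟩
  rw [dyadicOffset, dyadicOffset, zpow_add_one₀ (by norm_num)]
  split_ifs with h
  · rw [h.neg_one_zpow]; ring
  · rw [(Int.not_even_iff_odd.1 h).neg_one_zpow]; push_cast; ring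

theorem dyadicIndex_le (t k : ℤ) (u : ℝ) : dyadicIndex t k u ≤ 2 ^ k * u + dyadicOffset t k :=
  Int.floor_le _

theorem lt_dyadicIndex (t k : ℤ) (u : ℝ) :
    2 ^ k * u + dyadicOffset t k < dyadicIndex t k u + 1 :=
  Int.lt_floor_add_one _

theorem dyadicIndex_eq_iff {t k m : ℤ} {u : ℝ} :
    dyadicIndex t k u = m ↔ (2 ^ k)⁻¹ * (m - dyadicOffset t k) ≤ u ∧
      u < (2 ^ k)⁻¹ * (m + 1 - dyadicOffset t k) := by
  have h : (0 : ℝ) < 2 ^ k := by positivity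
  rw [dyadicIndex, Int.floor_eq_iff, inv_mul_le_iff₀ h, lt_inv_mul_iff₀ h]
  constructor <;> rintro ⟨h1, h2⟩ <;> constructor <;> linarith

theorem exists_dyadicIndex_eq (t k : ℤ) :
    ∃ e : ℤ, (2 * dyadicOffset t k = dyadicOffset t (k + 1) + e) ∧
      ∀ u, dyadicIndex t k u = (dyadicIndex t (k + 1) u + e) / 2 := by
  obtain ⟨e, he⟩ := exists_two_mul_dyadicOffset t k
  refine ⟨e, he, fun u => ?_⟩
  have h1 := dyadicIndex_le t (k + 1) u
  have h2 := lt_dyadicIndex t (k + 1) u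
  have h3 : (2 : ℝ) ^ (k + 1) = 2 * 2 ^ k := by rw [zpow_add_one₀ (by norm_num)]; ring
  rw [h3] at h1 h2
  set a := dyadicIndex t (k + 1) u
  rw [dyadicIndex, Int.floor_eq_iff]
  have h4 : 2 * ((a + e) / 2) ≤ a + e := by omega
  have h5 : a + e + 1 ≤ 2 * ((a + e) / 2) + 2 := by omega
  have h4' : 2 * (((a + e) / 2 : ℤ) : ℝ) ≤ a + e := by exact_mod_cast h4
  have h5' : (a : ℝ) + e + 1 ≤ 2 * (((a + e) / 2 : ℤ) : ℝ) + 2 := by exact_mod_cast h5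
  constructor <;> linarith

theorem dyadicIndex_pred_eq {t k : ℤ} {u v : ℝ} (h : dyadicIndex t (k + 1) u = dyadicIndex t (k + 1) v) :
    dyadicIndex t k u = dyadicIndex t k v := by
  obtain ⟨e, -, he⟩ := exists_dyadicIndex_eq t k
  rw [he, he, h]

theorem dyadicIndex_eq_of_le {t k l : ℤ} (hkl : k ≤ l) {u v : ℝ}
    (h : dyadicIndex t l u = dyadicIndex t l v) : dyadicIndex t k u = dyadicIndex t k v := by
  obtain ⟨n, rfl⟩ := Int.le.dest hkl
  induction n with
  | zero => simpa using h
  | succ n ih =>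
    refine ih (by omega) (dyadicIndex_pred_eq ?_)
    push_cast at h
    rwa [← add_assoc] at h

/-- Passing to the coarser level halves labels up to rounding, which does not increase an integer
distance bound `N ≥ 1`. This gives the nesting of the dilates. -/
theorem abs_dyadicIndex_sub_le_of_le {t k l N : ℤ} (hN : 1 ≤ N) (hkl : k ≤ l) {u v : ℝ}
    (h : |dyadicIndex t l u - dyadicIndex t l v| ≤ N) :
    |dyadicIndex t k u - dyadicIndex t k v| ≤ N := by
  obtain ⟨n, rfl⟩ := Int.le.dest hkl
  induction n with
  | zero => simpa using h
  | succ n ih =>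
    refine ih (by omega) ?_
    push_cast at h
    rw [← add_assoc] at h
    obtain ⟨e, -, he⟩ := exists_dyadicIndex_eq t (k + n)
    rw [he, he]
    rw [abs_le] at h ⊢
    omega

theorem abs_sub_lt_of_dyadicIndex {t k N : ℤ} {u v : ℝ}
    (h : |dyadicIndex t k u - dyadicIndex t k v| ≤ N) : |u - v| < (2 ^ k)⁻¹ * (N + 1) := by
  have hk : (0 : ℝ) < 2 ^ k := by positivity
  rw [lt_inv_mul_iff₀ hk, ← abs_of_pos hk, ← abs_mul]
  have h' : |(dyadicIndex t k u : ℝ) - dyadicIndex t k v| ≤ N := by exact_mod_cast h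
  rw [abs_le] at h'
  have h1 := dyadicIndex_le t k u
  have h2 := lt_dyadicIndex t k u
  have h3 := dyadicIndex_le t k v
  have h4 := lt_dyadicIndex t k v
  rw [abs_lt, mul_sub]
  constructor <;> linarith

theorem abs_dyadicIndex_sub_le {t k N : ℤ} {u v : ℝ} (h : 2 ^ k * |u - v| ≤ N) :
    |dyadicIndex t k u - dyadicIndex t k v| ≤ N := by
  have hk : (0 : ℝ) < 2 ^ k := by positivity
  rw [← abs_of_pos hk, ← abs_mul, abs_le, mul_sub] at h
  have h1 := dyadicIndex_le t k u
  have h2 := lt_dyadicIndex t k u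
  have h3 := dyadicIndex_le t k v
  have h4 := lt_dyadicIndex t k v
  have h5 : ((dyadicIndex t k u - dyadicIndex t k v : ℤ) : ℝ) < (N + 1 : ℤ) := by
    push_cast; linarith
  have h6 : ((-(N + 1) : ℤ) : ℝ) < (dyadicIndex t k u - dyadicIndex t k v : ℤ) := by
    push_cast; linarith
  have h5' := Int.cast_lt.1 h5
  have h6' := Int.cast_lt.1 h6
  rw [abs_le]
  omega

theorem abs_sub_dyadicMid_le (t k : ℤ) (u : ℝ) : |u - dyadicMid t k u| ≤ (2 ^ k)⁻¹ / 2 := by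
  have hk : (0 : ℝ) < 2 ^ k := by positivity
  have h1 := dyadicIndex_le t k u
  have h2 := lt_dyadicIndex t k u
  have h3 : u - dyadicMid t k u = (2 ^ k)⁻¹ *
      (2 ^ k * u + dyadicOffset t k - dyadicIndex t k u - 1 / 2) := by
    rw [dyadicMid]; field_simp; ring
  have h4 : |2 ^ k * u + dyadicOffset t k - dyadicIndex t k u - 1 / 2| ≤ 1 / 2 := by
    rw [abs_le]
    constructor <;> linarith
  rw [h3, abs_mul, abs_of_pos (inv_pos.2 hk)]
  calc _ ≤ (2 ^ k : ℝ)⁻¹ * (1 / 2) := by gcongr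
    _ = _ := by ring

theorem dyadicIndex_eq_of_abs_lt {t k : ℤ} {u v : ℝ}
    (h : |v - dyadicMid t k u| < (2 ^ k)⁻¹ / 2) : dyadicIndex t k v = dyadicIndex t k u := by
  rw [dyadicIndex_eq_iff]
  rw [abs_lt, dyadicMid] at h
  constructor <;> nlinarith [h.1, h.2]

theorem dyadicMid_congr {t k : ℤ} {u v : ℝ} (h : dyadicIndex t k u = dyadicIndex t k v) :
    dyadicMid t k u = dyadicMid t k v := by rw [dyadicMid, h, dyadicMid]

theorem abs_dyadicMid_sub_le (t k : ℤ) (u : ℝ) :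
    |dyadicMid t (k + 1) u - dyadicMid t k u| ≤ (2 ^ (k + 1))⁻¹ / 2 := by
  obtain ⟨e, h1, h2⟩ := exists_dyadicIndex_eq t k
  have hk : (0 : ℝ) < 2 ^ k := by positivity
  have h3 : (2 : ℝ) ^ (k + 1) = 2 * 2 ^ k := by rw [zpow_add_one₀ (by norm_num)]; ring
  set a := dyadicIndex t (k + 1) u
  set b := dyadicIndex t k u
  have h4 : b = (a + e) / 2 := h2 u
  have h5 : (2 * b : ℝ) ≤ a + e := by exact_mod_cast (by omega : 2 * b ≤ a + e)
  have h6 : (a + e : ℝ) ≤ 2 * b + 1 := by exact_mod_cast (by omega : a + e ≤ 2 * b + 1)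
  have h7 : dyadicMid t (k + 1) u - dyadicMid t k u = (2 ^ (k + 1))⁻¹ * (a + e - 2 * b - 1 / 2) := by
    have h8 : (2 * 2 ^ k : ℝ)⁻¹ = (2 ^ k)⁻¹ / 2 := by rw [mul_inv]; ring
    rw [dyadicMid, dyadicMid, h3, h8]
    linear_combination ((2 ^ k)⁻¹ / 2 : ℝ) * h1
  have h8 : |(a + e - 2 * b - 1 / 2 : ℝ)| ≤ 1 / 2 := by
    rw [abs_le]
    constructor <;> linarith
  rw [h7, abs_mul, abs_of_pos (by positivity)]
  calc _ ≤ (2 ^ (k + 1) : ℝ)⁻¹ * (1 / 2) := by gcongr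
    _ = _ := by ring

/-- One of the two shifted dyadic partitions has a cell that contains a given short interval. -/
theorem exists_shift (k : ℤ) (u : ℝ) : ∃ t : Fin 2, ∀ v, 2 ^ k * |v - u| < 1 / 6 →
    dyadicIndex ((t : ℕ) : ℤ) k v = dyadicIndex ((t : ℕ) : ℤ) k u := by
  have hk : (0 : ℝ) < 2 ^ k := by positivity
  have key : ∀ c : ℝ, (∃ m : ℤ, m + 1 / 6 ≤ 2 ^ k * u + c ∧ 2 ^ k * u + c ≤ m + 5 / 6) →
      ∀ v, 2 ^ k * |v - u| < 1 / 6 → ⌊2 ^ k * v + c⌋ = ⌊2 ^ k * u + c⌋ := by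
    rintro c ⟨m, h1, h2⟩ v hv
    rw [← abs_of_pos hk, ← abs_mul, mul_sub, abs_lt] at hv
    rw [(Int.floor_eq_iff (z := m)).2 ⟨by linarith, by linarith⟩,
      (Int.floor_eq_iff (z := m)).2 ⟨by linarith, by linarith⟩]
  set m := ⌊(2 : ℝ) ^ k * u⌋
  have h1 : (m : ℝ) ≤ 2 ^ k * u := Int.floor_le _
  have h2 : (2 : ℝ) ^ k * u < m + 1 := Int.lt_floor_add_one _
  -- Either `2 ^ k * u` has distance at least `1/6` from the integers, or a shift by `± 1/3` moves
  -- it there.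
  by_cases h : (m : ℝ) + 1 / 6 ≤ 2 ^ k * u ∧ 2 ^ k * u ≤ m + 5 / 6
  · refine ⟨0, fun v hv => key _ ⟨m, ?_⟩ v hv⟩
    simpa [dyadicOffset] using h
  · refine ⟨1, fun v hv => key _ ?_ v hv⟩
    have hoff : dyadicOffset (((1 : Fin 2) : ℕ) : ℤ) k = 1 / 3 ∨
        dyadicOffset (((1 : Fin 2) : ℕ) : ℤ) k = -1 / 3 := by
      rcases Int.even_or_odd k with hk | hk
      · left; simp [dyadicOffset, hk.neg_one_zpow]
      · right; simp [dyadicOffset, hk.neg_one_zpow]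
    rw [not_and_or, not_le, not_le] at h
    rcases h with h | h <;> rcases hoff with ho | ho <;> rw [ho]
    · exact ⟨m, by linarith, by linarith⟩
    · exact ⟨m - 1, by push_cast; linarith, by push_cast; linarith⟩
    · exact ⟨m + 1, by push_cast; linarith, by push_cast; linarith⟩
    · exact ⟨m, by linarith, by linarith⟩

/-- Bounded sets of reals are contained in a single interval of a partition with shift `1`. -/
theorem dyadicIndex_one_eq_zero {k : ℤ} {u : ℝ} (h : 2 ^ k * |u| < 1 / 3) :
    dyadicIndex 1 k u = dyadicIndex 1 k 0 := by
  have hk : (0 : ℝ) < 2 ^ k := by positivity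
  rw [← abs_of_pos hk, ← abs_mul, abs_lt] at h
  -- With shift `1` the origin stays at relative distance `1/3` from the nearest endpoint at every
  -- level. With shift `0` it would be an endpoint, and the cells around it would never exhaust the
  -- line.
  rw [dyadicIndex, dyadicIndex, dyadicOffset]
  rcases Int.even_or_odd k with hk | hk
  · rw [hk.neg_one_zpow, (Int.floor_eq_iff (z := 0)).2, (Int.floor_eq_iff (z := 0)).2] <;>
      constructor <;> push_cast <;> linarith
  · rw [hk.neg_one_zpow, (Int.floor_eq_iff (z := -1)).2, (Int.floor_eq_iff (z := -1)).2] <;>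
      constructor <;> push_cast <;> linarith

theorem measurable_dyadicIndex (t k : ℤ) : Measurable (dyadicIndex t k) :=
  Int.measurable_floor.comp ((measurable_id.const_mul _).add_const _)

/-! ### The size of a cell of the first factor -/

section Size

variable {n : ℕ} (τ : Fin n → ℤ)

/-- The label of the shifted dyadic cube of level `k` that contains `u`. -/
def cubeIndex (k : ℤ) (u : EuclideanSpace ℝ (Fin n)) : Fin n → ℤ := fun i => dyadicIndex (τ i) k (u i)

/-- The sum over the coordinates of the suprema of `|v i|` over the shifted dyadic cube of level `k`
that contains `u`. -/
def cubeSize (k : ℤ) (u : EuclideanSpace ℝ (Fin n)) : ℝ :=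
  ∑ i, (|dyadicMid (τ i) k (u i)| + (2 ^ k)⁻¹ / 2)

/-- The logarithm of `cubeSize`, rounded up. -/
def cubeScale (k : ℤ) (u : EuclideanSpace ℝ (Fin n)) : ℤ := Int.clog 2 (cubeSize τ k u)

variable {τ}

theorem cubeSize_congr {k : ℤ} {u v : EuclideanSpace ℝ (Fin n)}
    (h : cubeIndex τ k u = cubeIndex τ k v) : cubeSize τ k u = cubeSize τ k v :=
  Finset.sum_congr rfl fun i _ => by rw [dyadicMid_congr (congrFun h i)]

theorem sum_abs_le_cubeSize (k : ℤ) (u : EuclideanSpace ℝ (Fin n)) :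
    ∑ i, |u i| ≤ cubeSize τ k u := by
  refine Finset.sum_le_sum fun i _ => ?_
  have h1 := abs_sub_dyadicMid_le (τ i) k (u i)
  have h2 := abs_sub_abs_le_abs_sub (u i) (dyadicMid (τ i) k (u i))
  linarith

theorem cubeSize_le_sum_abs (k : ℤ) (u : EuclideanSpace ℝ (Fin n)) :
    cubeSize τ k u ≤ ∑ i, |u i| + n * (2 ^ k)⁻¹ := by
  have : ∑ i : Fin n, |u i| + n * ((2 : ℝ) ^ k)⁻¹ = ∑ i : Fin n, (|u i| + (2 ^ k)⁻¹) := by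
    simp [Finset.sum_add_distrib]
  rw [this]
  refine Finset.sum_le_sum fun i _ => ?_
  have h1 := abs_sub_dyadicMid_le (τ i) k (u i)
  have h2 := abs_sub_abs_le_abs_sub (dyadicMid (τ i) k (u i)) (u i)
  rw [abs_sub_comm] at h1
  linarith

theorem le_cubeSize (k : ℤ) (u : EuclideanSpace ℝ (Fin n)) :
    n * (2 ^ k)⁻¹ ≤ 2 * cubeSize τ k u := by
  have : (n : ℝ) * (2 ^ k)⁻¹ = 2 * ∑ i : Fin n, ((2 : ℝ) ^ k)⁻¹ / 2 := by
    simp; ring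
  rw [this, cubeSize]
  gcongr with i
  exact le_add_of_nonneg_left (abs_nonneg _)

/-- Being built from suprema over the cube, the size cannot grow when the cube shrinks; the norm of
the centre would lack this property. It yields nested cells in the product. -/
theorem cubeSize_succ_le (k : ℤ) (u : EuclideanSpace ℝ (Fin n)) :
    cubeSize τ (k + 1) u ≤ cubeSize τ k u := by
  refine Finset.sum_le_sum fun i _ => ?_
  have h1 := abs_dyadicMid_sub_le (τ i) k (u i)
  have h2 := abs_sub_abs_le_abs_sub (dyadicMid (τ i) (k + 1) (u i)) (dyadicMid (τ i) k (u i))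
  have h3 : ((2 : ℝ) ^ (k + 1))⁻¹ = (2 ^ k)⁻¹ / 2 := by
    rw [zpow_add_one₀ (by norm_num), mul_inv]; ring
  rw [h3] at h1 ⊢
  linarith

theorem cubeSize_le_two_zpow (k : ℤ) (u : EuclideanSpace ℝ (Fin n)) :
    cubeSize τ k u ≤ 2 ^ cubeScale τ k u :=
  Int.self_le_zpow_clog (by norm_num) _

variable (hn : 1 ≤ n)
include hn

theorem inv_le_two_mul_cubeSize (k : ℤ) (u : EuclideanSpace ℝ (Fin n)) :
    (2 ^ k)⁻¹ ≤ 2 * cubeSize τ k u := by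
  refine le_trans ?_ (le_cubeSize k u)
  have : (1 : ℝ) ≤ n := by exact_mod_cast hn
  exact le_mul_of_one_le_left (by positivity) this

theorem cubeSize_pos (k : ℤ) (u : EuclideanSpace ℝ (Fin n)) : 0 < cubeSize τ k u := by
  have h1 := inv_le_two_mul_cubeSize (τ := τ) hn k u
  have h2 : (0 : ℝ) < (2 ^ k)⁻¹ := by positivity
  linarith

theorem two_zpow_lt_cubeSize (k : ℤ) (u : EuclideanSpace ℝ (Fin n)) :
    2 ^ cubeScale τ k u < 2 * cubeSize τ k u := by
  have h : (2 : ℝ) ^ (cubeScale τ k u - 1) < cubeSize τ k u :=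
    Int.zpow_pred_clog_lt_self (b := 2) (by norm_num) (cubeSize_pos hn k u)
  rw [zpow_sub_one₀ (by norm_num)] at h
  linarith

theorem cubeScale_le_of_le {τ' : Fin n → ℤ} {k l a : ℤ} {u v : EuclideanSpace ℝ (Fin n)}
    (h : cubeSize τ k u ≤ 2 ^ a * cubeSize τ' l v) :
    cubeScale τ k u ≤ cubeScale τ' l v + a := by
  refine (Int.le_zpow_iff_clog_le (b := 2) (by norm_num) (cubeSize_pos hn k u)).1 ?_
  refine h.trans ?_
  push_cast
  rw [zpow_add₀ (by norm_num), mul_comm]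
  gcongr
  exact cubeSize_le_two_zpow l v

theorem cubeScale_succ_le (k : ℤ) (u : EuclideanSpace ℝ (Fin n)) :
    cubeScale τ (k + 1) u ≤ cubeScale τ k u := by
  have := cubeScale_le_of_le (τ := τ) (τ' := τ) (a := 0) hn
    (by simpa using cubeSize_succ_le (τ := τ) k u)
  simpa using this

/-- The sizes of two cells with a common point are comparable. -/
theorem cubeScale_le_add {τ' : Fin n → ℤ} {k l : ℤ} {a : ℕ} (hkl : l ≤ k + a)
    (u : EuclideanSpace ℝ (Fin n)) : cubeScale τ k u ≤ cubeScale τ' l u + (a + 2) := by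
  refine cubeScale_le_of_le hn ?_
  have h1 := cubeSize_le_sum_abs (τ := τ) k u
  have h2 := sum_abs_le_cubeSize (τ := τ') l u
  have h3 := le_cubeSize (τ := τ') l u
  have h4 : ((2 : ℝ) ^ k)⁻¹ ≤ 2 ^ a * (2 ^ l)⁻¹ := by
    have : (2 : ℝ) ^ l ≤ 2 ^ k * 2 ^ a := by
      rw [← zpow_natCast, ← zpow_add₀ (by norm_num)]
      exact zpow_le_zpow_right₀ (by norm_num) hkl
    rw [← div_eq_mul_inv, le_div_iff₀ (by positivity), inv_mul_le_iff₀ (by positivity)]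
    exact this
  have h5 : (n : ℝ) * (2 ^ k)⁻¹ ≤ 2 ^ a * (2 * cubeSize τ' l u) := by
    calc (n : ℝ) * (2 ^ k)⁻¹ ≤ n * (2 ^ a * (2 ^ l)⁻¹) := by gcongr
      _ = 2 ^ a * (n * (2 ^ l)⁻¹) := by ring
      _ ≤ _ := by gcongr
  have h6 : cubeSize τ' l u ≤ 2 ^ a * cubeSize τ' l u :=
    le_mul_of_one_le_left (cubeSize_pos hn l u).le (one_le_pow₀ (by norm_num))
  rw [show (a : ℤ) + 2 = ((a + 2 : ℕ) : ℤ) by push_cast; ring, zpow_natCast, pow_add]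
  have h7 : 0 < 2 ^ a * cubeSize τ' l u := mul_pos (by positivity) (cubeSize_pos hn l u)
  linarith

end Size

end Grushin
end

noncomputable section
namespace Grushin
open Filter Topology
variable {n₁ n₂ : ℕ}

/-! ### The geometry of the Grushin distance -/

variable (κ : ℕ)

/-- The second summand of the Grushin distance. -/
def distSnd (x y : Space n₁ n₂) : ℝ :=
  if ‖x.2 - y.2‖ ^ (1 / (1 + κ : ℝ)) ≤ ‖x.1‖ + ‖y.1‖ then
    ‖x.2 - y.2‖ / (‖x.1‖ + ‖y.1‖) ^ κ
  else ‖x.2 - y.2‖ ^ (1 / (1 + κ : ℝ))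

variable {κ}

theorem dist_eq (x y : Space n₁ n₂) : dist κ x y = ‖x.1 - y.1‖ + distSnd κ x y := rfl

theorem rpow_pow_succ {t : ℝ} (ht : 0 ≤ t) : (t ^ (1 / (1 + κ : ℝ))) ^ (κ + 1) = t := by
  rw [← Real.rpow_natCast, ← Real.rpow_mul ht]
  have : (1 / (1 + κ : ℝ)) * ((κ + 1 : ℕ) : ℝ) = 1 := by push_cast; field_simp; ring
  rw [this, Real.rpow_one]

theorem distSnd_nonneg (x y : Space n₁ n₂) : 0 ≤ distSnd κ x y := by
  rw [distSnd]
  split_ifs <;> positivity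

theorem dist_nonneg (x y : Space n₁ n₂) : 0 ≤ dist κ x y :=
  add_nonneg (norm_nonneg _) (distSnd_nonneg x y)

theorem dist_comm (x y : Space n₁ n₂) : dist κ x y = dist κ y x := by
  simp only [dist, norm_sub_rev x.1 y.1, norm_sub_rev x.2 y.2, add_comm ‖x.1‖]

theorem norm_fst_sub_le (x y : Space n₁ n₂) : ‖x.1 - y.1‖ ≤ dist κ x y :=
  le_add_of_nonneg_right (distSnd_nonneg x y)

theorem distSnd_le_dist (x y : Space n₁ n₂) : distSnd κ x y ≤ dist κ x y :=
  le_add_of_nonneg_left (norm_nonneg _)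

theorem norm_fst_le_add_dist (x y : Space n₁ n₂) : ‖y.1‖ ≤ ‖x.1‖ + dist κ x y := by
  have h1 := norm_fst_sub_le (κ := κ) x y
  have h2 := norm_le_norm_add_norm_sub' y.1 x.1
  rw [norm_sub_rev] at h2
  linarith

/-- A ball is contained in a box whose side in `x''` is `r (2|x'| + r)^κ`. If `|x'| + |y'| = 0` in
the first case of the distance, then the condition of that case forces `x'' = y''`. -/
theorem norm_snd_sub_le_of_dist_le {x y : Space n₁ n₂} {r : ℝ} (h : dist κ x y ≤ r) :
    ‖x.2 - y.2‖ ≤ r * (2 * ‖x.1‖ + r) ^ κ := by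
  have hr : 0 ≤ r := (dist_nonneg x y).trans h
  have h1 := (distSnd_le_dist (κ := κ) x y).trans h
  have h2 : ‖y.1‖ ≤ ‖x.1‖ + r := (norm_fst_le_add_dist (κ := κ) x y).trans (by linarith)
  rw [distSnd] at h1
  split_ifs at h1 with hc
  · rcases (add_nonneg (norm_nonneg x.1) (norm_nonneg y.1)).eq_or_lt with h0 | h0
    · rw [← h0] at hc
      have h3 := rpow_pow_succ (κ := κ) (norm_nonneg (x.2 - y.2))
      have h4 : ‖x.2 - y.2‖ ^ (1 / (1 + κ : ℝ)) = 0 := le_antisymm hc (by positivity)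
      rw [h4, zero_pow (by omega)] at h3
      rw [← h3]
      positivity
    · rw [div_le_iff₀ (by positivity)] at h1
      have h3 : ‖x.1‖ + ‖y.1‖ ≤ 2 * ‖x.1‖ + r := by linarith
      exact h1.trans (by gcongr)
  · calc ‖x.2 - y.2‖ = (‖x.2 - y.2‖ ^ (1 / (1 + κ : ℝ))) ^ (κ + 1) :=
          (rpow_pow_succ (norm_nonneg _)).symm
      _ ≤ r ^ (κ + 1) := by gcongr
      _ = r * r ^ κ := by ring
      _ ≤ _ := by
          gcongr
          linarith [norm_nonneg x.1]

/-- Where `|x'| + |y'|` is positive, the two branches are switched exactly where they agree, and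
`distSnd` is their minimum. This bound and the next one compare it with each branch. -/
theorem distSnd_le_rpow (x y : Space n₁ n₂) :
    distSnd κ x y ≤ ‖x.2 - y.2‖ ^ (1 / (1 + κ : ℝ)) := by
  rw [distSnd]
  split_ifs with hc
  · rcases (add_nonneg (norm_nonneg x.1) (norm_nonneg y.1)).eq_or_lt with h0 | h0
    · rw [← h0] at hc
      have h3 := rpow_pow_succ (κ := κ) (norm_nonneg (x.2 - y.2))
      have h4 : ‖x.2 - y.2‖ ^ (1 / (1 + κ : ℝ)) = 0 := le_antisymm hc (by positivity)
      rw [h4, zero_pow (by omega)] at h3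
      rw [h4, ← h3, zero_div]
    · rw [div_le_iff₀ (by positivity)]
      calc ‖x.2 - y.2‖ = (‖x.2 - y.2‖ ^ (1 / (1 + κ : ℝ))) ^ (κ + 1) :=
            (rpow_pow_succ (norm_nonneg _)).symm
        _ = ‖x.2 - y.2‖ ^ (1 / (1 + κ : ℝ)) * (‖x.2 - y.2‖ ^ (1 / (1 + κ : ℝ))) ^ κ := by ring
        _ ≤ _ := by gcongr
  · exact le_rfl

theorem distSnd_mul_le (x y : Space n₁ n₂) :
    distSnd κ x y * (‖x.1‖ + ‖y.1‖) ^ κ ≤ ‖x.2 - y.2‖ := by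
  rw [distSnd]
  split_ifs with hc
  · rcases eq_or_ne ((‖x.1‖ + ‖y.1‖) ^ κ) 0 with h | h
    · rw [h, mul_zero]
      exact norm_nonneg _
    · rw [div_mul_cancel₀ _ h]
  · calc _ ≤ ‖x.2 - y.2‖ ^ (1 / (1 + κ : ℝ)) * (‖x.2 - y.2‖ ^ (1 / (1 + κ : ℝ))) ^ κ := by
          gcongr
          exact (not_le.1 hc).le
      _ = (‖x.2 - y.2‖ ^ (1 / (1 + κ : ℝ))) ^ (κ + 1) := by ring
      _ = _ := rpow_pow_succ (norm_nonneg _)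

/-- The converse inclusion of a box in a ball. Near the singular set, `|x'| < r`, the power branch
is used; away from it, the quotient branch. -/
theorem dist_le_of_norm_le {x y : Space n₁ n₂} {r a : ℝ} (hr : 0 < r) (ha : 1 ≤ a)
    (h1 : ‖x.1 - y.1‖ ≤ r) (h2 : ‖x.2 - y.2‖ ≤ a * r * (‖x.1‖ + r) ^ κ) :
    dist κ x y ≤ (1 + a * 2 ^ κ) * r := by
  have ha2 : 1 ≤ a * 2 ^ κ := one_le_mul_of_one_le_of_one_le ha (one_le_pow₀ (by norm_num))
  suffices h : distSnd κ x y ≤ a * 2 ^ κ * r by rw [dist_eq]; linarith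
  rcases lt_or_ge ‖x.1‖ r with hx | hx
  · refine (distSnd_le_rpow x y).trans ?_
    rw [← pow_le_pow_iff_left₀ (by positivity) (by positivity) (Nat.succ_ne_zero κ),
      Nat.succ_eq_add_one, rpow_pow_succ (norm_nonneg _)]
    calc ‖x.2 - y.2‖ ≤ a * r * (‖x.1‖ + r) ^ κ := h2
      _ ≤ a * r * (r + r) ^ κ := by gcongr
      _ = a * 2 ^ κ * r ^ (κ + 1) := by rw [← two_mul, mul_pow]; ring
      _ ≤ (a * 2 ^ κ) ^ (κ + 1) * r ^ (κ + 1) := by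
          gcongr
          exact le_self_pow₀ ha2 (Nat.succ_ne_zero κ)
      _ = _ := (mul_pow _ _ _).symm
  · have hs : 0 < ‖x.1‖ + ‖y.1‖ := by linarith [norm_nonneg y.1]
    refine le_of_mul_le_mul_right ?_ (pow_pos hs κ)
    calc distSnd κ x y * (‖x.1‖ + ‖y.1‖) ^ κ ≤ ‖x.2 - y.2‖ := distSnd_mul_le x y
      _ ≤ a * r * (‖x.1‖ + r) ^ κ := h2
      _ ≤ a * r * (2 * (‖x.1‖ + ‖y.1‖)) ^ κ := by
          gcongr
          linarith [norm_nonneg y.1]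
      _ = _ := by rw [mul_pow]; ring

variable (κ) in
/-- The quasi-triangle constant. -/
def quasiConst : ℝ := 1 + 6 ^ κ

theorem one_le_quasiConst : 1 ≤ quasiConst κ := by
  rw [quasiConst]
  linarith [pow_pos (by norm_num : (0 : ℝ) < 6) κ]

/-- Balls and boxes are comparable and the box estimates add up, since the weights at `x` and `y`
are both at most `3 (|x'| + r + s)`; combining `3 ^ κ` with the `2 ^ κ` of the box inclusion gives
`quasiConst`. -/
theorem dist_triangle {x y z : Space n₁ n₂} {r s : ℝ} (hrs : 0 < r + s) (h1 : dist κ x y ≤ r)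
    (h2 : dist κ y z ≤ s) : dist κ x z ≤ quasiConst κ * (r + s) := by
  have hr : 0 ≤ r := (dist_nonneg x y).trans h1
  have hs : 0 ≤ s := (dist_nonneg y z).trans h2
  have h3 := (norm_fst_sub_le (κ := κ) x y).trans h1
  have h4 := (norm_fst_sub_le (κ := κ) y z).trans h2
  have h5 := norm_snd_sub_le_of_dist_le h1
  have h6 := norm_snd_sub_le_of_dist_le h2
  have h7 : ‖y.1‖ ≤ ‖x.1‖ + r := (norm_fst_le_add_dist (κ := κ) x y).trans (by linarith)
  have h8 : dist κ x z ≤ (1 + 3 ^ κ * 2 ^ κ) * (r + s) := by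
    refine dist_le_of_norm_le hrs (one_le_pow₀ (by norm_num)) ?_ ?_
    · calc ‖x.1 - z.1‖ = ‖(x.1 - y.1) + (y.1 - z.1)‖ := by rw [sub_add_sub_cancel]
        _ ≤ _ := (norm_add_le _ _).trans (add_le_add h3 h4)
    · calc ‖x.2 - z.2‖ = ‖(x.2 - y.2) + (y.2 - z.2)‖ := by rw [sub_add_sub_cancel]
        _ ≤ r * (2 * ‖x.1‖ + r) ^ κ + s * (2 * ‖y.1‖ + s) ^ κ :=
            (norm_add_le _ _).trans (add_le_add h5 h6)
        _ ≤ r * (3 * (‖x.1‖ + (r + s))) ^ κ + s * (3 * (‖x.1‖ + (r + s))) ^ κ := by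
            gcongr <;> linarith [norm_nonneg x.1]
        _ = _ := by rw [mul_pow]; ring
  rwa [← mul_pow, show (3 * 2 : ℝ) = 6 by norm_num] at h8

/-! ### The volume of balls -/

variable (κ) in
/-- The volume of the ball `B(x,r)`, up to constants. -/
def modelVol (x : Space n₁ n₂) (r : ℝ) : ℝ := r ^ (n₁ + n₂) * (‖x.1‖ + r) ^ (κ * n₂)

theorem modelVol_pos (x : Space n₁ n₂) {r : ℝ} (hr : 0 < r) : 0 < modelVol κ x r := by
  have := norm_nonneg x.1
  rw [modelVol]
  positivity

theorem ball_subset (x : Space n₁ n₂) (r : ℝ) :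
    ball κ x r ⊆ Metric.closedBall x.1 r ×ˢ Metric.closedBall x.2 (r * (2 * ‖x.1‖ + r) ^ κ) := by
  intro y hy
  have hy' : dist κ x y ≤ r := le_of_lt hy
  constructor
  · rw [Metric.mem_closedBall, dist_eq_norm, norm_sub_rev]
    exact (norm_fst_sub_le x y).trans hy'
  · rw [Metric.mem_closedBall, dist_eq_norm, norm_sub_rev]
    exact norm_snd_sub_le_of_dist_le hy'

theorem isBounded_ball (x : Space n₁ n₂) (r : ℝ) : Bornology.IsBounded (ball κ x r) :=
  (Metric.isBounded_closedBall.prod Metric.isBounded_closedBall).subset (ball_subset x r)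

-- Only this lower bound is needed: the ball volumes multiply the kernels in the hypotheses, so
-- bounding them below bounds the kernels above.
variable (n₁ n₂ κ) in
theorem exists_mul_modelVol_le_ballVol :
    ∃ c : ℝ, 0 < c ∧ ∀ (x : Space n₁ n₂) (r : ℝ), 0 < r → c * modelVol κ x r ≤ ballVol κ x r := by
  set v₁ := (volume : Measure (EuclideanSpace ℝ (Fin n₁))).real (Metric.ball 0 1)
  set v₂ := (volume : Measure (EuclideanSpace ℝ (Fin n₂))).real (Metric.ball 0 1)
  have hv₁ : 0 < v₁ := ENNReal.toReal_pos (Metric.measure_ball_pos _ _ one_pos).ne'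
    measure_ball_lt_top.ne
  have hv₂ : 0 < v₂ := ENNReal.toReal_pos (Metric.measure_ball_pos _ _ one_pos).ne'
    measure_ball_lt_top.ne
  set a : ℝ := (2 * (1 + 1 * 2 ^ κ))⁻¹
  have ha : 0 < a := by positivity
  have ha1 : a ≤ 1 := inv_le_one_of_one_le₀ (by
    have : (0 : ℝ) < 2 ^ κ := by positivity
    linarith)
  refine ⟨a ^ (n₁ + n₂) * a ^ (κ * n₂) * (v₁ * v₂), by positivity, fun x r hr => ?_⟩
  set ρ := a * r
  have hρ : 0 < ρ := by positivity
  set ρ' := ρ * (‖x.1‖ + ρ) ^ κ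
  have hρ' : 0 < ρ' := by have := norm_nonneg x.1; positivity
  have hsub : Metric.ball x.1 ρ ×ˢ Metric.ball x.2 ρ' ⊆ ball κ x r := by
    rintro y ⟨h1, h2⟩
    rw [Metric.mem_ball, dist_eq_norm, norm_sub_rev] at h1 h2
    have h3 : dist κ x y ≤ (1 + 1 * 2 ^ κ) * ρ :=
      dist_le_of_norm_le hρ le_rfl h1.le (by rw [one_mul]; exact h2.le)
    have h4 : (1 + 1 * 2 ^ κ) * ρ = r / 2 := by
      simp only [ρ, a]
      field_simp
    rw [h4] at h3
    exact lt_of_le_of_lt h3 (by linarith)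
  have hvol : (volume : Measure (Space n₁ n₂)).real (Metric.ball x.1 ρ ×ˢ Metric.ball x.2 ρ') =
      (ρ ^ n₁ * v₁) * (ρ' ^ n₂ * v₂) := by
    rw [measureReal_def, Measure.volume_eq_prod, Measure.prod_prod, ENNReal.toReal_mul,
      Measure.addHaar_ball_of_pos _ _ hρ, Measure.addHaar_ball_of_pos _ _ hρ', ENNReal.toReal_mul,
      ENNReal.toReal_mul, ENNReal.toReal_ofReal (by positivity),
      ENNReal.toReal_ofReal (by positivity), finrank_euclideanSpace_fin, finrank_euclideanSpace_fin]
    rfl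
  calc a ^ (n₁ + n₂) * a ^ (κ * n₂) * (v₁ * v₂) * modelVol κ x r
      = (a * r) ^ (n₁ + n₂) * (a * (‖x.1‖ + r)) ^ (κ * n₂) * (v₁ * v₂) := by
        rw [modelVol, mul_pow, mul_pow]; ring
    _ ≤ (a * r) ^ (n₁ + n₂) * (‖x.1‖ + ρ) ^ (κ * n₂) * (v₁ * v₂) := by
        gcongr
        rw [mul_add]
        gcongr
        exact mul_le_of_le_one_left (norm_nonneg _) ha1
    _ = (ρ ^ n₁ * v₁) * (ρ' ^ n₂ * v₂) := by
        simp only [ρ', mul_pow, pow_add, pow_mul]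
        ring
    _ ≤ ballVol κ x r := by
        rw [← hvol]
        exact measureReal_mono hsub (isBounded_ball x r).measure_lt_top.ne

/-- The doubling property of the model volume. -/
theorem modelVol_le (x y : Space n₁ n₂) {r s a : ℝ} (hr : 0 ≤ r) (hs : 0 ≤ s) (hrs : r ≤ a * s)
    (h : ‖x.1‖ ≤ ‖y.1‖ + a * s) (ha : 1 ≤ a) :
    modelVol κ x r ≤ (2 * a) ^ (n₁ + n₂ + κ * n₂) * modelVol κ y s := by
  have hx := norm_nonneg x.1
  have hy := norm_nonneg y.1
  have h0 : 0 ≤ a := by linarith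
  calc modelVol κ x r ≤ ((2 * a) * s) ^ (n₁ + n₂) * ((2 * a) * (‖y.1‖ + s)) ^ (κ * n₂) := by
        rw [modelVol]
        gcongr
        · nlinarith
        · nlinarith
    _ = _ := by rw [modelVol, mul_pow (2 * a) s, mul_pow (2 * a) (‖y.1‖ + s), pow_add (2 * a) (n₁ + n₂)]; ring

end Grushin
end

noncomputable section
namespace Grushin
open Filter Topology
variable {n₁ n₂ : ℕ}

/-! ### Adapted dyadic grids -/

theorem norm_le_sum_abs {n : ℕ} (u : EuclideanSpace ℝ (Fin n)) : ‖u‖ ≤ ∑ i, |u i| := by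
  rw [EuclideanSpace.norm_eq]
  refine Real.sqrt_le_iff.2 ⟨Finset.sum_nonneg fun i _ => abs_nonneg _, ?_⟩
  simp_rw [Real.norm_eq_abs]
  exact Finset.sum_sq_le_sq_sum_of_nonneg fun i _ => abs_nonneg _

theorem abs_apply_le_norm {n : ℕ} (u : EuclideanSpace ℝ (Fin n)) (i : Fin n) : |u i| ≤ ‖u‖ := by
  simpa using PiLp.norm_apply_le u i

theorem norm_le_mul_of_abs_le {n : ℕ} {u : EuclideanSpace ℝ (Fin n)} {a : ℝ}
    (h : ∀ i, |u i| ≤ a) : ‖u‖ ≤ n * a := by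
  refine (norm_le_sum_abs u).trans ((Finset.sum_le_sum fun i _ => h i).trans ?_)
  simp

theorem sum_abs_le_mul_norm {n : ℕ} (u : EuclideanSpace ℝ (Fin n)) : ∑ i, |u i| ≤ n * ‖u‖ := by
  refine (Finset.sum_le_sum fun i _ => abs_apply_le_norm u i).trans ?_
  simp

theorem volume_cubeIndex_eq {n : ℕ} (τ : Fin n → ℤ) (k : ℤ) (m : Fin n → ℤ) :
    volume {u : EuclideanSpace ℝ (Fin n) | cubeIndex τ k u = m} =
      ENNReal.ofReal ((2 ^ k)⁻¹ ^ n) := by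
  have h : {u : EuclideanSpace ℝ (Fin n) | cubeIndex τ k u = m} =
      WithLp.ofLp ⁻¹' (Set.pi univ fun i => Ico ((2 ^ k)⁻¹ * (m i - dyadicOffset (τ i) k))
        ((2 ^ k)⁻¹ * (m i + 1 - dyadicOffset (τ i) k))) := by
    ext u
    simp [cubeIndex, funext_iff, dyadicIndex_eq_iff]
  rw [h, (PiLp.volume_preserving_ofLp (Fin n)).measure_preimage
    (MeasurableSet.univ_pi fun i => measurableSet_Ico).nullMeasurableSet, volume_pi_pi]
  have h2 : ∀ i, ((2 : ℝ) ^ k)⁻¹ * (m i + 1 - dyadicOffset (τ i) k) -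
      (2 ^ k)⁻¹ * (m i - dyadicOffset (τ i) k) = (2 ^ k)⁻¹ := fun i => by ring
  simp_rw [Real.volume_Ico, h2]
  rw [Finset.prod_const, Finset.card_univ, Fintype.card_fin, ENNReal.ofReal_pow (by positivity)]

theorem measurableSet_cubeIndex_eq {n : ℕ} (τ : Fin n → ℤ) (k : ℤ) (m : Fin n → ℤ) :
    MeasurableSet {u : EuclideanSpace ℝ (Fin n) | cubeIndex τ k u = m} := by
  have h : Measurable (cubeIndex τ k) := measurable_pi_lambda _ fun i =>
    (measurable_dyadicIndex _ _).comp (by fun_prop)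
  exact h (measurableSet_singleton m)

section Grids

variable (κ : ℕ) (τ₁ : Fin n₁ → ℤ) (τ₂ : Fin n₂ → ℤ)

/-- The level of the intervals that make up the second factor of the cell of level `k` around a
point with first component `u`. -/
def sndLevel (k : ℤ) (u : EuclideanSpace ℝ (Fin n₁)) : ℤ := k - κ * cubeScale τ₁ k u

/-- The label of the cell of level `k` that contains `x`. -/
def gridIndex (k : ℤ) (x : Space n₁ n₂) : (Fin n₁ → ℤ) × (Fin n₂ → ℤ) :=
  (cubeIndex τ₁ k x.1, cubeIndex τ₂ (sndLevel κ τ₁ k x.1) x.2)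

variable {κ τ₁ τ₂}

theorem sndLevel_congr {k : ℤ} {u v : EuclideanSpace ℝ (Fin n₁)}
    (h : cubeIndex τ₁ k u = cubeIndex τ₁ k v) : sndLevel κ τ₁ k u = sndLevel κ τ₁ k v := by
  rw [sndLevel, cubeScale, cubeSize_congr h, sndLevel, cubeScale]

theorem gridIndex_eq_iff {k : ℤ} {x y : Space n₁ n₂} :
    gridIndex κ τ₁ τ₂ k y = gridIndex κ τ₁ τ₂ k x ↔ cubeIndex τ₁ k y.1 = cubeIndex τ₁ k x.1 ∧
      cubeIndex τ₂ (sndLevel κ τ₁ k x.1) y.2 = cubeIndex τ₂ (sndLevel κ τ₁ k x.1) x.2 := by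
  rw [gridIndex, gridIndex, Prod.mk.injEq]
  exact and_congr_right fun h => by rw [sndLevel_congr h]

/-- As `cubeScale` does not increase with the level, the second factor shrinks at least as fast as
the first. The cells are therefore nested. -/
theorem sndLevel_add_one_le (hn : 1 ≤ n₁) (k : ℤ) (u : EuclideanSpace ℝ (Fin n₁)) :
    sndLevel κ τ₁ k u + 1 ≤ sndLevel κ τ₁ (k + 1) u := by
  have h := mul_le_mul_of_nonneg_left (cubeScale_succ_le (τ := τ₁) hn k u) (Nat.cast_nonneg (α := ℤ) κ)
  rw [sndLevel, sndLevel]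
  linarith

/-- In one step `cubeScale` drops by at most 3, so the second factor shrinks by a bounded ratio.
This gives doubling. -/
theorem sndLevel_succ_le (hn : 1 ≤ n₁) (k : ℤ) (u : EuclideanSpace ℝ (Fin n₁)) :
    sndLevel κ τ₁ (k + 1) u ≤ sndLevel κ τ₁ k u + (1 + 3 * κ : ℕ) := by
  have h := mul_le_mul_of_nonneg_left (cubeScale_le_add (τ := τ₁) (τ' := τ₁) (l := k + 1) (a := 1)
    hn (k := k) (by simp) u) (Nat.cast_nonneg (α := ℤ) κ)
  rw [sndLevel, sndLevel]
  push_cast at h ⊢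
  linarith

theorem sndLevel_add_nat_le (hn : 1 ≤ n₁) (k : ℤ) (u : EuclideanSpace ℝ (Fin n₁)) (n : ℕ) :
    sndLevel κ τ₁ k u + n ≤ sndLevel κ τ₁ (k + n) u := by
  induction n with
  | zero => simp
  | succ n ih =>
    have := sndLevel_add_one_le (κ := κ) (τ₁ := τ₁) hn (k + n) u
    push_cast
    rw [← add_assoc, ← add_assoc]
    linarith

theorem fiber_eq (k : ℤ) (x : Space n₁ n₂) :
    gridIndex κ τ₁ τ₂ k ⁻¹' {gridIndex κ τ₁ τ₂ k x} =
      {u | cubeIndex τ₁ k u = cubeIndex τ₁ k x.1} ×ˢ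
        {u | cubeIndex τ₂ (sndLevel κ τ₁ k x.1) u = cubeIndex τ₂ (sndLevel κ τ₁ k x.1) x.2} := by
  ext y
  exact gridIndex_eq_iff

variable (n₁ n₂) in
/-- The volume of a cell, in terms of the levels of its factors. -/
def gridVol (k l : ℤ) : ℝ≥0∞ := ENNReal.ofReal ((2 ^ k)⁻¹ ^ n₁ * (2 ^ l)⁻¹ ^ n₂)

theorem volume_fiber (k : ℤ) (x : Space n₁ n₂) :
    volume (gridIndex κ τ₁ τ₂ k ⁻¹' {gridIndex κ τ₁ τ₂ k x}) =
      gridVol n₁ n₂ k (sndLevel κ τ₁ k x.1) := by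
  rw [fiber_eq, Measure.volume_eq_prod, Measure.prod_prod, volume_cubeIndex_eq,
    volume_cubeIndex_eq, gridVol, ENNReal.ofReal_mul (by positivity)]

theorem inv_two_zpow_le {k k' : ℤ} {a : ℕ} (h : k' ≤ k + a) :
    ((2 : ℝ) ^ k)⁻¹ ≤ 2 ^ a * (2 ^ k')⁻¹ := by
  have h1 : (2 : ℝ) ^ k' ≤ 2 ^ k * 2 ^ a := by
    rw [← zpow_natCast, ← zpow_add₀ (by norm_num)]
    exact zpow_le_zpow_right₀ (by norm_num) h
  rwa [← div_eq_mul_inv, le_div_iff₀ (by positivity), inv_mul_le_iff₀ (by positivity)]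

theorem gridVol_le {k k' l l' : ℤ} {a b : ℕ} (hk : k' ≤ k + a) (hl : l' ≤ l + b) :
    gridVol n₁ n₂ k l ≤ (2 ^ (a * n₁ + b * n₂) : ℝ≥0) * gridVol n₁ n₂ k' l' := by
  have h1 : (((2 ^ (a * n₁ + b * n₂) : ℝ≥0)) : ℝ≥0∞) = ENNReal.ofReal (2 ^ (a * n₁ + b * n₂)) := by
    rw [ENNReal.ofReal_pow (by norm_num)]
    simp
  rw [gridVol, gridVol, h1, ← ENNReal.ofReal_mul (by positivity)]
  refine ENNReal.ofReal_le_ofReal ?_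
  calc ((2 : ℝ) ^ k)⁻¹ ^ n₁ * (2 ^ l)⁻¹ ^ n₂
      ≤ (2 ^ a * (2 ^ k')⁻¹) ^ n₁ * (2 ^ b * (2 ^ l')⁻¹) ^ n₂ := by
        gcongr
        · exact inv_two_zpow_le hk
        · exact inv_two_zpow_le hl
    _ = _ := by rw [mul_pow, mul_pow, ← pow_mul, ← pow_mul, pow_add]; ring

theorem two_mul_gridVol_le (hn : 1 ≤ n₁) {k l l' : ℤ} (hl : l ≤ l') :
    2 * gridVol n₁ n₂ (k + 1) l' ≤ gridVol n₁ n₂ k l := by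
  have h2 : (2 : ℝ≥0∞) = ENNReal.ofReal 2 := by simp
  rw [gridVol, gridVol, h2, ← ENNReal.ofReal_mul (by norm_num)]
  refine ENNReal.ofReal_le_ofReal ?_
  have h3 : ((2 : ℝ) ^ (k + 1))⁻¹ = (2 ^ k)⁻¹ / 2 := by
    rw [zpow_add_one₀ (by norm_num), mul_inv]; ring
  have h4 : ((2 : ℝ) ^ l')⁻¹ ≤ (2 ^ l)⁻¹ := by
    gcongr
    norm_num
  have h5 : (2 : ℝ) ≤ 2 ^ n₁ := le_self_pow₀ (by norm_num) (by omega)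
  rw [h3, div_pow]
  calc 2 * (((2 : ℝ) ^ k)⁻¹ ^ n₁ / 2 ^ n₁ * (2 ^ l')⁻¹ ^ n₂)
      ≤ 2 * ((2 ^ k)⁻¹ ^ n₁ / 2 * (2 ^ l)⁻¹ ^ n₂) := by gcongr
    _ = _ := by ring

theorem norm_fst_sub_le_of_cubeIndex {n : ℕ} {τ : Fin n → ℤ} {k N : ℤ}
    {u v : EuclideanSpace ℝ (Fin n)}
    (h : ∀ i, |dyadicIndex (τ i) k (u i) - dyadicIndex (τ i) k (v i)| ≤ N) :
    ‖u - v‖ ≤ n * ((2 ^ k)⁻¹ * (N + 1)) :=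
  norm_le_mul_of_abs_le fun i => by
    simpa using (abs_sub_lt_of_dyadicIndex (h i)).le

theorem norm_sub_le_of_cubeIndex_eq {n : ℕ} {τ : Fin n → ℤ} {k : ℤ}
    {u v : EuclideanSpace ℝ (Fin n)} (h : cubeIndex τ k u = cubeIndex τ k v) :
    ‖u - v‖ ≤ n * (2 ^ k)⁻¹ := by
  have := norm_fst_sub_le_of_cubeIndex (τ := τ) (k := k) (N := 0) (u := u) (v := v) fun i => by
    have := congrFun h i
    simp only [cubeIndex] at this
    simp [this]
  simpa using this

theorem exists_fiber_subset (hn : 1 ≤ n₁) (U : Set (Space n₁ n₂)) (hU : IsOpen U)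
    (x : Space n₁ n₂) (hx : x ∈ U) :
    ∃ k, gridIndex κ τ₁ τ₂ k ⁻¹' {gridIndex κ τ₁ τ₂ k x} ⊆ U := by
  obtain ⟨ε, hε, hεU⟩ := Metric.isOpen_iff.1 hU x hx
  set a : ℝ := n₁ + n₂ * (2 ^ sndLevel κ τ₁ 0 x.1)⁻¹ + 1
  have ha : 0 < a := by positivity
  obtain ⟨n, hn'⟩ := exists_pow_lt_of_lt_one (div_pos hε ha) (by norm_num : (1 / 2 : ℝ) < 1)
  rw [lt_div_iff₀ ha, one_div, inv_pow] at hn'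
  refine ⟨n, fun y hy => hεU ?_⟩
  rw [fiber_eq] at hy
  obtain ⟨h1, h2⟩ := hy
  have h3 := norm_sub_le_of_cubeIndex_eq h1
  have h4 := norm_sub_le_of_cubeIndex_eq h2
  have h5 : ((2 : ℝ) ^ sndLevel κ τ₁ n x.1)⁻¹ ≤ (2 ^ sndLevel κ τ₁ 0 x.1)⁻¹ * (2 ^ n)⁻¹ := by
    have := sndLevel_add_nat_le (κ := κ) (τ₁ := τ₁) hn 0 x.1 n
    rw [zero_add] at this
    rw [← mul_inv, ← zpow_natCast, ← zpow_add₀ (by norm_num)]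
    gcongr
    norm_num
  rw [zpow_natCast] at h3
  have hpos : (0 : ℝ) < (2 ^ n)⁻¹ := by positivity
  have hpos' : (0 : ℝ) < (2 ^ sndLevel κ τ₁ 0 x.1)⁻¹ := by positivity
  rw [Metric.mem_ball, Prod.dist_eq, max_lt_iff, dist_eq_norm, dist_eq_norm]
  constructor
  · refine lt_of_le_of_lt (h3.trans ?_) hn'
    rw [mul_comm]
    gcongr
    simp only [a]
    have : 0 ≤ (n₂ : ℝ) * (2 ^ sndLevel κ τ₁ 0 x.1)⁻¹ := by positivity
    linarith
  · refine lt_of_le_of_lt (h4.trans ?_) hn'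
    calc (n₂ : ℝ) * (2 ^ sndLevel κ τ₁ n x.1)⁻¹
        ≤ n₂ * ((2 ^ sndLevel κ τ₁ 0 x.1)⁻¹ * (2 ^ n)⁻¹) := by gcongr
      _ = (2 ^ n)⁻¹ * (n₂ * (2 ^ sndLevel κ τ₁ 0 x.1)⁻¹) := by ring
      _ ≤ _ := by
          gcongr
          simp only [a]
          have : (0 : ℝ) ≤ n₁ := by positivity
          linarith

theorem gridIndex_pred (hn : 1 ≤ n₁) {k : ℤ} {x y : Space n₁ n₂}
    (h : gridIndex κ τ₁ τ₂ (k + 1) x = gridIndex κ τ₁ τ₂ (k + 1) y) :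
    gridIndex κ τ₁ τ₂ k x = gridIndex κ τ₁ τ₂ k y := by
  rw [gridIndex_eq_iff] at h ⊢
  refine ⟨funext fun i => dyadicIndex_pred_eq (congrFun h.1 i), funext fun i => ?_⟩
  exact dyadicIndex_eq_of_le (by linarith [sndLevel_add_one_le (κ := κ) (τ₁ := τ₁) hn k y.1])
    (congrFun h.2 i)

theorem measurableSet_fiber (k : ℤ) (i : (Fin n₁ → ℤ) × (Fin n₂ → ℤ)) :
    MeasurableSet (gridIndex κ τ₁ τ₂ k ⁻¹' {i}) := by
  rcases (gridIndex κ τ₁ τ₂ k ⁻¹' {i}).eq_empty_or_nonempty with h | ⟨x, rfl⟩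
  · rw [h]; exact .empty
  · rw [fiber_eq]
    exact (measurableSet_cubeIndex_eq _ _ _).prod (measurableSet_cubeIndex_eq _ _ _)

variable (κ τ₁ τ₂) in
/-- The dyadic grid, adapted to the Grushin distance, with given shifts. -/
def adaptedGrid (hn : 1 ≤ n₁) :
    Grid (volume : Measure (Space n₁ n₂)) ((Fin n₁ → ℤ) × (Fin n₂ → ℤ)) where
  idx := gridIndex κ τ₁ τ₂
  dbl := 2 ^ (1 * n₁ + (1 + 3 * κ) * n₂)
  idx_pred := gridIndex_pred hn
  measurableSet_fiber := measurableSet_fiber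
  measure_ne_zero k x := by
    rw [volume_fiber, gridVol, Ne, ENNReal.ofReal_eq_zero, not_le]
    positivity
  measure_ne_top k x := by
    rw [volume_fiber]
    exact ENNReal.ofReal_ne_top
  two_mul_measure_le k x := by
    rw [volume_fiber, volume_fiber]
    exact two_mul_gridVol_le hn (by linarith [sndLevel_add_one_le (κ := κ) (τ₁ := τ₁) hn k x.1])
  measure_le_dbl k x := by
    rw [volume_fiber, volume_fiber]
    exact gridVol_le (by simp) (sndLevel_succ_le hn k x.1)
  exists_subset := exists_fiber_subset hn

theorem mem_adaptedGrid_cube {hn : 1 ≤ n₁} {k : ℤ} {x y : Space n₁ n₂} :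
    y ∈ (adaptedGrid κ τ₁ τ₂ hn).cube k x ↔ cubeIndex τ₁ k y.1 = cubeIndex τ₁ k x.1 ∧
      cubeIndex τ₂ (sndLevel κ τ₁ k x.1) y.2 = cubeIndex τ₂ (sndLevel κ τ₁ k x.1) x.2 :=
  gridIndex_eq_iff

theorem volume_adaptedGrid_cube (hn : 1 ≤ n₁) (k : ℤ) (x : Space n₁ n₂) :
    volume ((adaptedGrid κ τ₁ τ₂ hn).cube k x) = gridVol n₁ n₂ k (sndLevel κ τ₁ k x.1) :=
  volume_fiber k x

/-- The level of a cell is determined by the cell. -/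
theorem adaptedGrid_level_eq {σ₁ : Fin n₁ → ℤ} {σ₂ : Fin n₂ → ℤ} (hn : 1 ≤ n₁) {k l : ℤ}
    {x y : Space n₁ n₂}
    (h : (adaptedGrid κ τ₁ τ₂ hn).cube k x = (adaptedGrid κ σ₁ σ₂ hn).cube l y) : k = l := by
  have key : ∀ {τ₁ σ₁ : Fin n₁ → ℤ} {τ₂ σ₂ : Fin n₂ → ℤ} {k l : ℤ} {x y : Space n₁ n₂},
      (adaptedGrid κ τ₁ τ₂ hn).cube k x = (adaptedGrid κ σ₁ σ₂ hn).cube l y → ¬ k < l := by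
    intro τ₁ σ₁ τ₂ σ₂ k l x y h hkl
    set i₀ : Fin n₁ := ⟨0, hn⟩
    set d : ℝ := (2 ^ k)⁻¹
    have hd : 0 < d := by positivity
    -- The cell contains two points that differ by `3/4 * d` in one coordinate, where `d` is its
    -- side in `x'`; a cell of finer level has side at most `d / 2`.
    set p : ℝ → Space n₁ n₂ := fun s =>
      (WithLp.toLp 2 (Function.update x.1.ofLp i₀ (dyadicMid (τ₁ i₀) k (x.1 i₀) + s * d)), x.2)
    have hp : ∀ s, |s| < 1 / 2 → p s ∈ (adaptedGrid κ τ₁ τ₂ hn).cube k x := by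
      intro s hs
      refine mem_adaptedGrid_cube.2 ⟨funext fun i => ?_, rfl⟩
      by_cases hi : i = i₀
      · subst hi
        simp only [cubeIndex, p, Function.update_self]
        refine dyadicIndex_eq_of_abs_lt ?_
        rw [add_sub_cancel_left, abs_mul, abs_of_pos hd]
        nlinarith
      · simp only [cubeIndex, p, Function.update_of_ne hi]
    have h1 : p (3 / 8) ∈ (adaptedGrid κ σ₁ σ₂ hn).cube l y := h ▸ hp _ (by rw [abs_lt]; norm_num)
    have h2 : p (-(3 / 8)) ∈ (adaptedGrid κ σ₁ σ₂ hn).cube l y :=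
      h ▸ hp _ (by rw [abs_lt]; norm_num)
    have h3 := congrFun ((mem_adaptedGrid_cube.1 h1).1.trans (mem_adaptedGrid_cube.1 h2).1.symm) i₀
    have h4 := abs_sub_lt_of_dyadicIndex (t := σ₁ i₀) (k := l) (N := 0)
      (u := (p (3 / 8)).1 i₀) (v := (p (-(3 / 8))).1 i₀) (by
        simp only [cubeIndex] at h3
        simp [h3])
    have h5 : ((2 : ℝ) ^ l)⁻¹ ≤ d / 2 := by
      have : (2 : ℝ) ^ (k + 1) ≤ 2 ^ l := zpow_le_zpow_right₀ (by norm_num) hkl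
      rw [zpow_add_one₀ (by norm_num)] at this
      calc ((2 : ℝ) ^ l)⁻¹ ≤ (2 ^ k * 2)⁻¹ := by gcongr
        _ = d / 2 := by rw [mul_inv]; ring
    simp only [p, Function.update_self] at h4
    rw [show dyadicMid (τ₁ i₀) k (x.1 i₀) + 3 / 8 * d - (dyadicMid (τ₁ i₀) k (x.1 i₀) +
      -(3 / 8) * d) = 3 / 4 * d by ring, abs_of_pos (by positivity)] at h4
    push_cast at h4
    linarith
  exact le_antisymm (not_lt.1 (key h.symm)) (not_lt.1 (key h))

/-! ### Dilated cells and adjacent grids -/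

variable (κ) in
/-- The `N`-fold dilate of the cell of level `k` that contains `x`, for the shifts `1`. -/
def starSet (N k : ℤ) (x : Space n₁ n₂) : Set (Space n₁ n₂) :=
  {y | (∀ i, |dyadicIndex 1 k (y.1 i) - dyadicIndex 1 k (x.1 i)| ≤ N) ∧
    ∀ j, |dyadicIndex 1 (sndLevel κ (fun _ => 1) k x.1) (y.2 j) -
      dyadicIndex 1 (sndLevel κ (fun _ => 1) k x.1) (x.2 j)| ≤ N}

theorem exists_adjacent_cube (hn : 1 ≤ n₁) {N : ℤ} {c : ℕ}
    (hc : 6 * (N + 1) * 2 ^ (2 * κ) ≤ 2 ^ c) (k : ℤ) (x : Space n₁ n₂) :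
    ∃ (t₁ : Fin n₁ → Fin 2) (t₂ : Fin n₂ → Fin 2),
      starSet κ N k x ⊆ (adaptedGrid κ (fun i => ((t₁ i : ℕ) : ℤ)) (fun j => ((t₂ j : ℕ) : ℤ)) hn).cube
        (k - c) x ∧
      volume ((adaptedGrid κ (fun i => ((t₁ i : ℕ) : ℤ)) (fun j => ((t₂ j : ℕ) : ℤ)) hn).cube
        (k - c) x) ≤ (2 ^ (c * n₁ + (c + κ * (c + 2)) * n₂) : ℝ≥0) *
        volume ((adaptedGrid κ (fun _ => 1) (fun _ => 1) hn).cube k x) := by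
  -- The shifts in `x'` come first: they fix the cube of the first factor, hence the level `l` at
  -- which the shifts in `x''` are chosen.
  choose t₁ ht₁ using fun i => exists_shift (k - c) (x.1 i)
  set σ : Fin n₁ → ℤ := fun i => ((t₁ i : ℕ) : ℤ)
  set l := sndLevel κ σ (k - c) x.1
  set lb := sndLevel κ (fun _ => 1) k x.1
  choose t₂ ht₂ using fun j => exists_shift l (x.2 j)
  have hscale₁ : cubeScale (fun _ => 1) k x.1 ≤ cubeScale σ (k - c) x.1 + 2 := by
    simpa using cubeScale_le_add (τ := fun _ => 1) (τ' := σ) (k := k) (l := k - c) (a := 0) hn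
      (by simp) x.1
  have hscale₂ : cubeScale σ (k - c) x.1 ≤ cubeScale (fun _ => 1) k x.1 + (c + 2) :=
    cubeScale_le_add hn (by simp) x.1
  -- Changing the shifts and coarsening costs at most `2` in `cubeScale`, hence `2 κ` levels in
  -- `x''`. The factor `2 ^ (2 * κ)` in the condition on `c` pays for this, and the factor `6` meets
  -- the margin `1/6` of `exists_shift`.
  have hl₁ : l ≤ lb - c + (2 * κ : ℕ) := by
    have := mul_le_mul_of_nonneg_left hscale₁ (Nat.cast_nonneg (α := ℤ) κ)
    simp only [l, lb, sndLevel]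
    push_cast
    linarith
  have hl₂ : lb ≤ l + (c + κ * (c + 2) : ℕ) := by
    have := mul_le_mul_of_nonneg_left hscale₂ (Nat.cast_nonneg (α := ℤ) κ)
    simp only [l, lb, sndLevel]
    push_cast
    linarith
  have hc' : (6 * (N + 1) * 2 ^ (2 * κ) : ℝ) ≤ 2 ^ c := by exact_mod_cast hc
  have hsmall : ∀ a b : ℤ, a ≤ b - c + (2 * κ : ℕ) → ∀ s : ℝ, 0 ≤ s → s < (2 ^ b)⁻¹ * (N + 1) →
      2 ^ a * s < 1 / 6 := by
    intro a b hab s hs0 hs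
    have h1 : (2 : ℝ) ^ a ≤ 2 ^ b * 2 ^ (2 * κ) / 2 ^ c := by
      rw [← zpow_natCast 2 c, ← zpow_natCast 2 (2 * κ), ← zpow_add₀ (by norm_num),
        ← zpow_sub₀ (by norm_num)]
      exact zpow_le_zpow_right₀ (by norm_num) (by omega)
    calc (2 : ℝ) ^ a * s ≤ 2 ^ b * 2 ^ (2 * κ) / 2 ^ c * s := by gcongr
      _ < 2 ^ b * 2 ^ (2 * κ) / 2 ^ c * ((2 ^ b)⁻¹ * (N + 1)) := by gcongr
      _ = (6 * (N + 1) * 2 ^ (2 * κ)) / 2 ^ c / 6 := by field_simp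
      _ ≤ 1 / 6 := by
          gcongr
          exact (div_le_one (by positivity)).2 hc'
  refine ⟨t₁, t₂, fun y hy => ?_, ?_⟩
  · refine mem_adaptedGrid_cube.2 ⟨funext fun i => ?_, funext fun j => ?_⟩
    · refine ht₁ i _ (hsmall _ k (by have := Nat.cast_nonneg (α := ℤ) (2 * κ); omega) _
        (abs_nonneg _) (abs_sub_lt_of_dyadicIndex (hy.1 i)))
    · exact ht₂ j _ (hsmall _ lb hl₁ _ (abs_nonneg _) (abs_sub_lt_of_dyadicIndex (hy.2 j)))
  · rw [volume_adaptedGrid_cube, volume_adaptedGrid_cube]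
    exact gridVol_le (by simp) hl₂

theorem starSet_congr {N k : ℤ} {x y : Space n₁ n₂}
    (h : gridIndex κ (fun _ => 1) (fun _ => 1) k x = gridIndex κ (fun _ => 1) (fun _ => 1) k y) :
    starSet κ N k x = starSet κ N k y := by
  rw [gridIndex_eq_iff] at h
  have h1 := fun i => congrFun h.1 i
  have h2 := fun i => congrFun h.2 i
  simp only [cubeIndex] at h1 h2
  simp only [starSet, sndLevel_congr h.1, h1, h2]

theorem measurableSet_starSet (N k : ℤ) (x : Space n₁ n₂) : MeasurableSet (starSet κ N k x) := by
  have h1 : ∀ (l a : ℤ) (i : Fin n₁),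
      MeasurableSet {y : Space n₁ n₂ | |dyadicIndex 1 l (y.1 i) - a| ≤ N} := fun l a i =>
    ((measurable_dyadicIndex 1 l).comp (by fun_prop : Measurable fun y : Space n₁ n₂ => y.1 i))
      (Set.to_countable {b | |b - a| ≤ N}).measurableSet
  have h2 : ∀ (l a : ℤ) (i : Fin n₂),
      MeasurableSet {y : Space n₁ n₂ | |dyadicIndex 1 l (y.2 i) - a| ≤ N} := fun l a i =>
    ((measurable_dyadicIndex 1 l).comp (by fun_prop : Measurable fun y : Space n₁ n₂ => y.2 i))
      (Set.to_countable {b | |b - a| ≤ N}).measurableSet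
  have : starSet κ N k x = (⋂ i, {y | |dyadicIndex 1 k (y.1 i) - dyadicIndex 1 k (x.1 i)| ≤ N}) ∩
      ⋂ j, {y | |dyadicIndex 1 (sndLevel κ (fun _ => 1) k x.1) (y.2 j) -
        dyadicIndex 1 (sndLevel κ (fun _ => 1) k x.1) (x.2 j)| ≤ N} := by
    ext y
    simp [starSet]
  rw [this]
  exact (MeasurableSet.iInter fun i => h1 _ _ i).inter (MeasurableSet.iInter fun j => h2 _ _ j)

theorem starSet_succ_subset (hn : 1 ≤ n₁) {N : ℤ} (hN : 1 ≤ N) (k : ℤ) (x : Space n₁ n₂) :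
    starSet κ N (k + 1) x ⊆ starSet κ N k x := fun y hy =>
  ⟨fun i => abs_dyadicIndex_sub_le_of_le hN (by omega) (hy.1 i), fun j =>
    abs_dyadicIndex_sub_le_of_le hN
      (by linarith [sndLevel_add_one_le (κ := κ) (τ₁ := fun _ => 1) hn k x.1]) (hy.2 j)⟩

theorem abs_dyadicIndex_sub_le_two_pow {t k l : ℤ} {a : ℕ} {u v : ℝ}
    (h : dyadicIndex t k u = dyadicIndex t k v) (hl : l ≤ k + a) :
    |dyadicIndex t l u - dyadicIndex t l v| ≤ 2 ^ a := by
  refine abs_dyadicIndex_sub_le ?_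
  have h1 := abs_sub_lt_of_dyadicIndex (t := t) (k := k) (N := 0) (u := u) (v := v) (by simp [h])
  have h2 : (2 : ℝ) ^ l ≤ 2 ^ k * 2 ^ a := by
    rw [← zpow_natCast, ← zpow_add₀ (by norm_num)]
    exact zpow_le_zpow_right₀ (by norm_num) hl
  push_cast at h1 ⊢
  calc (2 : ℝ) ^ l * |u - v| ≤ 2 ^ k * 2 ^ a * ((2 ^ k)⁻¹ * (0 + 1)) := by gcongr
    _ = 2 ^ a := by field_simp; ring

/-- One step down refines the second factor by at most `1 + 3 κ` levels, so the parent spans at most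
`2 ^ (1 + 3 κ)` intervals of the finer level. -/
theorem fiber_subset_starSet (hn : 1 ≤ n₁) {N : ℤ} (hN : 2 ^ (1 + 3 * κ) ≤ N) (k : ℤ)
    (x : Space n₁ n₂) :
    gridIndex κ (fun _ => 1) (fun _ => 1) k ⁻¹' {gridIndex κ (fun _ => 1) (fun _ => 1) k x} ⊆
      starSet κ N (k + 1) x := by
  intro y hy
  rw [fiber_eq] at hy
  refine ⟨fun i => ?_, fun j => ?_⟩
  · refine (abs_dyadicIndex_sub_le_two_pow (a := 1 + 3 * κ) (congrFun hy.1 i) ?_).trans hN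
    push_cast
    have := Nat.cast_nonneg (α := ℤ) κ
    linarith
  · exact (abs_dyadicIndex_sub_le_two_pow (congrFun hy.2 j) (sndLevel_succ_le hn k x.1)).trans hN

theorem two_zpow_sndLevel_neg_le (hn : 1 ≤ n₁) (u : EuclideanSpace ℝ (Fin n₁)) (n : ℕ) :
    (2 : ℝ) ^ sndLevel κ τ₁ (-n) u ≤ 2 ^ sndLevel κ τ₁ 0 u * (2 ^ n)⁻¹ := by
  have h := sndLevel_add_nat_le (κ := κ) (τ₁ := τ₁) hn (-n) u n
  rw [neg_add_cancel] at h
  rw [← zpow_natCast, ← zpow_neg, ← zpow_add₀ (by norm_num)]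
  exact zpow_le_zpow_right₀ (by norm_num) (by omega)

/-- Both side lengths tend to infinity at coarse levels. The exhaustion of the space by dilates and
by cells around the origin rests on this. -/
theorem exists_level_small (hn : 1 ≤ n₁) (u : EuclideanSpace ℝ (Fin n₁)) (b : ℝ) {ε : ℝ}
    (hε : 0 < ε) : ∃ k : ℤ, 2 ^ k * b < ε ∧ 2 ^ sndLevel κ τ₁ k u * b < ε := by
  set a : ℝ := (1 + 2 ^ sndLevel κ τ₁ 0 u) * (|b| + 1)
  have ha : 0 < a := by positivity
  obtain ⟨n, hn'⟩ := exists_pow_lt_of_lt_one (div_pos hε ha) (by norm_num : (1 / 2 : ℝ) < 1)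
  rw [lt_div_iff₀ ha, one_div, inv_pow] at hn'
  have hb : b ≤ |b| + 1 := (le_abs_self b).trans (by linarith)
  have hpos : (0 : ℝ) < 2 ^ sndLevel κ τ₁ 0 u := by positivity
  refine ⟨-n, lt_of_le_of_lt ?_ hn', lt_of_le_of_lt ?_ hn'⟩
  · rw [zpow_neg, zpow_natCast]
    gcongr
    refine hb.trans (le_mul_of_one_le_left (by positivity) (by linarith))
  · calc (2 : ℝ) ^ sndLevel κ τ₁ (-n) u * b ≤ 2 ^ sndLevel κ τ₁ (-n) u * (|b| + 1) := by gcongr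
      _ ≤ 2 ^ sndLevel κ τ₁ 0 u * (2 ^ n)⁻¹ * (|b| + 1) := by
          gcongr
          exact two_zpow_sndLevel_neg_le hn u n
      _ = (2 ^ n)⁻¹ * (2 ^ sndLevel κ τ₁ 0 u * (|b| + 1)) := by ring
      _ ≤ _ := mul_le_mul_of_nonneg_left (mul_le_mul_of_nonneg_right (by linarith)
          (by positivity)) (by positivity)

theorem exists_mem_starSet (hn : 1 ≤ n₁) {N : ℤ} (hN : 1 ≤ N) (x y : Space n₁ n₂) :
    ∃ k, y ∈ starSet κ N k x := by
  have hN' : (1 : ℝ) ≤ N := by exact_mod_cast hN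
  obtain ⟨k, h1, h2⟩ := exists_level_small (κ := κ) (τ₁ := fun _ => 1) hn x.1
    (‖y.1 - x.1‖ + ‖y.2 - x.2‖) one_pos
  refine ⟨k, fun i => abs_dyadicIndex_sub_le ?_, fun j => abs_dyadicIndex_sub_le ?_⟩
  · refine le_trans ?_ (h1.le.trans hN')
    gcongr
    exact (abs_apply_le_norm (y.1 - x.1) i).trans (le_add_of_nonneg_right (norm_nonneg _))
  · refine le_trans ?_ (h2.le.trans hN')
    gcongr
    exact (abs_apply_le_norm (y.2 - x.2) j).trans (le_add_of_nonneg_left (norm_nonneg _))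

theorem isBounded_starSet (N k : ℤ) (x : Space n₁ n₂) :
    Bornology.IsBounded (starSet κ N k x) := by
  have h1 := Metric.isBounded_closedBall (x := x.1) (r := n₁ * ((2 ^ k)⁻¹ * (N + 1)))
  have h2 := Metric.isBounded_closedBall (x := x.2)
    (r := n₂ * ((2 ^ sndLevel κ (fun _ => 1) k x.1)⁻¹ * (N + 1)))
  refine (h1.prod h2).subset (fun y hy => ⟨?_, ?_⟩)
  · rw [Metric.mem_closedBall, dist_eq_norm]
    exact norm_fst_sub_le_of_cubeIndex (τ := fun _ => 1) hy.1
  · rw [Metric.mem_closedBall, dist_eq_norm]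
    exact norm_fst_sub_le_of_cubeIndex (τ := fun _ => 1) hy.2

variable (κ n₂) in
/-- The grid with shifts `1`, with the `N`-fold dilates of its cells. -/
def starGrid (hn : 1 ≤ n₁) {N : ℤ} {c : ℕ} (hN : 2 ^ (1 + 3 * κ) ≤ N)
    (hc : 6 * (N + 1) * 2 ^ (2 * κ) ≤ 2 ^ c) :
    StarGrid n₁ n₂ ((Fin n₁ → ℤ) × (Fin n₂ → ℤ)) where
  toGrid := adaptedGrid κ (fun _ => 1) (fun _ => 1) hn
  star := starSet κ N
  starDbl := 2 ^ (c * n₁ + (c + κ * (c + 2)) * n₂)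
  star_congr := starSet_congr
  measurableSet_star := measurableSet_starSet N
  star_succ_subset := starSet_succ_subset hn ((one_le_pow₀ (by norm_num)).trans hN)
  fiber_subset_star := fiber_subset_starSet hn hN
  exists_mem_star := exists_mem_starSet hn ((one_le_pow₀ (by norm_num)).trans hN)
  isBounded_star := isBounded_starSet N
  measure_star_le k x := by
    obtain ⟨t₁, t₂, h1, h2⟩ := exists_adjacent_cube hn hc k x
    exact (measure_mono h1).trans h2

theorem exists_subset_adaptedGrid_cube (hn : 1 ≤ n₁) {s : Set (Space n₁ n₂)}
    (hs : Bornology.IsBounded s) :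
    ∃ k, s ⊆ (adaptedGrid κ (fun _ => 1) (fun _ => 1) hn).cube k 0 := by
  obtain ⟨r, hr⟩ := hs.subset_closedBall 0
  obtain ⟨k, h1, h2⟩ := exists_level_small (κ := κ) (τ₁ := fun _ => 1) hn 0 r
    (by norm_num : (0 : ℝ) < 1 / 3)
  refine ⟨k, fun y hy => mem_adaptedGrid_cube.2 ⟨funext fun i => ?_, funext fun j => ?_⟩⟩
  · refine dyadicIndex_one_eq_zero (lt_of_le_of_lt ?_ h1)
    gcongr
    have := hr hy
    rw [mem_closedBall_zero_iff, Prod.norm_def, max_le_iff] at this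
    exact (abs_apply_le_norm y.1 i).trans this.1
  · refine dyadicIndex_one_eq_zero (lt_of_le_of_lt (mul_le_mul_of_nonneg_left ?_ ?_) h2)
    swap
    · positivity
    have := hr hy
    rw [mem_closedBall_zero_iff, Prod.norm_def, max_le_iff] at this
    exact (abs_apply_le_norm y.2 j).trans this.2

end Grids

end Grushin
end

noncomputable section
namespace Grushin
open Filter Topology
variable {n₁ n₂ : ℕ}

/-! ### Comparison of cells and balls -/

section Cells

variable {κ : ℕ} {τ₁ : Fin n₁ → ℤ} {τ₂ : Fin n₂ → ℤ}

/-- With `M = 2 ^ cubeScale`, comparable to `|x'| + 2^{-k}`, the side of a cell in `x''` is `2^{-k}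
M^κ`: the proportions of a ball of radius `2^{-k}`. -/
theorem inv_two_zpow_sndLevel (k : ℤ) (u : EuclideanSpace ℝ (Fin n₁)) :
    ((2 : ℝ) ^ sndLevel κ τ₁ k u)⁻¹ = (2 ^ k)⁻¹ * (2 ^ cubeScale τ₁ k u) ^ κ := by
  rw [sndLevel, zpow_sub₀ (by norm_num), mul_comm (κ : ℤ), zpow_mul, zpow_natCast, inv_div,
    div_eq_inv_mul]

theorem norm_le_two_zpow_cubeScale (k : ℤ) (u : EuclideanSpace ℝ (Fin n₁)) :
    ‖u‖ ≤ 2 ^ cubeScale τ₁ k u :=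
  ((norm_le_sum_abs u).trans (sum_abs_le_cubeSize k u)).trans (cubeSize_le_two_zpow k u)

theorem inv_two_zpow_le_cubeScale (hn : 1 ≤ n₁) (k : ℤ) (u : EuclideanSpace ℝ (Fin n₁)) :
    (2 ^ k)⁻¹ ≤ 2 * (2 : ℝ) ^ cubeScale τ₁ k u :=
  (inv_le_two_mul_cubeSize hn k u).trans
    (mul_le_mul_of_nonneg_left (cubeSize_le_two_zpow (τ := τ₁) k u) (by norm_num))

theorem two_zpow_cubeScale_le (hn : 1 ≤ n₁) (k : ℤ) (u : EuclideanSpace ℝ (Fin n₁)) :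
    (2 : ℝ) ^ cubeScale τ₁ k u ≤ 2 * n₁ * (‖u‖ + (2 ^ k)⁻¹) := by
  have h1 := two_zpow_lt_cubeSize (τ := τ₁) hn k u
  have h2 := cubeSize_le_sum_abs (τ := τ₁) k u
  have h3 := sum_abs_le_mul_norm u
  linarith

variable (n₁ n₂ κ) in
/-- The ratio of the diameter of a cell and its side length. -/
def cellConst : ℝ := (1 + (n₂ * (2 * n₁) ^ κ + 1) * 2 ^ κ) * n₁

theorem cellConst_pos (hn : 1 ≤ n₁) : 0 < cellConst n₁ n₂ κ := by
  have : (0 : ℝ) < n₁ := by exact_mod_cast hn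
  rw [cellConst]
  positivity

/-- Points whose coordinates are close at the scale of a cell are close. -/
theorem dist_le_of_level (hn : 1 ≤ n₁) {k : ℤ} {x y : Space n₁ n₂} {b : ℝ} (hb : 1 ≤ b)
    (h1 : ‖x.1 - y.1‖ ≤ n₁ * ((2 ^ k)⁻¹ * b))
    (h2 : ‖x.2 - y.2‖ ≤ n₂ * ((2 ^ sndLevel κ τ₁ k x.1)⁻¹ * b)) :
    dist κ x y ≤ cellConst n₁ n₂ κ * (b * (2 ^ k)⁻¹) := by
  have hn' : (1 : ℝ) ≤ n₁ := by exact_mod_cast hn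
  set ρ : ℝ := (2 ^ k)⁻¹
  have hρ : 0 < ρ := by positivity
  have hx := norm_nonneg x.1
  have h3 : dist κ x y ≤ (1 + (n₂ * (2 * n₁) ^ κ + 1) * 2 ^ κ) * (n₁ * (ρ * b)) := by
    refine dist_le_of_norm_le (by positivity) (le_add_of_nonneg_left (by positivity)) h1
      (h2.trans ?_)
    rw [inv_two_zpow_sndLevel]
    have h4 : ρ ≤ n₁ * (ρ * b) := by
      calc ρ = 1 * (ρ * 1) := by ring
        _ ≤ n₁ * (ρ * b) := by gcongr
    calc n₂ * (ρ * (2 ^ cubeScale τ₁ k x.1) ^ κ * b)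
        ≤ n₂ * (ρ * (2 * n₁ * (‖x.1‖ + ρ)) ^ κ * b) := by
          gcongr
          exact two_zpow_cubeScale_le hn k x.1
      _ = n₂ * (2 * n₁) ^ κ * (ρ * b) * (‖x.1‖ + ρ) ^ κ := by rw [mul_pow]; ring
      _ ≤ (n₂ * (2 * n₁) ^ κ + 1) * (n₁ * (ρ * b)) * (‖x.1‖ + n₁ * (ρ * b)) ^ κ := by
          refine mul_le_mul (mul_le_mul (by linarith) ?_ (by positivity) (by positivity))
            (by gcongr) (by positivity) (by positivity)
          exact le_mul_of_one_le_left (by positivity) hn'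
  rw [cellConst]
  linarith

theorem dist_le_of_mem_cube (hn : 1 ≤ n₁) {k : ℤ} {x y : Space n₁ n₂}
    (h : y ∈ (adaptedGrid κ τ₁ τ₂ hn).cube k x) :
    dist κ x y ≤ cellConst n₁ n₂ κ * (2 ^ k)⁻¹ := by
  rw [mem_adaptedGrid_cube] at h
  have := dist_le_of_level (τ₁ := τ₁) hn le_rfl
    (by rw [mul_one]; exact norm_sub_le_of_cubeIndex_eq h.1.symm)
    (by rw [mul_one]; exact norm_sub_le_of_cubeIndex_eq h.2.symm)
  rwa [one_mul] at this

theorem dist_le_of_mem_starSet (hn : 1 ≤ n₁) {N k : ℤ} (hN : 0 ≤ N) {x y : Space n₁ n₂}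
    (h : y ∈ starSet κ N k x) : dist κ x y ≤ cellConst n₁ n₂ κ * ((N + 1) * (2 ^ k)⁻¹) := by
  have hN' : (0 : ℝ) ≤ N := by exact_mod_cast hN
  refine dist_le_of_level (τ₁ := fun _ => 1) hn (by linarith) ?_ ?_
  · rw [norm_sub_rev]
    exact norm_fst_sub_le_of_cubeIndex (τ := fun _ => 1) h.1
  · rw [norm_sub_rev]
    exact norm_fst_sub_le_of_cubeIndex (τ := fun _ => 1) h.2

/-- The dilation factor arises from `r (2|x'| + r)^κ` with `r = R 2^{-k}`, `|x'| ≤ M` and `2^{-k} ≤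
2 M`. In contrapositive form, points off the dilate are farther away than `R 2^{-k}`. -/
theorem mem_starSet_of_dist_le (hn : 1 ≤ n₁) {R : ℕ} {k : ℤ} {x y : Space n₁ n₂}
    (h : dist κ x y ≤ R * (2 ^ k)⁻¹) : y ∈ starSet κ ((R * (2 + 2 * R) ^ κ : ℕ) : ℤ) k x := by
  have hk : (0 : ℝ) < 2 ^ k := by positivity
  refine ⟨fun i => abs_dyadicIndex_sub_le ?_, fun j => abs_dyadicIndex_sub_le ?_⟩
  · have h1 := ((abs_apply_le_norm (x.1 - y.1) i).trans (norm_fst_sub_le x y)).trans h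
    rw [PiLp.sub_apply, abs_sub_comm] at h1
    calc 2 ^ k * |y.1 i - x.1 i| ≤ 2 ^ k * (R * (2 ^ k)⁻¹) := by gcongr
      _ = R * 1 := by field_simp
      _ ≤ R * (2 + 2 * R) ^ κ := by
          gcongr
          exact one_le_pow₀ (by linarith [Nat.cast_nonneg (α := ℝ) R])
      _ = _ := by push_cast; ring
  · have h1 := (abs_apply_le_norm (x.2 - y.2) j).trans (norm_snd_sub_le_of_dist_le h)
    rw [PiLp.sub_apply, abs_sub_comm] at h1
    have h2 := norm_le_two_zpow_cubeScale (τ₁ := fun _ => 1) k x.1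
    have h3 := inv_two_zpow_le_cubeScale (τ₁ := fun _ => 1) hn k x.1
    have h4 := inv_two_zpow_sndLevel (κ := κ) (τ₁ := fun _ => 1) k x.1
    have h5 : (0 : ℝ) < 2 ^ sndLevel κ (fun _ => 1) k x.1 := by positivity
    set M : ℝ := 2 ^ cubeScale (fun _ => 1) k x.1
    rw [mul_comm, ← le_div_iff₀ h5, div_eq_mul_inv, h4]
    calc |y.2 j - x.2 j| ≤ R * (2 ^ k)⁻¹ * (2 * ‖x.1‖ + R * (2 ^ k)⁻¹) ^ κ := h1
      _ ≤ R * (2 ^ k)⁻¹ * (2 * M + R * (2 * M)) ^ κ := by gcongr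
      _ = R * (2 ^ k)⁻¹ * ((2 + 2 * R) * M) ^ κ := by ring
      _ = _ := by push_cast; rw [mul_pow]; ring

theorem gridVol_sndLevel_le (hn : 1 ≤ n₁) (k : ℤ) (x : Space n₁ n₂) :
    gridVol n₁ n₂ k (sndLevel κ τ₁ k x.1) ≤
      ENNReal.ofReal ((2 * n₁) ^ (κ * n₂) * modelVol κ x (2 ^ k)⁻¹) := by
  rw [gridVol, inv_two_zpow_sndLevel]
  refine ENNReal.ofReal_le_ofReal ?_
  have h := two_zpow_cubeScale_le (τ₁ := τ₁) hn k x.1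
  calc ((2 : ℝ) ^ k)⁻¹ ^ n₁ * ((2 ^ k)⁻¹ * (2 ^ cubeScale τ₁ k x.1) ^ κ) ^ n₂
      ≤ (2 ^ k)⁻¹ ^ n₁ * ((2 ^ k)⁻¹ * (2 * n₁ * (‖x.1‖ + (2 ^ k)⁻¹)) ^ κ) ^ n₂ := by gcongr
    _ = _ := by
      rw [modelVol, mul_pow _ _ n₂, ← pow_mul, mul_pow (2 * (n₁ : ℝ)), pow_add]
      ring

/-! ### The dyadic decompositions -/

/-- The cells of an adapted grid are a dyadic decomposition. -/
theorem isDyadicDecomposition_adaptedGrid (hn : 1 ≤ n₁) :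
    IsDyadicDecomposition κ (4 ^ (κ + 1))⁻¹ (cellConst n₁ n₂ κ + 1)
      ((2 ^ (1 * n₁ + (1 + 3 * κ) * n₂))⁻¹) (1 / 2)
      (fun k => range fun x => (adaptedGrid κ τ₁ τ₂ hn).cube k x) where
  h₁_pos := by positivity
  h₁_le := by
    have := cellConst_pos (n₂ := n₂) (κ := κ) hn
    have h2 : ((4 : ℝ) ^ (κ + 1))⁻¹ ≤ 1 := inv_le_one_of_one_le₀ (one_le_pow₀ (by norm_num))
    linarith
  ε₀_mem := ⟨by positivity, inv_lt_one_of_one_lt₀ (one_lt_pow₀ (by norm_num) (by omega))⟩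
  δ₀_mem := by norm_num
  meas := by
    rintro k _ ⟨x, rfl⟩
    exact Grid.measurableSet_cube _ _ _
  cover k := by
    have : ⋃₀ (range fun x => (adaptedGrid κ τ₁ τ₂ hn).cube k x) = univ :=
      eq_univ_of_forall fun x => ⟨_, mem_range_self x, Grid.mem_cube_self _ _ _⟩
    rw [this, compl_univ, measure_empty]
  nested := by
    rintro k l hlk _ ⟨x, rfl⟩ _ ⟨y, rfl⟩
    refine or_iff_not_imp_left.2 fun h => ?_
    obtain ⟨z, hzx, hzy⟩ := Set.not_disjoint_iff.1 h
    have h1 := Grid.cube_eq_of_mem _ hzx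
    have h2 := Grid.cube_eq_of_mem _ hzy
    exact h1.symm.subset.trans ((Grid.cube_subset_cube _ hlk z).trans h2.subset)
  child := by
    rintro k _ ⟨x, rfl⟩
    exact ⟨_, mem_range_self x, Grid.cube_subset_cube _ (by omega) x⟩
  parent := by
    rintro k _ ⟨x, rfl⟩
    refine ⟨_, ⟨mem_range_self x, Grid.cube_subset_cube _ (by omega) x⟩, ?_⟩
    rintro _ ⟨⟨y, rfl⟩, h⟩
    exact (Grid.cube_eq_of_mem _ (h (Grid.mem_cube_self _ _ _))).symm
  child_vol := by
    rintro k _ ⟨x, rfl⟩ _ ⟨y, rfl⟩ h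
    change _ * volume ((adaptedGrid κ τ₁ τ₂ hn).cube k x) ≤ _
    rw [← Grid.cube_eq_of_mem _ (h (Grid.mem_cube_self _ _ _))]
    have h1 := (adaptedGrid κ τ₁ τ₂ hn).measure_le_dbl k y
    rw [ENNReal.ofReal_inv_of_pos (by positivity), ENNReal.ofReal_pow (by norm_num)]
    rw [mul_comm, ← div_eq_mul_inv]
    refine ENNReal.div_le_of_le_mul' ?_
    have h2 : ((adaptedGrid κ τ₁ τ₂ hn).dbl : ℝ≥0∞) =
      ENNReal.ofReal 2 ^ (1 * n₁ + (1 + 3 * κ) * n₂) := by simp [adaptedGrid]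
    rw [← h2]
    exact h1
  center := by
    rintro k _ ⟨x, rfl⟩
    set ρ : ℝ := (2 ^ k)⁻¹
    have hρ : 0 < ρ := by positivity
    have hρ' : (1 / 2 : ℝ) ^ k = ρ := by rw [one_div, inv_zpow]
    set l := sndLevel κ τ₁ k x.1
    -- The centre of the box is the centre of the two sandwiching balls.
    set c : Space n₁ n₂ := (WithLp.toLp 2 fun i => dyadicMid (τ₁ i) k (x.1 i),
      WithLp.toLp 2 fun j => dyadicMid (τ₂ j) l (x.2 j))
    have hl : ((2 : ℝ) ^ l)⁻¹ = ρ * (2 ^ cubeScale τ₁ k x.1) ^ κ := inv_two_zpow_sndLevel k x.1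
    have hM := inv_two_zpow_le_cubeScale (τ₁ := τ₁) hn k x.1
    have hc : ‖c.1‖ ≤ 2 ^ cubeScale τ₁ k x.1 := by
      refine ((norm_le_sum_abs c.1).trans ?_).trans (cubeSize_le_two_zpow k x.1)
      rw [cubeSize]
      exact Finset.sum_le_sum fun i _ => le_add_of_nonneg_right (by positivity)
    refine ⟨c, fun y hy => ?_, fun y hy => ?_⟩
    · have hy' : dist κ c y < (4 ^ (κ + 1))⁻¹ * ρ := by rw [← hρ']; exact hy
      have h4 : ((4 : ℝ) ^ (κ + 1))⁻¹ ≤ 4⁻¹ := by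
        gcongr
        exact le_self_pow₀ (by norm_num) (by omega)
      have h1 := norm_fst_sub_le (κ := κ) c y
      have h2 := norm_snd_sub_le_of_dist_le hy'.le
      refine mem_adaptedGrid_cube.2 ⟨funext fun i => dyadicIndex_eq_of_abs_lt ?_,
        funext fun j => dyadicIndex_eq_of_abs_lt ?_⟩
      · have h3 := abs_apply_le_norm (c.1 - y.1) i
        rw [PiLp.sub_apply, abs_sub_comm] at h3
        have h5 : ((4 : ℝ) ^ (κ + 1))⁻¹ * ρ ≤ 4⁻¹ * ρ := by gcongr
        calc |y.1 i - dyadicMid (τ₁ i) k (x.1 i)| ≤ ‖c.1 - y.1‖ := h3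
          _ < ρ / 2 := by linarith
      · have h3 := abs_apply_le_norm (c.2 - y.2) j
        rw [PiLp.sub_apply, abs_sub_comm] at h3
        change _ < ((2 : ℝ) ^ l)⁻¹ / 2
        have hMpos : (0 : ℝ) < 2 ^ cubeScale τ₁ k x.1 := by positivity
        set M : ℝ := 2 ^ cubeScale τ₁ k x.1
        -- The inner radius `4 ^ (-(κ + 1)) ρ` absorbs the factor `(4 M) ^ κ`, leaving a quarter of
        -- the side of the cell in `x''`.
        have h5 : 2 * ‖c.1‖ + (4 ^ (κ + 1))⁻¹ * ρ ≤ 4 * M := by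
          have : ((4 : ℝ) ^ (κ + 1))⁻¹ * ρ ≤ 4⁻¹ * (2 * M) := by gcongr
          linarith
        calc |y.2 j - dyadicMid (τ₂ j) l (x.2 j)| ≤ ‖c.2 - y.2‖ := h3
          _ ≤ _ := h2
          _ ≤ (4 ^ (κ + 1))⁻¹ * ρ * (4 * M) ^ κ := by gcongr
          _ = ρ * M ^ κ / 4 := by
              rw [mul_pow, pow_succ]
              field_simp
          _ < (2 ^ l)⁻¹ / 2 := by
              rw [hl]
              have : 0 < ρ * M ^ κ := by positivity
              linarith
    · have hy2 := mem_adaptedGrid_cube.1 hy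
      have h1 : ∀ i, |(c.1 - y.1) i| ≤ ρ := fun i => by
        have h := abs_sub_dyadicMid_le (τ₁ i) k (y.1 i)
        rw [dyadicMid_congr (congrFun hy2.1 i), abs_sub_comm] at h
        have : |(c.1 - y.1) i| ≤ ρ / 2 := h
        linarith
      have h2 : ∀ j, |(c.2 - y.2) j| ≤ (2 ^ l)⁻¹ := fun j => by
        have h := abs_sub_dyadicMid_le (τ₂ j) l (y.2 j)
        rw [dyadicMid_congr (congrFun hy2.2 j), abs_sub_comm] at h
        have h' : |(c.2 - y.2) j| ≤ (2 ^ l)⁻¹ / 2 := h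
        have : (0 : ℝ) < (2 ^ l)⁻¹ := by positivity
        linarith
      have hcx : cubeIndex τ₁ k c.1 = cubeIndex τ₁ k x.1 := funext fun i =>
        dyadicIndex_eq_of_abs_lt (by
          change |dyadicMid (τ₁ i) k (x.1 i) - dyadicMid (τ₁ i) k (x.1 i)| < _
          rw [sub_self, abs_zero]
          positivity)
      have hl' : sndLevel κ τ₁ k c.1 = l := sndLevel_congr hcx
      have h3 := dist_le_of_level (κ := κ) (τ₁ := τ₁) (x := c) (y := y) (k := k) hn le_rfl
        (by rw [mul_one]; exact norm_le_mul_of_abs_le h1)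
        (by rw [mul_one, hl']; exact norm_le_mul_of_abs_le h2)
      change dist κ c y < _
      rw [hρ']
      rw [one_mul] at h3
      linarith

end Cells

end Grushin
end

/-! ### From the kernel hypotheses to regularity on annuli. -/

noncomputable section
namespace Grushin
open Filter Topology
variable {n₁ n₂ : ℕ}

/-! ### The mean value theorem along the gradient fields -/

section LineDeriv

variable {E : Type*} [AddCommGroup E] [Module ℝ E]

/-- The kernels are assumed differentiable only along the fields, so the mean value theorem is
applied on lines in those directions. -/
theorem norm_sub_le_of_norm_lineDeriv_le {F : E → ℂ} {p v : E} {s B : ℝ}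
    (hd : ∀ t ∈ uIcc 0 s, LineDifferentiableAt ℝ F (p + t • v) v)
    (hB : ∀ t ∈ uIcc 0 s, ‖lineDeriv ℝ F (p + t • v) v‖ ≤ B) :
    ‖F (p + s • v) - F p‖ ≤ B * |s| := by
  have h1 : ∀ t ∈ uIcc 0 s, HasDerivWithinAt (fun t : ℝ => F (p + t • v))
      (lineDeriv ℝ F (p + t • v) v) (uIcc 0 s) t := by
    intro t ht
    have h2 : HasDerivAt (fun h : ℝ => F (p + t • v + h • v)) (lineDeriv ℝ F (p + t • v) v)
        (t - t) := by
      rw [sub_self]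
      exact (hd t ht).hasLineDerivAt
    have h3 := h2.comp_sub_const t t
    refine HasDerivAt.hasDerivWithinAt (h3.congr_of_eventuallyEq (Eventually.of_forall fun r => ?_))
    simp only [add_assoc, ← add_smul, add_sub_cancel]
  have h4 := (convex_uIcc (0 : ℝ) s).norm_image_sub_le_of_norm_hasDerivWithin_le h1 hB
    left_mem_uIcc right_mem_uIcc
  simpa using h4

/-- The coordinates are changed one at a time; all intermediate points stay in the box spanned by
`a` and `b`. -/
theorem norm_sub_le_of_norm_lineDeriv_single_le {n : ℕ} {F : EuclideanSpace ℝ (Fin n) → ℂ}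
    {a b : EuclideanSpace ℝ (Fin n)} {B : ℝ}
    (hd : ∀ c : EuclideanSpace ℝ (Fin n), (∀ i, c i ∈ uIcc (a i) (b i)) → ∀ i,
      LineDifferentiableAt ℝ F c (EuclideanSpace.single i 1))
    (hB : ∀ c : EuclideanSpace ℝ (Fin n), (∀ i, c i ∈ uIcc (a i) (b i)) → ∀ i,
      ‖lineDeriv ℝ F c (EuclideanSpace.single i 1)‖ ≤ B) :
    ‖F b - F a‖ ≤ B * ∑ i, |b i - a i| := by
  classical
  set c : Finset (Fin n) → EuclideanSpace ℝ (Fin n) := fun s =>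
    WithLp.toLp 2 fun i => if i ∈ s then b i else a i
  have key : ∀ s : Finset (Fin n), ‖F (c s) - F a‖ ≤ B * ∑ i ∈ s, |b i - a i| := by
    intro s
    induction s using Finset.induction_on with
    | empty =>
      have : c ∅ = a := by ext i; simp [c]
      simp [this]
    | insert i s hi ih =>
      have h1 : c (insert i s) = c s + (b i - a i) • EuclideanSpace.single i 1 := by
        ext j
        by_cases hj : j = i
        · subst hj
          simp [c, hi]
        · simp [c, hj]
      have hmem : ∀ t ∈ uIcc 0 (b i - a i), ∀ j,
          (c s + t • EuclideanSpace.single i (1 : ℝ)) j ∈ uIcc (a j) (b j) := by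
        intro t ht j
        by_cases hj : j = i
        · subst hj
          have : (c s + t • EuclideanSpace.single j (1 : ℝ)) j = a j + t := by simp [c, hi]
          rw [this]
          rw [mem_uIcc] at ht ⊢
          rcases ht with ht | ht
          · left; constructor <;> linarith [ht.1, ht.2]
          · right; constructor <;> linarith [ht.1, ht.2]
        · have : (c s + t • EuclideanSpace.single i (1 : ℝ)) j = if j ∈ s then b j else a j := by
            simp [c, hj]
          rw [this]
          split_ifs
          · exact right_mem_uIcc
          · exact left_mem_uIcc
      have h2 := norm_sub_le_of_norm_lineDeriv_le (F := F) (p := c s)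
        (v := EuclideanSpace.single i 1) (s := b i - a i) (B := B)
        (fun t ht => hd _ (hmem t ht) i) (fun t ht => hB _ (hmem t ht) i)
      rw [← h1] at h2
      rw [Finset.sum_insert hi, mul_add]
      calc ‖F (c (insert i s)) - F a‖ = ‖(F (c (insert i s)) - F (c s)) + (F (c s) - F a)‖ := by
            rw [sub_add_sub_cancel]
        _ ≤ _ := (norm_add_le _ _).trans (add_le_add h2 ih)
  have h := key Finset.univ
  have h1 : c Finset.univ = b := by ext i; simp [c]
  rwa [h1] at h

end LineDeriv

section Path

variable {κ : ℕ}

theorem normX_nonneg (F : Space n₁ n₂ → ℂ) (x : Space n₁ n₂) : 0 ≤ normX κ F x :=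
  Real.sqrt_nonneg _

theorem norm_lineDeriv_fieldX_le (F : Space n₁ n₂ → ℂ) (x : Space n₁ n₂) (j : Fin n₁) :
    ‖lineDeriv ℝ F x (fieldX j x)‖ ≤ normX κ F x := by
  refine Real.le_sqrt_of_sq_le (le_add_of_le_of_nonneg ?_ (by positivity))
  exact Finset.single_le_sum (f := fun j => ‖lineDeriv ℝ F x (fieldX j x)‖ ^ 2)
    (fun i _ => by positivity) (Finset.mem_univ j)

theorem norm_lineDeriv_fieldXX_le (F : Space n₁ n₂ → ℂ) (x : Space n₁ n₂) {α : Fin n₁ → ℕ}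
    (hα : α ∈ multiIndices n₁ κ) (k : Fin n₂) :
    ‖lineDeriv ℝ F x (fieldXX α k x)‖ ≤ normX κ F x := by
  refine Real.le_sqrt_of_sq_le (le_add_of_nonneg_of_le (by positivity) ?_)
  refine le_trans ?_ (Finset.single_le_sum
    (f := fun α => ∑ k, ‖lineDeriv ℝ F x (fieldXX α k x)‖ ^ 2)
    (fun i _ => by positivity) hα)
  exact Finset.single_le_sum (f := fun k => ‖lineDeriv ℝ F x (fieldXX α k x)‖ ^ 2)
    (fun i _ => by positivity) (Finset.mem_univ k)

theorem single_mem_multiIndices (i : Fin n₁) : Pi.single i κ ∈ multiIndices n₁ κ := by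
  rw [multiIndices, Finset.mem_piAntidiag]
  simp

theorem fieldXX_single (i : Fin n₁) (k : Fin n₂) (x : Space n₁ n₂) :
    fieldXX (Pi.single i κ) k x = (x.1 i ^ κ) • ((0, EuclideanSpace.single k 1) : Space n₁ n₂) := by
  rw [fieldXX, Finset.prod_eq_single i]
  · simp
  · intro j _ hj
    simp [hj]
  · simp

/-- The line derivative in a direction of the second factor, off the singular set. -/
theorem lineDeriv_snd {F : Space n₁ n₂ → ℂ} (hF : XDifferentiable κ F) {x : Space n₁ n₂}
    {i : Fin n₁} (hi : x.1 i ≠ 0) (k : Fin n₂) :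
    LineDifferentiableAt ℝ F x (0, EuclideanSpace.single k 1) ∧
      ‖lineDeriv ℝ F x (0, EuclideanSpace.single k 1)‖ ≤ normX κ F x / |x.1 i| ^ κ := by
  have h1 := (hF x).2 _ (single_mem_multiIndices i) k
  have h2 := norm_lineDeriv_fieldXX_le F x (single_mem_multiIndices (κ := κ) i) k
  have hne : x.1 i ^ κ ≠ 0 := pow_ne_zero _ hi
  rw [fieldXX_single] at h1 h2
  constructor
  · have h3 := h1.smul (x.1 i ^ κ)⁻¹
    rwa [smul_smul, inv_mul_cancel₀ hne, one_smul] at h3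
  · rw [lineDeriv_smul, norm_smul, norm_pow, Real.norm_eq_abs] at h2
    rw [le_div_iff₀ (by positivity), mul_comm]
    exact h2

theorem norm_sub_le_fst {F : Space n₁ n₂ → ℂ} (hF : XDifferentiable κ F)
    {a b : EuclideanSpace ℝ (Fin n₁)} {q : EuclideanSpace ℝ (Fin n₂)} {B : ℝ}
    (hB : ∀ c : EuclideanSpace ℝ (Fin n₁), (∀ i, c i ∈ uIcc (a i) (b i)) →
      normX κ F (c, q) ≤ B) : ‖F (b, q) - F (a, q)‖ ≤ B * ∑ i, |b i - a i| := by
  have h1 : ∀ (c : EuclideanSpace ℝ (Fin n₁)) (i : Fin n₁),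
      (fun t : ℝ => F ((c, q) + t • fieldX i (c, q))) =
      fun t : ℝ => F (c + t • EuclideanSpace.single i 1, q) := by
    intro c i
    ext t
    simp [fieldX]
  refine norm_sub_le_of_norm_lineDeriv_single_le (F := fun c => F (c, q)) (fun c hc i => ?_)
    (fun c hc i => ?_)
  · have := (hF (c, q)).1 i
    unfold LineDifferentiableAt at this ⊢
    rwa [h1] at this
  · have := (norm_lineDeriv_fieldX_le (κ := κ) F (c, q) i).trans (hB c hc)
    unfold lineDeriv at this ⊢
    rwa [h1] at this

theorem norm_sub_le_snd {F : Space n₁ n₂ → ℂ} (hF : XDifferentiable κ F)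
    {p : EuclideanSpace ℝ (Fin n₁)} {i : Fin n₁} (hi : p i ≠ 0)
    {a b : EuclideanSpace ℝ (Fin n₂)} {B : ℝ}
    (hB : ∀ c : EuclideanSpace ℝ (Fin n₂), (∀ j, c j ∈ uIcc (a j) (b j)) →
      normX κ F (p, c) ≤ B) : ‖F (p, b) - F (p, a)‖ ≤ B / |p i| ^ κ * ∑ j, |b j - a j| := by
  have h1 : ∀ (c : EuclideanSpace ℝ (Fin n₂)) (k : Fin n₂),
      (fun t : ℝ => F ((p, c) + t • ((0, EuclideanSpace.single k 1) : Space n₁ n₂))) =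
      fun t : ℝ => F (p, c + t • EuclideanSpace.single k 1) := by
    intro c i
    ext t
    simp
  refine norm_sub_le_of_norm_lineDeriv_single_le (F := fun c => F (p, c)) (fun c hc k => ?_)
    (fun c hc k => ?_)
  · have := (lineDeriv_snd hF (x := (p, c)) hi k).1
    unfold LineDifferentiableAt at this ⊢
    rwa [h1] at this
  · have := (lineDeriv_snd hF (x := (p, c)) hi k).2
    unfold lineDeriv at this ⊢
    rw [h1] at this
    refine this.trans ?_
    gcongr
    exact hB c hc

variable (n₁ n₂ κ) in
/-- The points of a horizontal path from `y` to `w` have distance at most `pathConst * δ` from `y`,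
where `δ` is the distance from `y` to `w`. -/
def pathConst : ℝ := (1 + (n₂ * 2 ^ κ + 1) * 2 ^ κ) * n₁

variable (n₁ n₂ κ) in
/-- The ratio of the length of a horizontal path and the distance of its endpoints. -/
def lengthConst : ℝ := 1 + n₂ * (2 * n₁) ^ κ + 2 * n₁

/-- A path in three stages: away from the singular set in `x'`, then in `x''` along the fields
`X_{α,k}` with `α = κ e_{i₀}`, then in `x'` to the endpoint. After the first stage the coordinate
`i₀` is comparable to `|y'| + δ`, so the middle stage has length `O(δ)` with respect to the fields.
-/
theorem norm_sub_le_of_normX_le (hn : 1 ≤ n₁) {F : Space n₁ n₂ → ℂ} (hF : XDifferentiable κ F)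
    {y w : Space n₁ n₂} {δ B : ℝ} (hδ : 0 < δ) (hyw : dist κ y w ≤ δ)
    (hB : ∀ p, dist κ y p ≤ pathConst n₁ n₂ κ * δ → normX κ F p ≤ B) :
    ‖F w - F y‖ ≤ lengthConst n₁ n₂ κ * B * δ := by
  have hn' : (1 : ℝ) ≤ n₁ := by exact_mod_cast hn
  have hy0 := norm_nonneg y.1
  set Λ : ℝ := (2 * ‖y.1‖ + δ) ^ κ
  have hΛ : 0 ≤ Λ := by positivity
  have hBp : ∀ p : Space n₁ n₂, (∀ i, |y.1 i - p.1 i| ≤ δ) → (∀ j, |y.2 j - p.2 j| ≤ δ * Λ) →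
      normX κ F p ≤ B := by
    intro p h1 h2
    refine hB p ?_
    rw [pathConst, mul_assoc]
    refine dist_le_of_norm_le (by positivity) (le_add_of_nonneg_left (by positivity))
      (norm_le_mul_of_abs_le h1) ((norm_le_mul_of_abs_le h2).trans ?_)
    calc n₂ * (δ * Λ) ≤ n₂ * (δ * (2 * (‖y.1‖ + n₁ * δ)) ^ κ) := by
          simp only [Λ]
          gcongr
          nlinarith
      _ = n₂ * 2 ^ κ * (1 * δ) * (‖y.1‖ + n₁ * δ) ^ κ := by rw [mul_pow]; ring
      _ ≤ (n₂ * 2 ^ κ + 1) * (n₁ * δ) * (‖y.1‖ + n₁ * δ) ^ κ := by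
          gcongr
          linarith
  have hB0 : 0 ≤ B := (normX_nonneg F y).trans (hBp y (by simp [hδ.le]) (fun j => by rw [sub_self, abs_zero]; positivity))
  have hw1 : ∀ i, |y.1 i - w.1 i| ≤ δ := fun i =>
    (abs_apply_le_norm (y.1 - w.1) i).trans ((norm_fst_sub_le y w).trans hyw)
  have hw2 : ∀ j, |y.2 j - w.2 j| ≤ δ * Λ := fun j =>
    (abs_apply_le_norm (y.2 - w.2) j).trans (norm_snd_sub_le_of_dist_le hyw)
  obtain ⟨i₀, -, hi₀⟩ := Finset.exists_max_image Finset.univ (fun i => |y.1 i|) ⟨⟨0, hn⟩, by simp⟩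
  -- The largest coordinate of `y'` is moved by `δ` in the direction of its own sign, so its modulus
  -- grows by exactly `δ`, even when `y' = 0`.
  obtain ⟨σ, hσ1, hσ2⟩ : ∃ σ : ℝ, |σ| = δ ∧ |y.1 i₀ + σ| = |y.1 i₀| + δ := by
    rcases le_total 0 (y.1 i₀) with h | h
    · exact ⟨δ, abs_of_pos hδ, by rw [abs_of_nonneg h, abs_of_nonneg (by linarith)]⟩
    · exact ⟨-δ, by rw [abs_neg, abs_of_pos hδ], by
        rw [abs_of_nonpos h, abs_of_nonpos (by linarith)]; ring⟩
  set z : EuclideanSpace ℝ (Fin n₁) := y.1 + σ • EuclideanSpace.single i₀ 1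
  have hz0 : z i₀ = y.1 i₀ + σ := by simp [z]
  have hzi : ∀ i, |y.1 i - z i| ≤ δ ∧ |z i - y.1 i| = if i = i₀ then δ else 0 := by
    intro i
    by_cases hi : i = i₀
    · subst hi
      simp [hz0, hσ1]
    · simp [z, hi, hδ.le]
  have hyn : ‖y.1‖ ≤ n₁ * |y.1 i₀| := norm_le_mul_of_abs_le fun i => hi₀ i (Finset.mem_univ i)
  have hzn : ‖y.1‖ + δ ≤ n₁ * |z i₀| := by
    rw [hz0, hσ2]
    nlinarith
  have hz_pos : 0 < |z i₀| := by
    rw [hz0, hσ2]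
    positivity
  have hbox : ∀ {u v c r e : ℝ}, c ∈ uIcc u v → |r - u| ≤ e → |r - v| ≤ e → |r - c| ≤ e := by
    intro u v c r e hc h1 h2
    rw [abs_le] at h1 h2 ⊢
    rcases mem_uIcc.1 hc with hc | hc <;> constructor <;> linarith [hc.1, hc.2, h1.1, h1.2, h2.1, h2.2]
  have s1 : ‖F (z, y.2) - F (y.1, y.2)‖ ≤ B * δ := by
    have h := norm_sub_le_fst hF (a := y.1) (b := z) (q := y.2) (B := B) fun c hc =>
      hBp (c, y.2) (fun i => hbox (hc i) (by simp [hδ.le]) (hzi i).1) (fun j => by simp; positivity)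
    refine h.trans (mul_le_mul_of_nonneg_left ?_ hB0)
    simp_rw [fun i => (hzi i).2]
    simp
  have s2 : ‖F (z, w.2) - F (z, y.2)‖ ≤ B * (n₂ * (2 * n₁) ^ κ) * δ := by
    have h := norm_sub_le_snd hF (p := z) (i := i₀) (abs_pos.1 hz_pos) (a := y.2) (b := w.2)
      (B := B) fun c hc => hBp (z, c) (fun i => (hzi i).1) (fun j => hbox (hc j)
        (by simp; positivity) (hw2 j))
    refine h.trans ?_
    have h3 : ∑ j, |w.2 j - y.2 j| ≤ n₂ * (δ * Λ) := by
      refine (Finset.sum_le_sum fun j _ => (abs_sub_comm (w.2 j) (y.2 j)).le.trans (hw2 j)).trans ?_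
      simp
    have h4 : Λ ≤ (2 * n₁) ^ κ * |z i₀| ^ κ := by
      rw [← mul_pow]
      simp only [Λ]
      gcongr
      linarith
    calc B / |z i₀| ^ κ * ∑ j, |w.2 j - y.2 j|
        ≤ B / |z i₀| ^ κ * (n₂ * (δ * ((2 * n₁) ^ κ * |z i₀| ^ κ))) := by
          gcongr
          exact h3.trans (by gcongr)
      _ = _ := by field_simp
  have s3 : ‖F (w.1, w.2) - F (z, w.2)‖ ≤ B * (2 * n₁) * δ := by
    have h := norm_sub_le_fst hF (a := z) (b := w.1) (q := w.2) (B := B) fun c hc =>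
      hBp (c, w.2) (fun i => hbox (hc i) (hzi i).1 (hw1 i)) hw2
    refine h.trans ?_
    have h3 : ∑ i, |w.1 i - z i| ≤ n₁ * (2 * δ) := by
      refine (Finset.sum_le_sum (g := fun _ => 2 * δ) fun i _ => ?_).trans (by simp)
      have h5 := hw1 i
      have h6 := (hzi i).1
      rw [abs_le] at h5 h6 ⊢
      constructor <;> linarith [h5.1, h5.2, h6.1, h6.2]
    calc B * ∑ i, |w.1 i - z i| ≤ B * (n₁ * (2 * δ)) := by gcongr
      _ = _ := by ring
  calc ‖F w - F y‖ = ‖(F (w.1, w.2) - F (z, w.2)) + (F (z, w.2) - F (z, y.2)) +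
        (F (z, y.2) - F (y.1, y.2))‖ := by
        rw [sub_add_sub_cancel, sub_add_sub_cancel]
    _ ≤ B * (2 * n₁) * δ + B * (n₂ * (2 * n₁) ^ κ) * δ + B * δ :=
        norm_add₃_le.trans (add_le_add (add_le_add s3 s2) s1)
    _ = _ := by rw [lengthConst]; ring

end Path

end Grushin
end

noncomputable section
namespace Grushin
open Filter Topology
variable {n₁ n₂ : ℕ}

/-! ### Kernel estimates -/

section Kernel

variable {κ : ℕ}

theorem homDim_eq : homDim n₁ n₂ κ = ((n₁ + n₂ + κ * n₂ : ℕ) : ℝ) := by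
  rw [homDim]
  push_cast
  ring

theorem homDim_nonneg : 0 ≤ homDim n₁ n₂ κ := by
  rw [homDim_eq]
  exact Nat.cast_nonneg _

theorem weight_comm (j : ℕ) (r : ℝ) (x y : Space n₁ n₂) : weight κ j r x y = weight κ j r y x := by
  rw [weight, weight, dist_comm, mul_comm (ballVol κ x _ ^ _)]

theorem weight_eq (j : ℕ) (r : ℝ) (x y : Space n₁ n₂) :
    weight κ j r x y = weight κ j 0 x y * dist κ x y ^ r := by
  rw [weight, weight, Real.rpow_zero, mul_one]

theorem weight_nonneg (j : ℕ) (r : ℝ) (x y : Space n₁ n₂) : 0 ≤ weight κ j r x y := by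
  have := dist_nonneg (κ := κ) x y
  have h1 : 0 ≤ ballVol κ x (2 ^ (-(j : ℝ) / 2)) := measureReal_nonneg
  have h2 : 0 ≤ ballVol κ y (2 ^ (-(j : ℝ) / 2)) := measureReal_nonneg
  rw [weight]
  positivity

theorem le_rpow_half_mul_rpow_half {a b c : ℝ} (ha : 0 ≤ a) (hb : a ≤ b) (hc : a ≤ c) :
    a ≤ b ^ (1 / 2 : ℝ) * c ^ (1 / 2 : ℝ) := by
  have hb' : 0 ≤ b := ha.trans hb
  calc a = a ^ (1 / 2 : ℝ) * a ^ (1 / 2 : ℝ) := by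
        rw [← Real.sqrt_eq_rpow, Real.mul_self_sqrt ha]
    _ ≤ _ := by gcongr

theorem two_rpow_neg_half (j : ℕ) : (2 : ℝ) ^ (-(j : ℝ) / 2) = (2 ^ ((j : ℝ) / 2))⁻¹ := by
  rw [neg_div, Real.rpow_neg (by norm_num)]

variable (n₁ n₂ κ) in
/-- The product of the volumes of the balls at scale `2^{-j/2}` controls the volume at scale `D`. -/
theorem exists_modelVol_le_weight (hn : 1 ≤ n₁) {A : ℝ} (hA : 1 ≤ A) :
    ∃ C : ℝ, 0 < C ∧ ∀ (j : ℕ) (p q w : Space n₁ n₂) (D : ℝ), 0 < D →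
      ‖w.1‖ ≤ ‖p.1‖ + A * D → ‖w.1‖ ≤ ‖q.1‖ + A * D →
      (D * 2 ^ ((j : ℝ) / 2) ≤ 1 →
        modelVol κ w D ≤ C * (D * 2 ^ ((j : ℝ) / 2)) * weight κ j 0 p q) ∧
      (1 ≤ D * 2 ^ ((j : ℝ) / 2) →
        modelVol κ w D ≤
          C * (D * 2 ^ ((j : ℝ) / 2)) ^ (n₁ + n₂ + κ * n₂) * weight κ j 0 p q) := by
  obtain ⟨c, hc, hcV⟩ := exists_mul_modelVol_le_ballVol n₁ n₂ κ
  refine ⟨(2 * A) ^ (n₁ + n₂ + κ * n₂) / c, by positivity, fun j p q w D hD hp hq => ?_⟩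
  set t : ℝ := 2 ^ ((j : ℝ) / 2)
  have ht : 0 < t := by positivity
  set u := D * t
  have hu : 0 < u := by positivity
  have hDt : D = u * t⁻¹ := by simp only [u]; field_simp
  have hw := norm_nonneg w.1
  -- A common lower bound for the two ball volumes bounds their geometric mean, which is the weight
  -- of order zero.
  have key : ∀ e : ℝ, 0 < e → (∀ p : Space n₁ n₂, ‖w.1‖ ≤ ‖p.1‖ + A * D →
      modelVol κ w D ≤ (2 * A) ^ (n₁ + n₂ + κ * n₂) * e * modelVol κ p t⁻¹) →
      modelVol κ w D ≤ (2 * A) ^ (n₁ + n₂ + κ * n₂) / c * e * weight κ j 0 p q := by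
    intro e he h
    set a := c * (modelVol κ w D / ((2 * A) ^ (n₁ + n₂ + κ * n₂) * e))
    have ha : 0 ≤ a := by
      have := modelVol_pos (κ := κ) w hD
      positivity
    have hle : ∀ p : Space n₁ n₂, ‖w.1‖ ≤ ‖p.1‖ + A * D → a ≤ ballVol κ p t⁻¹ := by
      intro p hp
      refine le_trans ?_ (hcV p t⁻¹ (by positivity))
      refine mul_le_mul_of_nonneg_left ?_ hc.le
      rw [div_le_iff₀ (by positivity), mul_comm]
      exact h p hp
    have h1 : a ≤ weight κ j 0 p q := by
      rw [weight, Real.rpow_zero, mul_one, two_rpow_neg_half]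
      exact le_rpow_half_mul_rpow_half ha (hle p hp) (hle q hq)
    calc modelVol κ w D = (2 * A) ^ (n₁ + n₂ + κ * n₂) / c * e * a := by
          simp only [a]; field_simp
      _ ≤ _ := by gcongr
  refine ⟨fun h1 => key u hu fun p hp => ?_, fun h1 => key _ (by positivity) fun p hp => ?_⟩
  · have h2 : D ≤ t⁻¹ := by
      rw [hDt]
      exact mul_le_of_le_one_left (by positivity) h1
    have hp0 := norm_nonneg p.1
    -- One power of `u` is enough to sum over the scales with `u ≤ 1`.
    have h3 : u ^ (n₁ + n₂) ≤ u := pow_le_of_le_one hu.le h1 (by omega)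
    have h4 : ‖w.1‖ + D ≤ 2 * A * (‖p.1‖ + t⁻¹) := by
      have : A * D ≤ A * t⁻¹ := by gcongr
      nlinarith
    have h5 : 1 ≤ (2 * A) ^ (n₁ + n₂) := one_le_pow₀ (by linarith)
    calc modelVol κ w D = D ^ (n₁ + n₂) * (‖w.1‖ + D) ^ (κ * n₂) := rfl
      _ ≤ (u * t⁻¹) ^ (n₁ + n₂) * (2 * A * (‖p.1‖ + t⁻¹)) ^ (κ * n₂) := by
          rw [← hDt]
          gcongr
      _ = 1 * (u ^ (n₁ + n₂) * (2 * A) ^ (κ * n₂) * modelVol κ p t⁻¹) := by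
          rw [modelVol, mul_pow, mul_pow (2 * A)]; ring
      _ ≤ (2 * A) ^ (n₁ + n₂) * (u * (2 * A) ^ (κ * n₂) * modelVol κ p t⁻¹) := by
          have := modelVol_pos (κ := κ) p (inv_pos.2 ht)
          gcongr
      _ = _ := by rw [pow_add (2 * A) (n₁ + n₂)]; ring
  · have h2 : D ≤ A * u * t⁻¹ := by
      rw [mul_assoc, ← hDt]
      exact le_mul_of_one_le_left hD.le hA
    have h3 := modelVol_le (κ := κ) (a := A * u) w p hD.le (inv_pos.2 ht).le h2
      (by rwa [mul_assoc, ← hDt]) (by nlinarith)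
    calc modelVol κ w D ≤ _ := h3
      _ = _ := by rw [← mul_assoc, mul_pow]

-- With `u = D 2^{j/2}`: for `u ≤ 1` the order zero bound is used. For `u ≥ 1` the factor `d^{r₀}`
-- contributes `u^{-r₀}` against the volume ratio `u^Q`.
variable (n₁ n₂ κ) in
theorem exists_modelVol_mul_le (hn : 1 ≤ n₁) {A : ℝ} (hA : 1 ≤ A) {c₀ : ℝ} (hc₀ : 0 < c₀) {r₀ : ℝ}
    (hr₀ : 0 ≤ r₀) :
    ∃ C : ℝ, 0 < C ∧ ∀ (j : ℕ) (p q w : Space n₁ n₂) (D N E : ℝ), 0 < D → c₀ * D ≤ dist κ p q →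
      ‖w.1‖ ≤ ‖p.1‖ + A * D → ‖w.1‖ ≤ ‖q.1‖ + A * D → 0 ≤ N →
      (weight κ j 0 p q * N ≤ E → D * 2 ^ ((j : ℝ) / 2) ≤ 1 →
        modelVol κ w D * N ≤ C * E * (D * 2 ^ ((j : ℝ) / 2))) ∧
      (weight κ j r₀ p q * N ≤ E * 2 ^ (-(j * r₀) / 2) → 1 ≤ D * 2 ^ ((j : ℝ) / 2) →
        modelVol κ w D * N ≤ C * E * (D * 2 ^ ((j : ℝ) / 2)) ^ (homDim n₁ n₂ κ - r₀)) := by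
  obtain ⟨C, hC, h⟩ := exists_modelVol_le_weight n₁ n₂ κ hn hA
  refine ⟨C * (1 + (c₀ ^ r₀)⁻¹), by positivity, fun j p q w D N E hD hd hp hq hN => ?_⟩
  obtain ⟨ha, hb⟩ := h j p q w D hD hp hq
  set t : ℝ := 2 ^ ((j : ℝ) / 2)
  have ht : 0 < t := by positivity
  set u := D * t
  have hu : 0 < u := by positivity
  have hS := weight_nonneg (κ := κ) j 0 p q
  set S := weight κ j 0 p q
  have hc₀' : 0 < (c₀ ^ r₀)⁻¹ := by positivity
  constructor
  · intro h1 h2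
    have hE : 0 ≤ E := (mul_nonneg hS hN).trans h1
    calc modelVol κ w D * N ≤ C * u * S * N := by gcongr; exact ha h2
      _ = C * u * (S * N) := by ring
      _ ≤ C * u * E := by gcongr
      _ = C * 1 * E * u := by ring
      _ ≤ _ := by gcongr; linarith
  · intro h1 h2
    have hE : 0 ≤ E := by
      have h3 := (mul_nonneg (weight_nonneg (κ := κ) j r₀ p q) hN).trans h1
      exact nonneg_of_mul_nonneg_left h3 (by positivity)
    rw [weight_eq] at h1
    have ht' : (2 : ℝ) ^ (-(j * r₀) / 2) = (t ^ r₀)⁻¹ := by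
      rw [← Real.rpow_mul (by norm_num), ← Real.rpow_neg (by norm_num)]
      congr 1
      ring
    rw [ht'] at h1
    have h3 : S * N ≤ E * (c₀ ^ r₀)⁻¹ * u ^ (-r₀) := by
      have h4 : (c₀ * D) ^ r₀ ≤ dist κ p q ^ r₀ := Real.rpow_le_rpow (by positivity) hd hr₀
      have h5 : S * (c₀ * D) ^ r₀ * N ≤ E * (t ^ r₀)⁻¹ := le_trans (by gcongr) h1
      rw [Real.mul_rpow hc₀.le hD.le] at h5
      rw [Real.rpow_neg hu.le, Real.mul_rpow hD.le ht.le]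
      have hDr : 0 < D ^ r₀ := by positivity
      have htr : 0 < t ^ r₀ := by positivity
      have hcr : 0 < c₀ ^ r₀ := by positivity
      rw [← div_eq_mul_inv, le_div_iff₀ htr] at h5
      rw [← div_eq_mul_inv, ← div_eq_mul_inv, le_div_iff₀ (by positivity), le_div_iff₀ hcr]
      calc _ = S * (c₀ ^ r₀ * D ^ r₀) * N * t ^ r₀ := by ring
        _ ≤ E := h5
    calc modelVol κ w D * N ≤ C * u ^ (n₁ + n₂ + κ * n₂) * S * N := by gcongr; exact hb h2
      _ = C * u ^ (n₁ + n₂ + κ * n₂) * (S * N) := by ring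
      _ ≤ C * u ^ (n₁ + n₂ + κ * n₂) * (E * (c₀ ^ r₀)⁻¹ * u ^ (-r₀)) := by gcongr
      _ = C * (c₀ ^ r₀)⁻¹ * E * u ^ (homDim n₁ n₂ κ - r₀) := by
          rw [sub_eq_add_neg, Real.rpow_add hu, homDim_eq, Real.rpow_natCast]
          ring
      _ ≤ _ := by gcongr; linarith

/-- Kernel bounds at a single pair of points, for the orders that are used. -/
def SizeBound (κ j : ℕ) (p q : Space n₁ n₂) (r₀ N E : ℝ) : Prop :=
  weight κ j 0 p q * N ≤ E ∧ weight κ j r₀ p q * N ≤ E * 2 ^ (-(j * r₀) / 2)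

theorem SizeBound.comm {j : ℕ} {p q : Space n₁ n₂} {r₀ N E : ℝ} (h : SizeBound κ j p q r₀ N E) :
    SizeBound κ j q p r₀ N E := by
  rwa [SizeBound, weight_comm j 0, weight_comm j r₀]

theorem SizeBound.nonneg {j : ℕ} {p q : Space n₁ n₂} {r₀ N E : ℝ} (h : SizeBound κ j p q r₀ N E)
    (hN : 0 ≤ N) : 0 ≤ E :=
  (mul_nonneg (weight_nonneg j 0 p q) hN).trans h.1

-- The order `Q + 1/2` leaves `u^{-1/2}`. Writing `u = g ^ 8` keeps all exponents in the later
-- interpolation natural numbers.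
variable (n₁ n₂ κ) in
theorem exists_size_le (hn : 1 ≤ n₁) {A : ℝ} (hA : 1 ≤ A) {c₀ : ℝ} (hc₀ : 0 < c₀) :
    ∃ C : ℝ, 0 < C ∧ ∀ (j : ℕ) (p q w : Space n₁ n₂) (D N E g : ℝ), 0 < D → 0 < g →
      g ^ 8 = D * 2 ^ ((j : ℝ) / 2) → c₀ * D ≤ dist κ p q →
      ‖w.1‖ ≤ ‖p.1‖ + A * D → ‖w.1‖ ≤ ‖q.1‖ + A * D → 0 ≤ N →
      SizeBound κ j p q (homDim n₁ n₂ κ + 1 / 2) N E → 1 ≤ g →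
        modelVol κ w D * N ≤ C * E * (g ^ 4)⁻¹ := by
  obtain ⟨C, hC, h⟩ := exists_modelVol_mul_le n₁ n₂ κ hn hA hc₀ (r₀ := homDim n₁ n₂ κ + 1 / 2)
    (by linarith [homDim_nonneg (n₁ := n₁) (n₂ := n₂) (κ := κ)])
  refine ⟨C, hC, fun j p q w D N E g hD hg hgu hd hp hq hN hK hg1 => ?_⟩
  have h1 := (h j p q w D N E hD hd hp hq hN).2 hK.2 (by
    rw [← hgu]
    exact one_le_pow₀ hg1)
  refine h1.trans (le_of_eq ?_)
  congr 1
  rw [← hgu, sub_add_cancel_left, Real.rpow_neg (by positivity), ← Real.sqrt_eq_rpow,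
    show g ^ 8 = (g ^ 4) ^ 2 by ring, Real.sqrt_sq (by positivity)]

-- At order `Q` the powers of `u` cancel for `u ≥ 1`. The gradient bound then holds at all scales
-- without decay.
variable (n₁ n₂ κ) in
theorem exists_grad_le (hn : 1 ≤ n₁) {A : ℝ} (hA : 1 ≤ A) {c₀ : ℝ} (hc₀ : 0 < c₀) :
    ∃ C : ℝ, 0 < C ∧ ∀ (j : ℕ) (p q w : Space n₁ n₂) (D N E : ℝ), 0 < D → c₀ * D ≤ dist κ p q →
      ‖w.1‖ ≤ ‖p.1‖ + A * D → ‖w.1‖ ≤ ‖q.1‖ + A * D → 0 ≤ N →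
      SizeBound κ j p q (homDim n₁ n₂ κ) N E → modelVol κ w D * N ≤ C * E := by
  obtain ⟨C, hC, h⟩ := exists_modelVol_mul_le n₁ n₂ κ hn hA hc₀
    (homDim_nonneg (n₁ := n₁) (n₂ := n₂) (κ := κ))
  refine ⟨C, hC, fun j p q w D N E hD hd hp hq hN hK => ?_⟩
  obtain ⟨h1, h2⟩ := h j p q w D N E hD hd hp hq hN
  have hE := hK.nonneg hN
  rcases le_total (D * 2 ^ ((j : ℝ) / 2)) 1 with hu | hu
  · exact (h1 hK.1 hu).trans (mul_le_of_le_one_right (by positivity) hu)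
  · simpa using h2 hK.2 hu

theorem one_le_pathConst (hn : 1 ≤ n₁) : 1 ≤ pathConst n₁ n₂ κ := by
  have h1 : (1 : ℝ) ≤ n₁ := by exact_mod_cast hn
  rw [pathConst]
  exact one_le_mul_of_one_le_of_one_le (le_add_of_nonneg_right (by positivity)) h1

/-- The modulus of continuity of a kernel that satisfies the size and gradient bounds. -/
theorem exists_sub_le (hn : 1 ≤ n₁) {A : ℝ} (hA : 1 ≤ A) {C₁ : ℝ} (hC₁ : 0 < C₁) :
    ∃ C : ℝ, 0 < C ∧ ∀ (j : ℕ) (F : Space n₁ n₂ → ℂ) (y ξ z : Space n₁ n₂) (r h g E : ℝ),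
      XDifferentiable κ F → 0 < r → 0 < h → h ≤ 1 → 0 < g → g ^ 8 = r * 2 ^ ((j : ℝ) / 2) →
      dist κ ξ z ≤ C₁ * h ^ 4 * r →
      2 * quasiConst κ * (pathConst n₁ n₂ κ * (C₁ * h ^ 4 * r)) ≤ dist κ ξ y →
      r ≤ dist κ ξ y → dist κ ξ y ≤ A * r →
      (∀ p, SizeBound κ j p y (homDim n₁ n₂ κ + 1 / 2) ‖F p‖ E) →
      (∀ p, dist κ ξ p ≤ pathConst n₁ n₂ κ * (C₁ * h ^ 4 * r) →
        SizeBound κ j p y (homDim n₁ n₂ κ) (normX κ F p) (E * 2 ^ ((j : ℝ) / 2))) →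
      modelVol κ ξ r * ‖F ξ - F z‖ ≤ C * E * h * min g g⁻¹ := by
  have hq := one_le_quasiConst (κ := κ)
  set q := quasiConst κ
  have hP := one_le_pathConst (n₂ := n₂) (κ := κ) hn
  set P := pathConst n₁ n₂ κ
  obtain ⟨Cs, hCs, hsize⟩ := exists_size_le n₁ n₂ κ hn hA (c₀ := 1 / (2 * q)) (by positivity)
  obtain ⟨Cg, hCg, hgrad⟩ := exists_grad_le n₁ n₂ κ hn hA (c₀ := 1 / (2 * q)) (by positivity)
  have hL : 0 < lengthConst n₁ n₂ κ := by rw [lengthConst]; positivity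
  set L := lengthConst n₁ n₂ κ
  refine ⟨2 * Cs + L * Cg * C₁, by positivity, ?_⟩
  intro j F y ξ z r h g E hF hr hh hh1 hg hgu hξz hsep hry hyA hS hG
  have hE : 0 ≤ E := (hS ξ).nonneg (norm_nonneg _)
  set δ := C₁ * h ^ 4 * r
  have hδ : 0 < δ := by positivity
  have hV : 0 < modelVol κ ξ r := modelVol_pos ξ hr
  have hPδ : P * δ ≤ A * r := by
    have : 1 * (P * δ) ≤ 2 * q * (P * δ) := by gcongr; linarith
    linarith
  -- By the separation hypothesis and the quasi-triangle inequality, every point the path can reach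
  -- stays at distance at least `r / (2 q)` from `y`.
  have hfar : ∀ p, dist κ ξ p ≤ P * δ → 1 / (2 * q) * r ≤ dist κ p y := by
    intro p hp
    have h1 := dist_triangle (y := p) (z := y) (s := dist κ p y)
      (by have := dist_nonneg (κ := κ) p y; positivity) hp le_rfl
    rw [one_div_mul_eq_div, div_le_iff₀ (by positivity)]
    change _ ≤ q * (P * δ + dist κ p y) at h1
    linarith
  have hn1 : ∀ p, dist κ ξ p ≤ P * δ → ‖ξ.1‖ ≤ ‖p.1‖ + A * r := by
    intro p hp
    rw [dist_comm] at hp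
    exact (norm_fst_le_add_dist (κ := κ) p ξ).trans (by linarith)
  have hn2 : ‖ξ.1‖ ≤ ‖y.1‖ + A * r := by
    rw [dist_comm] at hyA
    exact (norm_fst_le_add_dist (κ := κ) y ξ).trans (by linarith)
  have hξ : dist κ ξ z ≤ P * δ := hξz.trans (le_mul_of_one_le_left hδ.le hP)
  have hξξ : dist κ ξ ξ ≤ P * δ := by
    have h1 := distSnd_le_rpow (κ := κ) ξ ξ
    rw [sub_self, norm_zero, Real.zero_rpow (by positivity)] at h1
    rw [dist_eq, sub_self, norm_zero, zero_add]
    exact h1.trans (by positivity)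
  have hsub : modelVol κ ξ r * ‖F ξ - F z‖ ≤ L * Cg * C₁ * E * (h ^ 4 * g ^ 8) := by
    have h1 := norm_sub_le_of_normX_le hn hF (B := Cg * (E * 2 ^ ((j : ℝ) / 2)) / modelVol κ ξ r)
      hδ hξz fun p hp => by
        rw [le_div_iff₀ hV, mul_comm]
        exact hgrad j p y ξ r _ _ hr (hfar p hp) (hn1 p hp) hn2 (normX_nonneg F p) (hG p hp)
    rw [norm_sub_rev]
    calc modelVol κ ξ r * ‖F z - F ξ‖
        ≤ modelVol κ ξ r * (L * (Cg * (E * 2 ^ ((j : ℝ) / 2)) / modelVol κ ξ r) * δ) := by gcongr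
      _ = L * Cg * C₁ * E * (h ^ 4 * (r * 2 ^ ((j : ℝ) / 2))) := by
          simp only [δ]; field_simp
      _ = _ := by rw [hgu]
  have hK1 : 0 ≤ L * Cg * C₁ * E := by positivity
  have hK2 : 0 ≤ Cs * E := by positivity
  -- The mean value bound gives `h ^ 4 g ^ 8` and, for `g ≥ 1`, the size bound gives `g ^ (-4)`. For
  -- `g ≤ 1` the former is at most `h g`. For `g ≥ 1` the former is at most `h / g` if `h g ^ 3 ≤
  -- 1`, and the latter is at most `h / g` otherwise.
  rcases le_total g 1 with hg1 | hg1
  · rw [min_eq_left (hg1.trans ((one_le_inv₀ hg).2 hg1))]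
    have h1 : h ^ 4 * g ^ 8 ≤ h * g :=
      mul_le_mul (pow_le_of_le_one hh.le hh1 (by norm_num)) (pow_le_of_le_one hg.le hg1 (by norm_num))
        (by positivity) hh.le
    calc _ ≤ _ := hsub
      _ ≤ L * Cg * C₁ * E * (h * g) := by gcongr
      _ ≤ _ := by nlinarith [mul_nonneg hK2 (mul_pos hh hg).le]
  · rw [min_eq_right ((inv_le_one_of_one_le₀ hg1).trans hg1)]
    rcases le_total (h * g ^ 3) 1 with h1 | h1
    · have h2 : h ^ 4 * g ^ 8 ≤ h * g⁻¹ := by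
        rw [← div_eq_mul_inv, le_div_iff₀ hg]
        calc h ^ 4 * g ^ 8 * g = h * (h * g ^ 3) ^ 3 := by ring
          _ ≤ h * 1 := by
              gcongr
              exact pow_le_one₀ (by positivity) h1
          _ = h := mul_one h
      calc _ ≤ _ := hsub
        _ ≤ L * Cg * C₁ * E * (h * g⁻¹) := by gcongr
        _ ≤ _ := by nlinarith [mul_nonneg hK2 (mul_pos hh (inv_pos.2 hg)).le]
    · have h2 : (g ^ 4)⁻¹ ≤ h * g⁻¹ := by
        rw [← div_eq_mul_inv, le_div_iff₀ hg, inv_mul_le_iff₀ (by positivity)]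
        calc g = 1 * g := (one_mul g).symm
          _ ≤ h * g ^ 3 * g := by gcongr
          _ = _ := by ring
      have h3 := hsize j ξ y ξ r _ E g hr hg hgu (hfar ξ hξξ) (hn1 ξ hξξ) hn2 (norm_nonneg _)
        (hS ξ) hg1
      have h4 := hsize j z y ξ r _ E g hr hg hgu (hfar z hξ) (hn1 z hξ) hn2 (norm_nonneg _)
        (hS z) hg1
      calc modelVol κ ξ r * ‖F ξ - F z‖ ≤ modelVol κ ξ r * (‖F ξ‖ + ‖F z‖) := by
            gcongr
            exact norm_sub_le _ _
        _ ≤ 2 * (Cs * E * (g ^ 4)⁻¹) := by linarith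
        _ ≤ 2 * (Cs * E * (h * g⁻¹)) := by gcongr
        _ ≤ _ := by nlinarith [mul_nonneg hK1 (mul_pos hh (inv_pos.2 hg)).le]

/-! ### Summation over the dyadic scales -/

/-- Along a geometric progression `min a a⁻¹` is dominated by the increments of the bounded function
`-1 / (1 + a)`. The sum telescopes, with a bound independent of the starting point. -/
theorem min_inv_le {a q : ℝ} (ha : 0 < a) (hq : 1 < q) :
    min a a⁻¹ ≤ 4 * q / (q - 1) * ((1 + a)⁻¹ - (1 + a * q)⁻¹) := by
  have hq1 : 0 < q - 1 := by linarith
  have h1 : 4 * q / (q - 1) * ((1 + a)⁻¹ - (1 + a * q)⁻¹) =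
      4 * q * a / ((1 + a) * (1 + a * q)) := by
    have : 1 + a * q ≠ 0 := by positivity
    have : 1 + a ≠ 0 := by positivity
    field_simp
    ring
  rw [h1, le_div_iff₀ (by positivity)]
  rcases le_total a 1 with h | h
  · rw [min_eq_left (h.trans ((one_le_inv₀ ha).2 h))]
    have : (1 + a) * (1 + a * q) ≤ 2 * (2 * q) := by
      gcongr <;> nlinarith
    nlinarith
  · rw [min_eq_right ((inv_le_one_of_one_le₀ h).trans h), inv_mul_le_iff₀ ha]
    have h2 : 1 + a * q ≤ 2 * (a * q) := by nlinarith
    have h3 : 1 + a ≤ 2 * a := by linarith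
    have : (1 + a) * (1 + a * q) ≤ (2 * a) * (2 * (a * q)) := by gcongr
    nlinarith

theorem sum_min_inv_le {a q : ℝ} (ha : 0 < a) (hq : 1 < q) (J : ℕ) :
    ∑ j ∈ Finset.range J, min (a * q ^ j) (a * q ^ j)⁻¹ ≤ 4 * q / (q - 1) := by
  have hq1 : 0 < q - 1 := by linarith
  have hq0 : 0 < q := by linarith
  have h : ∀ J, ∑ j ∈ Finset.range J, min (a * q ^ j) (a * q ^ j)⁻¹ ≤
      4 * q / (q - 1) * ((1 + a)⁻¹ - (1 + a * q ^ J)⁻¹) := by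
    intro J
    induction J with
    | zero => simp
    | succ J ih =>
      rw [Finset.sum_range_succ]
      have := min_inv_le (a := a * q ^ J) (by positivity) hq
      rw [mul_assoc, ← pow_succ] at this
      rw [mul_sub] at this ih ⊢
      linarith
  refine (h J).trans (mul_le_of_le_one_right (by positivity) ?_)
  have h1 : (1 + a)⁻¹ ≤ 1 := inv_le_one_of_one_le₀ (by linarith)
  have h2 : 0 < (1 + a * q ^ J)⁻¹ := by positivity
  linarith

theorem sum_inv_pow_le {q : ℝ} (hq : 1 < q) (J : ℕ) :
    ∑ j ∈ Finset.range J, (q ^ j)⁻¹ ≤ q / (q - 1) := by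
  have hq1 : 0 < q - 1 := by linarith
  have hq0 : 0 < q := by linarith
  have h : ∀ J, ∑ j ∈ Finset.range J, (q ^ j)⁻¹ ≤ q / (q - 1) * (1 - (q ^ J)⁻¹) := by
    intro J
    induction J with
    | zero => simp
    | succ J ih =>
      rw [Finset.sum_range_succ]
      refine (add_le_add_left ih _).trans (le_of_eq ?_)
      field_simp
      ring
  refine (h J).trans (mul_le_of_le_one_right (by positivity) ?_)
  have h2 : 0 < (q ^ J)⁻¹ := by positivity
  linarith

end Kernel

end Grushin
end

noncomputable section
namespace Grushin
open Filter Topology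
variable {n₁ n₂ : ℕ}

/-! ### The modulus of continuity of the sum of the kernels -/

section Sums

variable {κ : ℕ}

theorem one_lt_two_rpow {a : ℝ} (ha : 0 < a) : (1 : ℝ) < 2 ^ a := Real.one_lt_rpow (by norm_num) ha

theorem scale_pow_eight {r : ℝ} (hr : 0 < r) (j : ℕ) :
    (r ^ (1 / 8 : ℝ) * (2 ^ (1 / 16 : ℝ)) ^ j) ^ 8 = r * 2 ^ ((j : ℝ) / 2) := by
  rw [mul_pow, ← Real.rpow_natCast (r ^ (1 / 8 : ℝ)), ← Real.rpow_mul hr.le, ← pow_mul,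
    ← Real.rpow_natCast (2 ^ (1 / 16 : ℝ)), ← Real.rpow_mul (by norm_num)]
  congr 1
  · norm_num
  · congr 1
    push_cast
    ring

/-- Here `g = r^{1/8} 2^{j/16}` runs through a geometric progression, so the sum over `j` is bounded
independently of `r` and `J`. -/
theorem exists_sum_sub_le (hn : 1 ≤ n₁) {A : ℝ} (hA : 1 ≤ A) {C₁ : ℝ} (hC₁ : 0 < C₁) :
    ∃ C : ℝ, 0 < C ∧ ∀ (F : ℕ → Space n₁ n₂ → ℂ) (y ξ z : Space n₁ n₂) (r h E : ℝ) (J : ℕ),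
      (∀ j, XDifferentiable κ (F j)) → 0 < r → 0 < h → h ≤ 1 →
      dist κ ξ z ≤ C₁ * h ^ 4 * r →
      2 * quasiConst κ * (pathConst n₁ n₂ κ * (C₁ * h ^ 4 * r)) ≤ dist κ ξ y →
      r ≤ dist κ ξ y → dist κ ξ y ≤ A * r →
      (∀ j p, SizeBound κ j p y (homDim n₁ n₂ κ + 1 / 2) ‖F j p‖ E) →
      (∀ j p, dist κ ξ p ≤ pathConst n₁ n₂ κ * (C₁ * h ^ 4 * r) →
        SizeBound κ j p y (homDim n₁ n₂ κ) (normX κ (F j) p) (E * 2 ^ ((j : ℝ) / 2))) →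
      modelVol κ ξ r * ∑ j ∈ Finset.range J, ‖F j ξ - F j z‖ ≤ C * E * h := by
  obtain ⟨C, hC, hsub⟩ := exists_sub_le (n₂ := n₂) (κ := κ) hn hA hC₁
  have hb := one_lt_two_rpow (by norm_num : (0 : ℝ) < 1 / 16)
  set b : ℝ := 2 ^ (1 / 16 : ℝ)
  have hb1 : 0 < b - 1 := by linarith
  refine ⟨C * (4 * b / (b - 1)), by positivity, ?_⟩
  intro F y ξ z r h E J hF hr hh hh1 hξz hsep hry hyA hS hG
  have hE : 0 ≤ E := (hS 0 ξ).nonneg (norm_nonneg _)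
  have ha : 0 < r ^ (1 / 8 : ℝ) := by positivity
  rw [Finset.mul_sum]
  calc ∑ j ∈ Finset.range J, modelVol κ ξ r * ‖F j ξ - F j z‖
      ≤ ∑ j ∈ Finset.range J, C * E * h *
        min (r ^ (1 / 8 : ℝ) * b ^ j) (r ^ (1 / 8 : ℝ) * b ^ j)⁻¹ :=
        Finset.sum_le_sum fun j _ => hsub j (F j) y ξ z r h _ E (hF j) hr hh hh1 (by positivity)
          (scale_pow_eight hr j) hξz hsep hry hyA (hS j) (hG j)
    _ ≤ C * E * h * (4 * b / (b - 1)) := by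
        rw [← Finset.mul_sum]
        gcongr
        exact sum_min_inv_le ha hb J
    _ = _ := by ring

/-- For `r ≥ 1` every `j ≥ 0` is in the range `g ≥ 1`. The decay `g ^ (-4)` is then summable without
any gradient bound, and leaves `r^{-1/2}`. -/
theorem exists_sum_size_le (hn : 1 ≤ n₁) {A : ℝ} (hA : 1 ≤ A) {c₀ : ℝ} (hc₀ : 0 < c₀) :
    ∃ C : ℝ, 0 < C ∧ ∀ (F : ℕ → ℂ) (y ξ p : Space n₁ n₂) (r E : ℝ) (J : ℕ), 1 ≤ r →
      c₀ * r ≤ dist κ p y → ‖ξ.1‖ ≤ ‖p.1‖ + A * r → ‖ξ.1‖ ≤ ‖y.1‖ + A * r →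
      (∀ j, SizeBound κ j p y (homDim n₁ n₂ κ + 1 / 2) ‖F j‖ E) →
      modelVol κ ξ r * ∑ j ∈ Finset.range J, ‖F j‖ ≤ C * E * (r ^ (1 / 2 : ℝ))⁻¹ := by
  obtain ⟨C, hC, hsize⟩ := exists_size_le n₁ n₂ κ hn hA hc₀
  have hb := one_lt_two_rpow (by norm_num : (0 : ℝ) < 1 / 16)
  set b : ℝ := 2 ^ (1 / 16 : ℝ)
  have hb4 : 1 < b ^ 4 := one_lt_pow₀ hb (by norm_num)
  have hb1 : 0 < b ^ 4 - 1 := by linarith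
  refine ⟨C * (b ^ 4 / (b ^ 4 - 1)), by positivity, ?_⟩
  intro F y ξ p r E J hr hd hp hy hS
  have hE : 0 ≤ E := (hS 0).nonneg (norm_nonneg _)
  have hr0 : 0 < r := by linarith
  have ha : 1 ≤ r ^ (1 / 8 : ℝ) := Real.one_le_rpow hr (by norm_num)
  have hrr : (r ^ (1 / 8 : ℝ)) ^ 4 = r ^ (1 / 2 : ℝ) := by
    rw [← Real.rpow_natCast, ← Real.rpow_mul hr0.le]
    norm_num
  rw [Finset.mul_sum]
  calc ∑ j ∈ Finset.range J, modelVol κ ξ r * ‖F j‖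
      ≤ ∑ j ∈ Finset.range J, C * E * ((r ^ (1 / 8 : ℝ) * b ^ j) ^ 4)⁻¹ :=
        Finset.sum_le_sum fun j _ => hsize j p y ξ r _ E _ hr0 (by positivity)
          (scale_pow_eight hr0 j) hd hp hy (norm_nonneg _) (hS j)
          (one_le_mul_of_one_le_of_one_le ha (one_le_pow₀ hb.le))
    _ = C * E * (r ^ (1 / 2 : ℝ))⁻¹ * ∑ j ∈ Finset.range J, ((b ^ 4) ^ j)⁻¹ := by
        rw [Finset.mul_sum]
        refine Finset.sum_congr rfl fun j _ => ?_
        rw [mul_pow, mul_inv, hrr, ← pow_mul, ← pow_mul, mul_comm j 4]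
        ring
    _ ≤ C * E * (r ^ (1 / 2 : ℝ))⁻¹ * (b ^ 4 / (b ^ 4 - 1)) := by
        gcongr
        exact sum_inv_pow_le hb4 J
    _ = _ := by ring

theorem SizeBound.mono {j : ℕ} {p q : Space n₁ n₂} {r₀ N E E' : ℝ} (h : SizeBound κ j p q r₀ N E)
    (hE : E ≤ E') : SizeBound κ j p q r₀ N E' :=
  ⟨h.1.trans hE, h.2.trans (by gcongr)⟩

theorem KernelSup.sizeBound {K : ℕ → Space n₁ n₂ → Space n₁ n₂ → ℂ} {R₀ r₀ : ℝ}
    (h : KernelSup κ K R₀) (h0 : 0 ≤ r₀) (hr : r₀ ≤ R₀) :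
    ∃ E, ∀ j x y, SizeBound κ j x y r₀ ‖K j x y‖ E := by
  obtain ⟨C, hC⟩ := h
  refine ⟨C, fun j x y => ⟨?_, hC r₀ ⟨h0, hr⟩ j x y⟩⟩
  simpa using hC 0 ⟨le_rfl, h0.trans hr⟩ j x y

theorem KernelGradYSup.sizeBound {K : ℕ → Space n₁ n₂ → Space n₁ n₂ → ℂ} {R₀ r₀ : ℝ}
    (h : KernelGradYSup κ K R₀) (h0 : 0 ≤ r₀) (hr : r₀ ≤ R₀) :
    ∃ E, ∀ j x y, SizeBound κ j x y r₀ (normX κ (fun y' => K j x y') y) (E * 2 ^ ((j : ℝ) / 2)) := by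
  obtain ⟨-, C, hC⟩ := h
  refine ⟨C, fun j x y => ⟨?_, (hC r₀ ⟨h0, hr⟩ j x y).trans (le_of_eq (by ring))⟩⟩
  simpa using hC 0 ⟨le_rfl, h0.trans hr⟩ j x y

theorem KernelGradXSup.sizeBound {K : ℕ → Space n₁ n₂ → Space n₁ n₂ → ℂ} {R₀ r₀ : ℝ}
    (h : KernelGradXSup κ K R₀) (h0 : 0 ≤ r₀) (hr : r₀ ≤ R₀) {K₀ : ℝ} (hK₀ : 0 < K₀) :
    ∃ E, ∀ j x y, dist κ x y < K₀ →
      SizeBound κ j x y r₀ (normX κ (fun x' => K j x' y) x) (E * 2 ^ ((j : ℝ) / 2)) := by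
  obtain ⟨C, hC⟩ := h.2 K₀ hK₀
  refine ⟨C, fun j x y hxy => ⟨?_, (hC r₀ ⟨h0, hr⟩ j x y hxy).trans (le_of_eq (by ring))⟩⟩
  simpa using hC 0 ⟨le_rfl, h0.trans hr⟩ j x y hxy

/-! ### Dilated cells and annuli -/

variable {R c : ℕ} (hn : 1 ≤ n₁) (hN : 2 ^ (1 + 3 * κ) ≤ ((R * (2 + 2 * R) ^ κ : ℕ) : ℤ))
  (hc : 6 * (((R * (2 + 2 * R) ^ κ : ℕ) : ℤ) + 1) * 2 ^ (2 * κ) ≤ 2 ^ c)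

variable (n₁ n₂ κ R) in
/-- The ratio of the diameter of a dilated cell and the side length of the cell. -/
def outerConst : ℝ := 2 * (cellConst n₁ n₂ κ * (((R * (2 + 2 * R) ^ κ : ℕ) : ℝ) + 1))

variable (n₁ n₂ κ c) in
/-- The ratio of the volume of a dilated cell and the volume of a ball. -/
def starVolConst : ℝ :=
  2 ^ (c * n₁ + (c + κ * (c + 2)) * n₂) * (2 * n₁) ^ (κ * n₂) * 4 ^ (n₁ + n₂ + κ * n₂)

/-- The regularity conditions refer to a reference point `x` of the cell; since `ξ` has the same
coarser cells and dilates, all of them can be measured from `ξ`. -/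
theorem dist_of_mem_annulus {l : ℤ} {i : ℕ} {x ξ z y : Space n₁ n₂}
    (hξ : ξ ∈ (starGrid n₂ κ hn hN hc).cube l x) (hz : z ∈ (starGrid n₂ κ hn hN hc).cube l x)
    (hy : y ∈ (starGrid n₂ κ hn hN hc).annulus l x i) :
    dist κ ξ z ≤ cellConst n₁ n₂ κ * (2 ^ l)⁻¹ ∧
      R * (2 ^ (l - i))⁻¹ ≤ dist κ ξ y ∧
      dist κ ξ y ≤ outerConst n₁ n₂ κ R * (2 ^ (l - i))⁻¹ ∧
      volume ((starGrid n₂ κ hn hN hc).star (l - i - 1) x) ≤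
        ENNReal.ofReal (starVolConst n₁ n₂ κ c * modelVol κ ξ (2 ^ (l - i))⁻¹) := by
  set G := starGrid n₂ κ hn hN hc
  have hstar : ∀ k : ℤ, k ≤ l → G.star k x = G.star k ξ := fun k hk =>
    (G.star_eq_of_mem (G.cube_subset_cube hk x hξ)).symm
  obtain ⟨hy1, hy2⟩ := hy
  rw [hstar _ (by omega)] at hy1 hy2
  have hpow : ((2 : ℝ) ^ (l - i - 1))⁻¹ = 2 * (2 ^ (l - i))⁻¹ := by
    rw [zpow_sub_one₀ (by norm_num), mul_inv, inv_inv, mul_comm]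
  have hpos : (0 : ℝ) < (2 ^ (l - i))⁻¹ := by positivity
  refine ⟨?_, ?_, ?_, ?_⟩
  · refine dist_le_of_mem_cube (τ₁ := fun _ => 1) (τ₂ := fun _ => 1) hn ?_
    exact G.mem_cube.2 ((G.mem_cube.1 hz).trans (G.mem_cube.1 hξ).symm)
  · by_contra! h
    exact hy2 (mem_starSet_of_dist_le hn h.le)
  · have h := dist_le_of_mem_starSet hn (by positivity) hy1
    rw [hpow] at h
    refine h.trans (le_of_eq ?_)
    rw [outerConst]
    push_cast
    ring
  · rw [hstar _ (by omega)]
    refine (G.star_le _ _).trans ?_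
    have h1 : volume (G.cube (l - i - 1) ξ) ≤ _ :=
      (volume_adaptedGrid_cube (κ := κ) (τ₁ := fun _ => 1) (τ₂ := fun _ => 1) hn (l - i - 1) ξ).le.trans
        (gridVol_sndLevel_le hn _ ξ)
    have h2 : (G.starDbl : ℝ≥0∞) = ENNReal.ofReal (2 ^ (c * n₁ + (c + κ * (c + 2)) * n₂)) := by
      rw [ENNReal.ofReal_pow (by norm_num)]
      simp [G, starGrid]
    have h3 := modelVol_le (κ := κ) (a := 2) ξ ξ (r := (2 ^ (l - i - 1))⁻¹) (s := (2 ^ (l - i))⁻¹)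
      (by positivity) hpos.le hpow.le (le_add_of_nonneg_right (by positivity)) (by norm_num)
    calc (G.starDbl : ℝ≥0∞) * volume (G.cube (l - i - 1) ξ)
        ≤ ENNReal.ofReal (2 ^ (c * n₁ + (c + κ * (c + 2)) * n₂)) *
          ENNReal.ofReal ((2 * n₁) ^ (κ * n₂) * modelVol κ ξ (2 ^ (l - i - 1))⁻¹) := by
          rw [h2]
          gcongr
      _ ≤ _ := by
          rw [← ENNReal.ofReal_mul (by positivity)]
          refine ENNReal.ofReal_le_ofReal ?_
          calc _ ≤ (2 : ℝ) ^ (c * n₁ + (c + κ * (c + 2)) * n₂) * ((2 * n₁) ^ (κ * n₂) *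
                ((2 * 2) ^ (n₁ + n₂ + κ * n₂) * modelVol κ ξ (2 ^ (l - i))⁻¹)) := by gcongr
            _ = _ := by rw [starVolConst]; norm_num; ring

/-- The decay of the modulus of continuity over annuli of the given index. -/
def annulusDecay (i : ℕ) : ℝ := ((2 ^ (1 / 4 : ℝ)) ^ i)⁻¹

/-- The fourth power of the decay is `2^{-i}`, the ratio of the cell side to the annulus radius;
this is the `h ^ 4` of `exists_sub_le`. -/
theorem annulusDecay_pow (l : ℤ) (i : ℕ) (C : ℝ) :
    C * annulusDecay i ^ 4 * (2 ^ (l - i))⁻¹ = C * (2 ^ l)⁻¹ := by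
  have h : ((2 : ℝ) ^ (1 / 4 : ℝ)) ^ 4 = 2 := by
    rw [← Real.rpow_natCast, ← Real.rpow_mul (by norm_num)]
    norm_num
  rw [annulusDecay, inv_pow, ← pow_mul, mul_comm i 4, pow_mul, h, zpow_sub₀ (by norm_num),
    zpow_natCast]
  field_simp

theorem annulusDecay_pos (i : ℕ) : 0 < annulusDecay i := by
  rw [annulusDecay]
  positivity

theorem annulusDecay_le_one (i : ℕ) : annulusDecay i ≤ 1 :=
  inv_le_one_of_one_le₀ (one_le_pow₀ (one_lt_two_rpow (by norm_num)).le)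

theorem mul_enorm_le_ofReal {v : ℝ≥0∞} {a V b : ℝ} {w : ℂ} (ha : 0 ≤ a)
    (hv : v ≤ ENNReal.ofReal (a * V)) (h : V * ‖w‖ ≤ b) : v * ‖w‖ₑ ≤ ENNReal.ofReal (a * b) := by
  rw [← ofReal_norm]
  calc v * ENNReal.ofReal ‖w‖ ≤ ENNReal.ofReal (a * V) * ENNReal.ofReal ‖w‖ := by gcongr
    _ = ENNReal.ofReal (a * (V * ‖w‖)) := by
        rw [← ENNReal.ofReal_mul' (norm_nonneg _), mul_assoc]
    _ ≤ _ := ENNReal.ofReal_le_ofReal (by gcongr)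

theorem starVolConst_pos (hn : 1 ≤ n₁) : 0 < starVolConst n₁ n₂ κ c := by
  have : (0 : ℝ) < n₁ := by exact_mod_cast hn
  rw [starVolConst]
  positivity

/-- The gradient in `y` is controlled at all distances, so the bound decays geometrically in `i`,
uniformly in the level. -/
theorem exists_regular_right (hR1 : 1 ≤ R)
    (hR : 2 * quasiConst κ * (pathConst n₁ n₂ κ * cellConst n₁ n₂ κ) ≤ R)
    {K : ℕ → Space n₁ n₂ → Space n₁ n₂ → ℂ} {R₀ : ℝ} (hR₀ : homDim n₁ n₂ κ + 1 / 2 ≤ R₀)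
    (hK : KernelSup κ K R₀) (hKY : KernelGradYSup κ K R₀) :
    ∃ C : ℝ, 0 ≤ C ∧ ∀ (J : ℕ) (l : ℤ) (i : ℕ) (x ξ z y : Space n₁ n₂),
      ξ ∈ (starGrid n₂ κ hn hN hc).cube l x → z ∈ (starGrid n₂ κ hn hN hc).cube l x →
      y ∈ (starGrid n₂ κ hn hN hc).annulus l x i →
      volume ((starGrid n₂ κ hn hN hc).star (l - i - 1) x) *
        ‖∑ j ∈ Finset.range J, K j y ξ - ∑ j ∈ Finset.range J, K j y z‖ₑ ≤
        ENNReal.ofReal (C * annulusDecay i) := by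
  have hQ := homDim_nonneg (n₁ := n₁) (n₂ := n₂) (κ := κ)
  obtain ⟨C, hC, h⟩ := exists_sum_sub_le (n₂ := n₂) (κ := κ) hn
    (le_max_left 1 (outerConst n₁ n₂ κ R)) (cellConst_pos (n₂ := n₂) (κ := κ) hn)
  obtain ⟨E₁, hE₁⟩ := hK.sizeBound (by linarith) hR₀
  obtain ⟨E₂, hE₂⟩ := hKY.sizeBound hQ (by linarith)
  have hE : 0 ≤ E₁ := (hE₁ 0 0 0).nonneg (norm_nonneg _)
  have hv := starVolConst_pos (n₂ := n₂) (κ := κ) (c := c) hn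
  refine ⟨starVolConst n₁ n₂ κ c * (C * max E₁ E₂),
    mul_nonneg hv.le (mul_nonneg hC.le (hE.trans (le_max_left _ _))), ?_⟩
  intro J l i x ξ z y hξ hz hy
  obtain ⟨h1, h2, h3, h4⟩ := dist_of_mem_annulus hn hN hc hξ hz hy
  have hpos : (0 : ℝ) < (2 ^ (l - i))⁻¹ := by positivity
  have hlr : ((2 : ℝ) ^ l)⁻¹ ≤ (2 ^ (l - i))⁻¹ := by
    gcongr
    · norm_num
    · omega
  rw [mul_assoc]
  refine mul_enorm_le_ofReal hv.le h4 ?_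
  rw [← Finset.sum_sub_distrib]
  refine (mul_le_mul_of_nonneg_left (norm_sum_le _ _) (modelVol_pos ξ hpos).le).trans ?_
  refine h (fun j p => K j y p) y ξ z _ _ _ J (fun j => hKY.1 j y) hpos (annulusDecay_pos i)
    (annulusDecay_le_one i) (by rwa [annulusDecay_pow]) ?_ ?_ ?_
    (fun j p => ((hE₁ j y p).comm).mono (le_max_left _ _)) fun j p _ =>
      ((hE₂ j y p).comm).mono (by gcongr; exact le_max_right _ _)
  · rw [annulusDecay_pow]
    refine le_trans ?_ h2
    calc _ = 2 * quasiConst κ * (pathConst n₁ n₂ κ * cellConst n₁ n₂ κ) * (2 ^ l)⁻¹ := by ring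
      _ ≤ _ := by gcongr
  · refine le_trans ?_ h2
    have : (1 : ℝ) ≤ R := by exact_mod_cast hR1
    exact le_mul_of_one_le_left hpos.le this
  · refine h3.trans ?_
    gcongr
    exact le_max_right _ _

/-- The gradient in `x` is available only at bounded distance, so radii `r ≤ 1` and `r ≥ 1` are
treated differently. The second term carries the decay `r^{-1/2}` of large radii; written as a
minimum, its sum over `i` is bounded uniformly in `l`. -/
theorem exists_regular_left (hR1 : 1 ≤ R)
    (hR : 2 * quasiConst κ * (pathConst n₁ n₂ κ * cellConst n₁ n₂ κ) ≤ R)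
    {K : ℕ → Space n₁ n₂ → Space n₁ n₂ → ℂ} {R₀ R₁ : ℝ} (hR₀ : homDim n₁ n₂ κ + 1 / 2 ≤ R₀)
    (hK : KernelSup κ K R₀) (hR₁ : homDim n₁ n₂ κ ≤ R₁) (hKX : KernelGradXSup κ K R₁) :
    ∃ C : ℝ, 0 ≤ C ∧ ∀ (J : ℕ) (l : ℤ) (i : ℕ) (x ξ z y : Space n₁ n₂),
      ξ ∈ (starGrid n₂ κ hn hN hc).cube l x → z ∈ (starGrid n₂ κ hn hN hc).cube l x →
      y ∈ (starGrid n₂ κ hn hN hc).annulus l x i →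
      volume ((starGrid n₂ κ hn hN hc).star (l - i - 1) x) *
        ‖∑ j ∈ Finset.range J, K j ξ y - ∑ j ∈ Finset.range J, K j z y‖ₑ ≤
        ENNReal.ofReal (C * (annulusDecay i + min (((2 ^ (l - i))⁻¹ : ℝ) ^ (1 / 2 : ℝ))
          (((2 ^ (l - i))⁻¹ : ℝ) ^ (1 / 2 : ℝ))⁻¹)) := by
  have hQ := homDim_nonneg (n₁ := n₁) (n₂ := n₂) (κ := κ)
  have hq := one_le_quasiConst (κ := κ)
  have hP := one_le_pathConst (n₂ := n₂) (κ := κ) hn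
  have hcell := cellConst_pos (n₂ := n₂) (κ := κ) hn
  set A := max 1 (outerConst n₁ n₂ κ R)
  have hA : 1 ≤ A := le_max_left _ _
  obtain ⟨C, hC, h⟩ := exists_sum_sub_le (n₂ := n₂) (κ := κ) hn hA hcell
  obtain ⟨C', hC', h'⟩ := exists_sum_size_le (n₂ := n₂) (κ := κ) hn hA
    (c₀ := 1 / (2 * quasiConst κ)) (by positivity)
  obtain ⟨E₁, hE₁⟩ := hK.sizeBound (by linarith) hR₀
  -- For `r ≤ 1` the points of the path have distance at most `quasiConst κ * (2 * A)` from `y`; the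
  -- `+ 1` makes the inequality strict.
  obtain ⟨E₂, hE₂⟩ := hKX.sizeBound hQ hR₁ (K₀ := quasiConst κ * (2 * A) + 1) (by positivity)
  have hE : 0 ≤ E₁ := (hE₁ 0 0 0).nonneg (norm_nonneg _)
  have hE' : 0 ≤ max E₁ E₂ := hE.trans (le_max_left _ _)
  have hv := starVolConst_pos (n₂ := n₂) (κ := κ) (c := c) hn
  refine ⟨starVolConst n₁ n₂ κ c * (C * max E₁ E₂ + 2 * (C' * E₁)), by positivity, ?_⟩
  intro J l i x ξ z y hξ hz hy
  obtain ⟨h1, h2, h3, h4⟩ := dist_of_mem_annulus hn hN hc hξ hz hy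
  have hpos : (0 : ℝ) < (2 ^ (l - i))⁻¹ := by positivity
  have hlr : ((2 : ℝ) ^ l)⁻¹ ≤ (2 ^ (l - i))⁻¹ := by
    gcongr
    · norm_num
    · omega
  have hlpos : (0 : ℝ) < (2 ^ l)⁻¹ := by positivity
  set r : ℝ := (2 ^ (l - i))⁻¹
  set ρ : ℝ := (2 ^ l)⁻¹
  have hsep : 2 * quasiConst κ * (pathConst n₁ n₂ κ * (cellConst n₁ n₂ κ * ρ)) ≤ dist κ ξ y := by
    refine le_trans ?_ h2
    calc _ = 2 * quasiConst κ * (pathConst n₁ n₂ κ * cellConst n₁ n₂ κ) * ρ := by ring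
      _ ≤ _ := by gcongr
  have hry : r ≤ dist κ ξ y := by
    refine le_trans ?_ h2
    have : (1 : ℝ) ≤ R := by exact_mod_cast hR1
    exact le_mul_of_one_le_left hpos.le this
  have hyA : dist κ ξ y ≤ A * r := h3.trans (by gcongr; exact le_max_right _ _)
  have hPρ : pathConst n₁ n₂ κ * (cellConst n₁ n₂ κ * ρ) ≤ A * r := by
    have : 1 * (pathConst n₁ n₂ κ * (cellConst n₁ n₂ κ * ρ)) ≤
        2 * quasiConst κ * (pathConst n₁ n₂ κ * (cellConst n₁ n₂ κ * ρ)) := by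
      gcongr
      linarith
    linarith
  have hd := annulusDecay_pos i
  rw [mul_assoc]
  refine mul_enorm_le_ofReal hv.le h4 ?_
  rw [← Finset.sum_sub_distrib]
  refine (mul_le_mul_of_nonneg_left (norm_sum_le _ _) (modelVol_pos ξ hpos).le).trans ?_
  have hrpos : 0 < r ^ (1 / 2 : ℝ) := by positivity
  have hmin : 0 < min (r ^ (1 / 2 : ℝ)) (r ^ (1 / 2 : ℝ))⁻¹ := lt_min hrpos (inv_pos.2 hrpos)
  have e1 : 0 ≤ C * max E₁ E₂ := by positivity
  have e2 : 0 ≤ C' * E₁ := by positivity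
  rcases le_total r 1 with hr | hr
  · have := h (fun j p => K j p y) y ξ z r (annulusDecay i) (max E₁ E₂) J (fun j => hKX.1 j y) hpos hd
      (annulusDecay_le_one i) (by rwa [annulusDecay_pow]) (by rwa [annulusDecay_pow]) hry hyA
      (fun j p => (hE₁ j p y).mono (le_max_left _ _)) fun j p hp => by
        rw [annulusDecay_pow] at hp
        refine (hE₂ j p y ?_).mono (by gcongr; exact le_max_right _ _)
        rw [dist_comm] at hp
        have h5 := dist_triangle (x := p) (y := ξ) (z := y) (r := A * r) (s := A * r) (by positivity)
          (hp.trans hPρ) hyA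
        have h6 : quasiConst κ * (A * r + A * r) ≤ quasiConst κ * (2 * A) := by
          gcongr
          nlinarith
        linarith
    refine this.trans ?_
    nlinarith [mul_nonneg e1 hmin.le, mul_nonneg e2 hmin.le, mul_nonneg e2 hd.le]
  · have hn2 : ‖ξ.1‖ ≤ ‖y.1‖ + A * r := by
      rw [dist_comm] at hyA
      exact (norm_fst_le_add_dist (κ := κ) y ξ).trans (by linarith)
    -- For `r ≥ 1` no cancellation is used: the kernel is estimated at `ξ` and at `z` separately.
    have hnear : ∀ p, dist κ ξ p ≤ pathConst n₁ n₂ κ * (cellConst n₁ n₂ κ * ρ) →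
        modelVol κ ξ r * ∑ j ∈ Finset.range J, ‖K j p y‖ ≤ C' * E₁ * (r ^ (1 / 2 : ℝ))⁻¹ := by
      intro p hp
      refine h' (fun j => K j p y) y ξ p r E₁ J hr ?_ ?_ hn2 fun j => hE₁ j p y
      · have h1 := dist_triangle (y := p) (z := y) (s := dist κ p y)
          (by have := dist_nonneg (κ := κ) p y; positivity) hp le_rfl
        rw [one_div_mul_eq_div, div_le_iff₀ (by positivity)]
        linarith
      · rw [dist_comm] at hp
        exact (norm_fst_le_add_dist (κ := κ) p ξ).trans (by linarith)
    have hs1 := hnear ξ (by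
      have h1 := distSnd_le_rpow (κ := κ) ξ ξ
      rw [sub_self, norm_zero, Real.zero_rpow (by positivity)] at h1
      rw [dist_eq, sub_self, norm_zero, zero_add]
      exact h1.trans (by positivity))
    have hs2 := hnear z (h1.trans (le_mul_of_one_le_left (by positivity) hP))
    have hsum : ∑ j ∈ Finset.range J, ‖K j ξ y - K j z y‖ ≤
        ∑ j ∈ Finset.range J, ‖K j ξ y‖ + ∑ j ∈ Finset.range J, ‖K j z y‖ := by
      rw [← Finset.sum_add_distrib]
      exact Finset.sum_le_sum fun j _ => norm_sub_le _ _
    have hmin' : min (r ^ (1 / 2 : ℝ)) (r ^ (1 / 2 : ℝ))⁻¹ = (r ^ (1 / 2 : ℝ))⁻¹ := by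
      have : 1 ≤ r ^ (1 / 2 : ℝ) := Real.one_le_rpow hr (by norm_num)
      exact min_eq_right ((inv_le_one_of_one_le₀ this).trans this)
    have := mul_le_mul_of_nonneg_left hsum (modelVol_pos (κ := κ) ξ hpos).le
    rw [hmin'] at hmin ⊢
    nlinarith [mul_nonneg e1 hmin.le, mul_nonneg e1 hd.le, mul_nonneg e2 hd.le]

end Sums

end Grushin
end

/-! ### Strong convergence of the dyadic spectral pieces. -/

noncomputable section
namespace Grushin
open Filter Topology
variable {n₁ n₂ : ℕ}

/-! ### The spectral cutoffs converge to the identity -/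

section Spectral

variable {H : Type*} [NormedAddCommGroup H] [InnerProductSpace ℂ H]

theorem norm_sub_starProjection_le (U : Submodule ℂ H) [U.HasOrthogonalProjection] (f : H) {v : H}
    (hv : v ∈ U) : ‖f - U.starProjection f‖ ≤ ‖f - v‖ := by
  rw [U.starProjection_minimal]
  exact ciInf_le ⟨0, by rintro _ ⟨w, rfl⟩; exact norm_nonneg _⟩ (⟨v, hv⟩ : U)

theorem inner_inlH (h : H) (p : WithLp 2 (H × H)) : inner ℂ (inlH h) p = inner ℂ h p.fst := by
  rw [WithLp.prod_inner_apply]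
  simp [inlH]

variable [CompleteSpace H] (Γ : Submodule ℂ (WithLp 2 (H × H))) [Γ.HasOrthogonalProjection]

/-- The quadratic form is the squared norm of the projection of `(h, 0)` to `Γ`. Positivity follows,
and the kernel consists of the `h` with `(h, 0)` orthogonal to `Γ`. -/
theorem inner_invOneAddSq (h : H) : inner ℂ (invOneAddSq Γ h) h =
    inner ℂ (Γ.starProjection (inlH h)) (Γ.starProjection (inlH h)) := by
  rw [invOneAddSq, ContinuousLinearMap.comp_apply, ContinuousLinearMap.comp_apply,
    ContinuousLinearMap.adjoint_inner_left, Submodule.inner_starProjection_left_eq_right,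
    Submodule.inner_starProjection_left_eq_right,
    Submodule.starProjection_eq_self_iff.2 (Γ.starProjection_apply_mem (inlH h))]

theorem isPositive_invOneAddSq : (invOneAddSq Γ).IsPositive := by
  refine ContinuousLinearMap.isPositive_def'.2 ⟨isSelfAdjoint_invOneAddSq Γ, fun h => ?_⟩
  rw [ContinuousLinearMap.reApplyInnerSelf_apply, inner_invOneAddSq]
  exact inner_self_nonneg

/-- On the spectrum, where `s ≥ 0`, truncation changes `s` by `min s t ≤ t`. -/
theorem norm_cfc_sub_le {t : ℝ} (ht : 0 ≤ t) :
    ‖invOneAddSq Γ - cfc (fun s : ℝ => max (s - t) 0) (invOneAddSq Γ)‖ ≤ t := by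
  have hsa := isSelfAdjoint_invOneAddSq Γ
  have hpos : 0 ≤ invOneAddSq Γ :=
    (ContinuousLinearMap.nonneg_iff_isPositive _).2 (isPositive_invOneAddSq Γ)
  have h1 : invOneAddSq Γ - cfc (fun s : ℝ => max (s - t) 0) (invOneAddSq Γ) =
      cfc (fun s : ℝ => s - max (s - t) 0) (invOneAddSq Γ) := by
    rw [cfc_sub (fun s : ℝ => s) (fun s : ℝ => max (s - t) 0) (invOneAddSq Γ)
      (by fun_prop) (by fun_prop), cfc_id' ℝ (invOneAddSq Γ)]
  rw [h1]
  refine norm_cfc_le ht fun x hx => ?_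
  have hx0 : 0 ≤ x := spectrum_nonneg_of_nonneg hpos hx
  rw [Real.norm_eq_abs, abs_le]
  rcases le_total (x - t) 0 with h | h
  · rw [max_eq_right h]; constructor <;> linarith
  · rw [max_eq_left h]; constructor <;> linarith

theorem denseRange_invOneAddSq (hker : ∀ h, invOneAddSq Γ h = 0 → h = 0) :
    DenseRange (invOneAddSq Γ) := by
  have h1 : (LinearMap.range (invOneAddSq Γ).toLinearMap)ᗮ = ⊥ := by
    rw [ContinuousLinearMap.orthogonal_range, (isSelfAdjoint_invOneAddSq Γ).adjoint_eq]
    rw [LinearMap.ker_eq_bot']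
    exact hker
  have h2 := Submodule.topologicalClosure_eq_top_iff.2 h1
  have h3 := Submodule.dense_iff_topologicalClosure_eq_top.2 h2
  exact h3

/-- An injective self-adjoint operator has dense range, so `f` is close to some `R h` with `R = (1 +
A* A)⁻¹`. Then `(R - t)⁺ h` lies in the range of the cutoff and differs from `R h` by at most `t
‖h‖`, with `t = (1 + b²)⁻¹` tending to zero. The best approximation property of projections
concludes. -/
theorem tendsto_spectralCutoff (hker : ∀ h, invOneAddSq Γ h = 0 → h = 0) {ι : Type*} {l : Filter ι}
    {b : ι → ℝ} (hb : Tendsto b l atTop) (f : H) :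
    Tendsto (fun i => spectralCutoff Γ (b i) f) l (𝓝 f) := by
  rw [Metric.tendsto_nhds]
  intro ε hε
  obtain ⟨h, hh⟩ := (denseRange_invOneAddSq Γ hker).exists_dist_lt f (half_pos hε)
  have ht : Tendsto (fun i => (1 + b i ^ 2)⁻¹ * ‖h‖) l (𝓝 (0 * ‖h‖)) := by
    refine Tendsto.mul_const _ (tendsto_inv_atTop_zero.comp ?_)
    exact tendsto_atTop_add_const_left _ _ ((tendsto_pow_atTop (by norm_num)).comp hb)
  rw [zero_mul] at ht
  filter_upwards [ht.eventually_lt_const (half_pos hε)] with i hi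
  have hmem : cfc (fun s : ℝ => max (s - (1 + b i ^ 2)⁻¹) 0) (invOneAddSq Γ) h ∈
      (LinearMap.range (cfc (fun s : ℝ => max (s - (1 + b i ^ 2)⁻¹) 0)
        (invOneAddSq Γ) : H →L[ℂ] H).toLinearMap).topologicalClosure :=
    Submodule.le_topologicalClosure _ ⟨h, rfl⟩
  have h1 := norm_sub_starProjection_le _ f hmem
  have h2 := (ContinuousLinearMap.le_opNorm _ h).trans (mul_le_mul_of_nonneg_right
    (norm_cfc_sub_le Γ (t := (1 + b i ^ 2)⁻¹) (by positivity)) (norm_nonneg h))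
  rw [sub_apply] at h2
  rw [_root_.dist_comm, dist_eq_norm]
  rw [dist_eq_norm] at hh
  calc ‖f - spectralCutoff Γ (b i) f‖ ≤ _ := h1
    _ = ‖(f - invOneAddSq Γ h) + (invOneAddSq Γ h -
        cfc (fun s : ℝ => max (s - (1 + b i ^ 2)⁻¹) 0) (invOneAddSq Γ) h)‖ := by
        rw [sub_add_sub_cancel]
    _ ≤ _ := norm_add_le _ _
    _ < ε := by linarith

/-- Thus a vector in the kernel is orthogonal to the domain, and the resolvent is injective once the
domain is dense. -/
theorem inner_eq_zero_of_invOneAddSq_eq_zero {h : H} (hh : invOneAddSq Γ h = 0)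
    {p : WithLp 2 (H × H)} (hp : p ∈ Γ) : inner ℂ h p.fst = 0 := by
  have h1 := inner_invOneAddSq Γ h
  rw [hh, inner_zero_left, eq_comm, inner_self_eq_zero,
    Submodule.starProjection_apply_eq_zero_iff] at h1
  rw [← inner_inlH]
  exact Submodule.inner_left_of_mem_orthogonal hp h1

end Spectral

/-! ### The kernel of the resolvent of the Grushin operator -/

/-- Applied to the inclusions of the two factors, this writes both partial Laplacians through the
full second derivative, which makes the continuity of `grushinOp V φ` evident. -/
theorem laplacian_comp_affine {E F : Type*} [NormedAddCommGroup E] [InnerProductSpace ℝ E]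
    [FiniteDimensional ℝ E] [NormedAddCommGroup F] [NormedSpace ℝ F] {φ : F → ℂ}
    (hφ : ContDiff ℝ ∞ φ) (L : E →L[ℝ] F) (c : F) (u : E) :
    Laplacian.laplacian (fun u => φ (L u + c)) u =
      ∑ i, iteratedFDeriv ℝ 2 φ (L u + c) (fun _ => L (stdOrthonormalBasis ℝ E i)) := by
  rw [InnerProductSpace.laplacian_eq_iteratedFDeriv_stdOrthonormalBasis]
  have h1 : ContDiff ℝ ∞ (fun y => φ (y + c)) := hφ.comp (contDiff_id.add contDiff_const)
  have h2 := L.iteratedFDeriv_comp_right h1 u (i := 2) (by norm_cast)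
  have h3 : (fun u => φ (L u + c)) = (fun y => φ (y + c)) ∘ L := rfl
  rw [h3]
  dsimp only
  rw [h2, iteratedFDeriv_comp_add_right]
  refine Finset.sum_congr rfl fun i _ => ?_
  rw [ContinuousMultilinearMap.compContinuousLinearMap_apply]
  congr 1
  ext j
  fin_cases j <;> rfl

theorem IsPotential.continuous {κ : ℕ} {V : EuclideanSpace ℝ (Fin n₁) → ℝ} (hV : IsPotential κ V) :
    Continuous V := by
  rcases hV with rfl | rfl <;> fun_prop

theorem memLp_grushinOp {V : EuclideanSpace ℝ (Fin n₁) → ℝ} (hV : Continuous V)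
    {φ : Space n₁ n₂ → ℂ} (hφ : ContDiff ℝ ∞ φ) (hs : HasCompactSupport φ) :
    MemLp (grushinOp V φ) 2 volume := by
  set D := iteratedFDeriv ℝ 2 φ
  have hD : Continuous D := hφ.continuous_iteratedFDeriv (by norm_cast)
  have hDs : HasCompactSupport D := hs.iteratedFDeriv 2
  have h : grushinOp V φ = fun x =>
      -∑ i, D x (fun _ => ContinuousLinearMap.inl ℝ (EuclideanSpace ℝ (Fin n₁))
        (EuclideanSpace ℝ (Fin n₂)) (stdOrthonormalBasis ℝ _ i)) -
      (V x.1 : ℂ) * ∑ i, D x (fun _ => ContinuousLinearMap.inr ℝ (EuclideanSpace ℝ (Fin n₁))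
        (EuclideanSpace ℝ (Fin n₂)) (stdOrthonormalBasis ℝ _ i)) := by
    ext x
    have h1 := laplacian_comp_affine hφ (ContinuousLinearMap.inl ℝ (EuclideanSpace ℝ (Fin n₁))
        (EuclideanSpace ℝ (Fin n₂))) (0, x.2) x.1
    have h2 := laplacian_comp_affine hφ (ContinuousLinearMap.inr ℝ (EuclideanSpace ℝ (Fin n₁))
        (EuclideanSpace ℝ (Fin n₂))) (x.1, 0) x.2
    simp only [ContinuousLinearMap.inl_apply, ContinuousLinearMap.inr_apply, Prod.mk_add_mk,
      zero_add, add_zero] at h1 h2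
    rw [grushinOp, h1, h2]
    simp [D]
  have hev : ∀ v : Fin 2 → Space n₁ n₂, Continuous fun x => D x v := fun v =>
    (ContinuousMultilinearMap.apply ℝ (fun _ : Fin 2 => Space n₁ n₂) ℂ v).continuous.comp hD
  refine Continuous.memLp_of_hasCompactSupport ?_ ?_
  · rw [h]
    have hV' : Continuous fun x : Space n₁ n₂ => (V x.1 : ℂ) := by fun_prop
    exact (continuous_finsetSum _ fun i _ => hev _).neg.sub
      (hV'.mul (continuous_finsetSum _ fun i _ => hev _))
  · refine hDs.mono' fun x hx => subset_tsupport _ ?_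
    contrapose! hx
    rw [Function.notMem_support] at hx ⊢
    rw [h]
    simp [hx]

/-- The resolvent of the Grushin operator is injective. -/
theorem eq_zero_of_invOneAddSq_grushinGraph {V : EuclideanSpace ℝ (Fin n₁) → ℝ} (hV : Continuous V)
    {f : L2 n₁ n₂} (hf : invOneAddSq (grushinGraph V) f = 0) : f = 0 := by
  have key : ∀ φ : Space n₁ n₂ → ℂ, ContDiff ℝ ∞ φ → HasCompactSupport φ →
      ∫ x, inner ℂ (f x) (φ x) = 0 := by
    intro φ hφ hs
    have hφ2 : MemLp φ 2 (volume : Measure (Space n₁ n₂)) :=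
      hφ.continuous.memLp_of_hasCompactSupport hs
    -- The pair of `φ` and its image belongs to the graph, so `f` is orthogonal to every test
    -- function.
    have h1 := inner_eq_zero_of_invOneAddSq_eq_zero (grushinGraph V) hf
      (p := WithLp.toLp 2 (hφ2.toLp φ, (memLp_grushinOp hV hφ hs).toLp _))
      (Submodule.le_topologicalClosure _ (Submodule.subset_span
        ⟨φ, hφ, hs, hφ2.coeFn_toLp, (memLp_grushinOp hV hφ hs).coeFn_toLp⟩))
    rw [L2.inner_def] at h1
    rw [← h1]
    refine integral_congr_ae ?_
    filter_upwards [hφ2.coeFn_toLp] with x hx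
    change _ = inner ℂ (f x) (hφ2.toLp φ x)
    rw [hx]
  have hloc : LocallyIntegrable f (volume : Measure (Space n₁ n₂)) :=
    (Lp.memLp f).locallyIntegrable (by norm_num)
  refine (Lp.eq_zero_iff_ae_eq_zero).2 ?_
  refine ae_eq_zero_of_integral_contDiff_smul_eq_zero hloc fun g hg hgs => ?_
  have h1 := key (fun x => (g x : ℂ)) (Complex.ofRealCLM.contDiff.comp hg)
    (hgs.comp_left (g := fun t : ℝ => (t : ℂ)) Complex.ofReal_zero)
  have h2 : ∀ x, g x • f x = (starRingEnd ℂ) (inner ℂ (f x) (g x : ℂ)) := by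
    intro x
    simp [RCLike.inner_apply]
  simp_rw [h2]
  rw [integral_conj, h1, map_zero]

theorem tendsto_spectralCutoff_grushinGraph {V : EuclideanSpace ℝ (Fin n₁) → ℝ}
    (hV : Continuous V) (f : L2 n₁ n₂) :
    Tendsto (fun J : ℕ => spectralCutoff (grushinGraph V) (2 ^ J) f) atTop (𝓝 f) :=
  tendsto_spectralCutoff _ (fun _ h => eq_zero_of_invOneAddSq_grushinGraph hV h)
    (tendsto_pow_atTop_atTop_of_one_lt one_lt_two) f

theorem sum_dyadicProj (V : EuclideanSpace ℝ (Fin n₁) → ℝ) (J : ℕ) :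
    ∑ j ∈ Finset.range (J + 1), dyadicProj n₂ V j = spectralCutoff (grushinGraph V) (2 ^ J) := by
  induction J with
  | zero => simp [dyadicProj]
  | succ J ih =>
    rw [Finset.sum_range_succ, ih, dyadicProj]
    abel

end Grushin
end

noncomputable section
namespace Grushin
open Filter Topology
variable {n₁ n₂ : ℕ}

/-! ### The operator as a limit of Calderón-Zygmund operators -/

theorem IsIntegralKernel.zero : IsIntegralKernel (0 : L2 n₁ n₂ →L[ℂ] L2 n₁ n₂) 0 := by
  intro f hf
  exact Eventually.of_forall fun x => by simp

theorem IsIntegralKernel.add {A B : L2 n₁ n₂ →L[ℂ] L2 n₁ n₂}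
    {K L : Space n₁ n₂ → Space n₁ n₂ → ℂ} (hA : IsIntegralKernel A K) (hB : IsIntegralKernel B L) :
    IsIntegralKernel (A + B) (fun x y => K x y + L x y) := by
  intro f hf
  filter_upwards [hA f hf, hB f hf, Lp.coeFn_add (A hf.toL2) (B hf.toL2)] with x h1 h2 h3
  simp_rw [add_mul]
  refine ⟨h1.1.add h2.1, ?_⟩
  rw [integral_add h1.1 h2.1, ← h1.2, ← h2.2]
  exact h3

theorem IsIntegralKernel.sum {A : ℕ → L2 n₁ n₂ →L[ℂ] L2 n₁ n₂}
    {K : ℕ → Space n₁ n₂ → Space n₁ n₂ → ℂ} (h : ∀ j, IsIntegralKernel (A j) (K j)) (J : ℕ) :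
    IsIntegralKernel (∑ j ∈ Finset.range J, A j) (fun x y => ∑ j ∈ Finset.range J, K j x y) := by
  induction J with
  | zero =>
    simp only [Finset.range_zero, Finset.sum_empty]
    exact .zero
  | succ J ih =>
    simp_rw [Finset.sum_range_succ]
    exact ih.add (h J)

theorem tsum_ofReal_le {u : ℕ → ℝ} {C : ℝ} (hu : ∀ i, 0 ≤ u i)
    (h : ∀ J, ∑ i ∈ Finset.range J, u i ≤ C) : ∑' i, ENNReal.ofReal (u i) ≤ ENNReal.ofReal C := by
  refine ENNReal.tsum_le_of_sum_range_le fun J => ?_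
  rw [← ENNReal.ofReal_sum_of_nonneg fun i _ => hu i]
  exact ENNReal.ofReal_le_ofReal (h J)

theorem sum_annulusDecay_le (J : ℕ) : ∑ i ∈ Finset.range J, annulusDecay i ≤
    2 ^ (1 / 4 : ℝ) / (2 ^ (1 / 4 : ℝ) - 1) :=
  sum_inv_pow_le (one_lt_two_rpow (by norm_num)) J

theorem sum_min_scale_le (l : ℤ) (J : ℕ) :
    ∑ i ∈ Finset.range J, min (((2 ^ (l - i))⁻¹ : ℝ) ^ (1 / 2 : ℝ))
      (((2 ^ (l - i))⁻¹ : ℝ) ^ (1 / 2 : ℝ))⁻¹ ≤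
    4 * 2 ^ (1 / 2 : ℝ) / (2 ^ (1 / 2 : ℝ) - 1) := by
  have h : ∀ i : ℕ, (((2 : ℝ) ^ (l - i))⁻¹ : ℝ) ^ (1 / 2 : ℝ) =
      ((2 ^ l)⁻¹ : ℝ) ^ (1 / 2 : ℝ) * (2 ^ (1 / 2 : ℝ)) ^ i := by
    intro i
    rw [zpow_sub₀ (by norm_num), inv_div, div_eq_inv_mul, Real.mul_rpow (by positivity)
      (by positivity), zpow_natCast, ← Real.rpow_natCast, ← Real.rpow_natCast,
      ← Real.rpow_mul (by norm_num), ← Real.rpow_mul (by norm_num), mul_comm (i : ℝ)]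
  simp_rw [h]
  exact sum_min_inv_le (by positivity) (one_lt_two_rpow (by norm_num)) J

/-- The approximations are the partial sums in `j`; they converge strongly to `T` because the
spectral projections telescope to a cutoff tending to the identity. -/
theorem exists_czOperator {κ R c : ℕ} (hn : 1 ≤ n₁)
    (hN : 2 ^ (1 + 3 * κ) ≤ ((R * (2 + 2 * R) ^ κ : ℕ) : ℤ))
    (hc : 6 * (((R * (2 + 2 * R) ^ κ : ℕ) : ℤ) + 1) * 2 ^ (2 * κ) ≤ 2 ^ c) (hR1 : 1 ≤ R)
    (hR : 2 * quasiConst κ * (pathConst n₁ n₂ κ * cellConst n₁ n₂ κ) ≤ R)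
    {V : EuclideanSpace ℝ (Fin n₁) → ℝ} (hV : Continuous V) (T : L2 n₁ n₂ →L[ℂ] L2 n₁ n₂)
    {K : ℕ → Space n₁ n₂ → Space n₁ n₂ → ℂ}
    (hT : ∀ j, IsIntegralKernel (T ∘L dyadicProj n₂ V j) (K j))
    {R₀ R₁ : ℝ} (hR₀ : homDim n₁ n₂ κ + 1 / 2 ≤ R₀) (hK : KernelSup κ K R₀)
    (hKY : KernelGradYSup κ K R₀) (hR₁ : homDim n₁ n₂ κ ≤ R₁) (hKX : KernelGradXSup κ K R₁) :
    ∃ A : CZOperator (starGrid n₂ κ hn hN hc), A.T = T := by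
  obtain ⟨C₁, hC₁, h₁⟩ := exists_regular_right hn hN hc hR1 hR hR₀ hK hKY
  obtain ⟨C₂, hC₂, h₂⟩ := exists_regular_left hn hN hc hR1 hR hR₀ hK hR₁ hKX
  set m : ℤ → ℕ → ℝ := fun l i => min (((2 ^ (l - i))⁻¹ : ℝ) ^ (1 / 2 : ℝ))
    (((2 ^ (l - i))⁻¹ : ℝ) ^ (1 / 2 : ℝ))⁻¹
  have hm : ∀ l i, 0 ≤ m l i := fun l i => le_min (by positivity) (by positivity)
  have hd : ∀ i, 0 ≤ annulusDecay i := fun i => (annulusDecay_pos i).le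
  set B : ℝ := (C₁ + C₂) * (2 ^ (1 / 4 : ℝ) / (2 ^ (1 / 4 : ℝ) - 1) +
    4 * 2 ^ (1 / 2 : ℝ) / (2 ^ (1 / 2 : ℝ) - 1))
  refine ⟨{ T := T
            S := fun J => ∑ j ∈ Finset.range (J + 1), T ∘L dyadicProj n₂ V j
            k := fun J x y => ∑ j ∈ Finset.range (J + 1), K j x y
            w := fun l i => ENNReal.ofReal ((C₁ + C₂) * (annulusDecay i + m l i))
            W := B.toNNReal
            tendsto := fun f => ?_
            isIntegralKernel := fun J => IsIntegralKernel.sum hT (J + 1)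
            tsum_le := fun l => ?_
            regular_right := fun J l i x ξ z y hξ hz hy =>
              (h₁ (J + 1) l i x ξ z y hξ hz hy).trans (ENNReal.ofReal_le_ofReal ?_)
            regular_left := fun J l i x ξ z y hξ hz hy =>
              (h₂ (J + 1) l i x ξ z y hξ hz hy).trans (ENNReal.ofReal_le_ofReal ?_) }, rfl⟩
  · have h := (T.continuous.tendsto f).comp (tendsto_spectralCutoff_grushinGraph hV f)
    refine h.congr fun J => ?_
    rw [← ContinuousLinearMap.comp_finsetSum, sum_dyadicProj]
    rfl
  · refine tsum_ofReal_le (fun i => mul_nonneg (by positivity) (add_nonneg (hd i) (hm l i)))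
      fun J => ?_
    rw [← Finset.mul_sum, Finset.sum_add_distrib]
    exact mul_le_mul_of_nonneg_left (add_le_add (sum_annulusDecay_le J) (sum_min_scale_le l J))
      (by positivity)
  · exact mul_le_mul (by linarith) (by linarith [hm l i]) (hd i) (by positivity)
  · exact mul_le_mul_of_nonneg_right (by linarith) (add_nonneg (hd i) (hm l i))

end Grushin
end

/-! ### Choice of the constants and assembly of the theorem. -/

theorem mainTheorem5 (n₁ n₂ κ : ℕ) (hn₁ : 1 ≤ n₁) (hn₂ : 1 ≤ n₂) (hκ : 1 ≤ κ) :
    ∃ (m : ℕ) (𝒟 : Fin m → ℤ → Set (Set (Grushin.Space n₁ n₂))) (η : ℝ),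
      (∃ h₁ h₂ ε₀ δ₀ : ℝ, ∀ t, Grushin.IsDyadicDecomposition κ h₁ h₂ ε₀ δ₀ (𝒟 t)) ∧
      0 < η ∧ η < 1 ∧
      ∀ V : EuclideanSpace ℝ (Fin n₁) → ℝ, Grushin.IsPotential κ V →
      ∀ T : Grushin.L2 n₁ n₂ →L[ℂ] Grushin.L2 n₁ n₂,
      ∀ K : ℕ → Grushin.Space n₁ n₂ → Grushin.Space n₁ n₂ → ℂ,
        (∀ j, Grushin.IsIntegralKernel (T ∘L Grushin.dyadicProj n₂ V j) (K j)) →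
        (∃ R₀ : ℝ, Grushin.homDim n₁ n₂ κ + 1 / 2 ≤ R₀ ∧
          Grushin.KernelSup κ K R₀ ∧ Grushin.KernelGradYSup κ K R₀) →
        (∃ R₁ : ℝ, Grushin.homDim n₁ n₂ κ < R₁ ∧ Grushin.KernelGradXSup κ K R₁) →
        ∃ C : ℝ≥0, ∀ f : Grushin.Space n₁ n₂ → ℂ, ∀ hf : Grushin.IsBddCompactSupp f,
          ∃ S : Set (Set (Grushin.Space n₁ n₂)), S ⊆ (⋃ t, ⋃ k, 𝒟 t k) ∧ Grushin.IsSparse η S ∧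
            ∀ᵐ x, ‖T hf.toL2 x‖ₑ ≤ C * Grushin.sparseOperator 1 S f x := by
  open Grushin in
  -- `R` is the metric size of a dilate relative to its cell. The second condition keeps the annuli
  -- away from all paths between points of the cell; `4 ≤ R` makes the dilate contain the parent
  -- cell.
  obtain ⟨R, hR4, hR⟩ : ∃ R : ℕ, 4 ≤ R ∧
      2 * quasiConst κ * (pathConst n₁ n₂ κ * cellConst n₁ n₂ κ) ≤ R := by
    obtain ⟨R, hR⟩ := exists_nat_ge (2 * quasiConst κ * (pathConst n₁ n₂ κ * cellConst n₁ n₂ κ))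
    exact ⟨max 4 R, le_max_left _ _, hR.trans (by exact_mod_cast le_max_right 4 R)⟩
  have hN : 2 ^ (1 + 3 * κ) ≤ ((R * (2 + 2 * R) ^ κ : ℕ) : ℤ) := by
    have h : 2 ^ (1 + 3 * κ) ≤ R * (2 + 2 * R) ^ κ := by
      rw [pow_add, pow_mul]
      exact Nat.mul_le_mul (by omega) (Nat.pow_le_pow_left (by omega) κ)
    exact_mod_cast h
  obtain ⟨c, hc⟩ := pow_unbounded_of_one_lt
    (6 * (((R * (2 + 2 * R) ^ κ : ℕ) : ℤ) + 1) * 2 ^ (2 * κ)) one_lt_two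
  -- One grid for each choice of shift `0` or `1` in every coordinate: `2^{n₁+n₂}` grids, fixed with
  -- `D` and `η` before `V` and `T`.
  set e := (Fintype.equivFin ((Fin n₁ → Fin 2) × (Fin n₂ → Fin 2))).symm
  set D : ℝ≥0 := 2 ^ (c * n₁ + (c + κ * (c + 2)) * n₂)
  set 𝒢 := fun t => Grushin.adaptedGrid κ (fun i => (((e t).1 i : ℕ) : ℤ))
    (fun j => (((e t).2 j : ℕ) : ℤ)) hn₁
  refine ⟨_, fun t k => Set.range fun x => (𝒢 t).cube k x, 1 / (2 * (D + 1)),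
    ⟨_, _, _, _, fun t => Grushin.isDyadicDecomposition_adaptedGrid hn₁⟩, by positivity, ?_, ?_⟩
  · rw [div_lt_one (by positivity)]
    have := D.coe_nonneg
    linarith
  rintro V hV T K hT ⟨R₀, hR₀, hK, hKY⟩ ⟨R₁, hR₁, hKX⟩
  obtain ⟨A, rfl⟩ := Grushin.exists_czOperator hn₁ hN hc.le (by omega) hR hV.continuous T hT hR₀ hK
    hKY hR₁.le hKX
  have hadj : Grushin.IsAdjacent (Grushin.starGrid n₂ κ hn₁ hN hc.le) 𝒢 c D := by
    intro k x
    obtain ⟨t₁, t₂, h1, h2⟩ := Grushin.exists_adjacent_cube hn₁ hc.le k x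
    refine ⟨e.symm (t₁, t₂), ?_, ?_⟩
    · simp only [𝒢, Equiv.apply_symm_apply]
      exact h1
    · simp only [𝒢, Equiv.apply_symm_apply]
      exact h2
  obtain ⟨C, hC⟩ := A.exists_sparse_domination hadj
    (fun t t' k k' x x' h => Grushin.adaptedGrid_level_eq hn₁ h) (x₀ := 0)
    (fun s hs => Grushin.exists_subset_adaptedGrid_cube hn₁ hs)
  refine ⟨C, fun f hf => ?_⟩
  obtain ⟨S, hS1, hS2, hS3⟩ := hC f hf
  refine ⟨S, fun Q hQ => ?_, hS2, hS3⟩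
  obtain ⟨t, k, x, rfl⟩ := hS1 Q hQ
  exact Set.mem_iUnion.2 ⟨t, Set.mem_iUnion.2 ⟨k, x, rfl⟩⟩
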